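/- Throughout, matroids may be infinite, and a matroid is connected if it is $2$-connected, i.e. has no $1$-separation. A graph-like space $G$ is a topological space on the set $V\sqcup((0,1)\times E)$ with vertex set $V$ and edge set $E$, together with continuous maps $\iota_e:[0,1]\to G$ for $e\in E$ such that $\iota_e(0),\iota_e(1)\in V$, $\iota_e(x)=(x,e)$ for $0<x<1$, $\iota_e\restriction(0,1)$ is open, and any two distinct vertices lie in different members of some pair of disjoint open sets that together cover $V$. A map of graph-like spaces is a continuous map sending vertices to vertices and, for each edge $e$, either collapsing all of $(0,1)\times\{e\}$ to one vertex or sending it onto $(0,1)\times\{f\}$ for some edge $f$ by $(r,e)\mapsto(r,f)$ or by $(r,e)\mapsto(1-r,f)$. Removing an edge means removing its interior points. A pseudo-line is a compact connected graph-like space with two vertices $s,t$ such that removing any edge separates $s$ from $t$ and any two vertices can be separated by removing one edge; a pseudo-circle is a compact connected graph-like space with at least one edge such that removing any edge does not disconnect it, removing any pair of edges does, and any two vertices can be separated by removing a pair of edges. Pseudo-arcs and pseudo-circles in $G$ are (images of) injective maps of graph-like spaces into $G$ from a pseudo-line and from a pseudo-circle, respectively; a pseudo-arc joins the images of $s$ and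 $t$ ($s=t$ is allowed, for a pseudo-line consisting of one vertex). $\hat G$ is the subspace of $G$ with the same edges and with the vertices of $G$ that lie on at least one edge or pseudo-circle of $G$. For $X\subseteq E$, the standard subspace $\bar X$ of $G$ is the subspace with edge set $X$ and with the vertices in the closure of $(0,1)\times X$. A set $H$ of points of $G$ is pseudo-arc connected in $G$ if either it is a connected set of interior points of one edge, or any two vertices in $H$ are joined by a pseudo-arc of $G$ included in $H$ and any interior point in $H$ of an edge $e$ can be joined to an endvertex of $e$ by an arc in $H\cap\iota_e([0,1])$. A graph-like space $G$ is locally pseudo-arc connected if every open neighbourhood $U$ of any vertex $x$ of $G$ includes an open neighbourhood $U'$ of $x$ that is pseudo-arc connected in $G$. A graph framework $\Gamma$ on a matroid $M$ with ground set $E$ requires $M$ to be tame (circuit-cocircuit intersections are finite) and consists of functions $c_o:o\to\{-1,1\}$ for each circuit $o$, and $d_b:b\to\{-1,1\}$ and $\sigma_b:E\setminus b\to\{-1,1\}$ for each cocircuit $b$, such that $\sum_{e\in o\cap b}c_o(e)d_b(e)=0$ for all $o,b$; for each circuit $o$ the relation $R_o$, where $[e,f,g]_{R_o}$ holds iff $e,f,g\in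 o$ are distinct and some cocircuit $b$ has $b\cap o=\{e,f\}$ and $\sigma_b(g)=c_o(f)d_b(f)$, is a cyclic order on $o$; and for each circuit $o$, cocircuit $b$, finite $s$ with $o\cap b\subseteq s\subseteq o$, and distinct $p,q\in s$ with $[p,q,g]_{R_o}$ for all $g\in s\setminus\{p,q\}$: (1) if $p,q\in b$ then $c_o(p)d_b(p)=-c_o(q)d_b(q)$; (2) if $p,q\notin b$ then $\sigma_b(p)=\sigma_b(q)$; (3) if $p\in b$, $q\notin b$ then $c_o(p)d_b(p)=\sigma_b(q)$; (4) if $p\notin b$, $q\in b$ then $c_o(q)d_b(q)=-\sigma_b(p)$. The graph-like space $G(M,\Gamma)$ has edge set $E$ and vertex set $\{-1,1\}^{\mathcal C^*(M)}$, where $\mathcal C^*(M)$ is the set of cocircuits of $M$. Its edges satisfy $\iota_e(0)(b)=\iota_e(1)(b)=\sigma_b(e)$ if $e\notin b$, and $\iota_e(0)(b)=-d_b(e)$, $\iota_e(1)(b)=d_b(e)$ if $e\in b$. Its topology is generated by the sets $W\times\{e\}$ with $W\subseteq(0,1)$ open and $e\in E$, and the sets $$U_b^i(\epsilon)=\{v: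 v(b)=i\}\cup\bigcup_{e\notin b,\ \sigma_b(e)=i}(0,1)\times\{e\}\cup\bigcup_{e\in b,\ d_b(e)=i}(1-\epsilon(e),1)\times\{e\}\cup\bigcup_{e\in b,\ d_b(e)=-i}(0,\epsilon(e))\times\{e\}$$ for $b\in\mathcal C^*(M)$, $i\in\{-1,1\}$ and $\epsilon:b\to(0,1)$. Let $\hat G(M,\Gamma)=\widehat{G(M,\Gamma)}$. **Theorem.** Let $M$ be a connected matroid with a graph framework $\Gamma$ on it. If $X$ is a set of edges such that the standard subspace $\bar X$ of $\hat G(M,\Gamma)$ is pseudo-arc connected, then $\bar X$, as a graph-like space, is locally pseudo-arc connected. Moreover, $\hat G(M,\Gamma)$ itself is locally pseudo-arc connected. -/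

import Mathlib

open Set

universe u

/-! ### Infinite matroids: tameness, separations, connectedness -/

/-- A matroid is tame if every circuit meets every cocircuit in a finite set. -/
def Matroid.Tame {α : Type u} (M : Matroid α) : Prop :=
  ∀ o b : Set α, M.IsCircuit o → M.IsCocircuit b → (o ∩ b).Finite

/-- `(A, B)` is a `k`-separation of `M`: a partition of the ground set into two sets of size at
least `k`, with bases `sA` of `A`, `sB` of `B` and `s` of `M` such that `|(sA ∪ sB) \ s| < k`. -/
def Matroid.IsKSeparation {α : Type u} (M : Matroid α) (k : ℕ) (A B : Set α) : Prop :=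
  A ∪ B = M.E ∧ Disjoint A B ∧ (k : ℕ∞) ≤ A.encard ∧ (k : ℕ∞) ≤ B.encard ∧
    ∃ sA sB s : Set α, M.IsBasis sA A ∧ M.IsBasis sB B ∧ M.IsBase s ∧
      ((sA ∪ sB) \ s).encard < (k : ℕ∞)

/-- A matroid is `k`-connected if it has no `l`-separation for any `l < k`. -/
def Matroid.KConnected {α : Type u} (M : Matroid α) (k : ℕ) : Prop :=
  ∀ l < k, ∀ A B : Set α, ¬ M.IsKSeparation l A B

/-- A matroid is connected if it is `2`-connected. -/
def Matroid.IsConnectedMatroid {α : Type u} (M : Matroid α) : Prop :=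
  M.KConnected 2

/-! ### Graph-like spaces -/

/-- The underlying set `V ⊔ ((0,1) × E)` of a graph-like space. -/
inductive GraphLikePoint (V E : Type u) : Type u
  /-- a vertex -/
  | vertex (v : V) : GraphLikePoint V E
  /-- the interior point `(r, e)` of the edge `e` -/
  | edgePt (r : Ioo (0 : ℝ) 1) (e : E) : GraphLikePoint V E

namespace GraphLikePoint

open scoped Classical in
/-- The map `ι_e : [0,1] → V ⊔ ((0,1) × E)` with `ι_e(0) = src e`, `ι_e(1) = tgt e` and
`ι_e(x) = (x, e)` for `0 < x < 1`. -/
noncomputable def edgeMap {V E : Type u} (src tgt : E → V) (e : E) (x : unitInterval) :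
    GraphLikePoint V E :=
  if h0 : x = 0 then vertex (src e)
  else if h1 : x = 1 then vertex (tgt e)
  else edgePt ⟨(x : ℝ), unitInterval.pos_iff_ne_zero.2 h0, unitInterval.lt_one_iff_ne_one.2 h1⟩ e

end GraphLikePoint

/-- A graph-like space. The maps `ι_e` are recorded through the endvertices `src e = ι_e(0)` and
`tgt e = ι_e(1)`, which determine them. -/
structure GraphLikeSpace : Type (u + 1) where
  /-- the vertex set -/
  V : Type u
  /-- the edge set -/
  E : Type u
  /-- `ι_e(0)` -/
  src : E → V
  /-- `ι_e(1)` -/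
  tgt : E → V
  /-- the topology -/
  top : TopologicalSpace (GraphLikePoint V E)
  continuous_edge : ∀ e : E, Continuous (GraphLikePoint.edgeMap src tgt e)
  isOpenMap_inner : ∀ e : E,
    IsOpenMap (fun r : Ioo (0 : ℝ) 1 => (GraphLikePoint.edgePt r e : GraphLikePoint V E))
  separated : ∀ v v' : V, v ≠ v' → ∃ U U' : Set (GraphLikePoint V E),
    IsOpen U ∧ IsOpen U' ∧ Disjoint U U' ∧
      (∀ w : V, GraphLikePoint.vertex w ∈ U ∨ GraphLikePoint.vertex w ∈ U') ∧
      GraphLikePoint.vertex v ∈ U ∧ GraphLikePoint.vertex v' ∈ U'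

namespace GraphLikeSpace

open GraphLikePoint

/-- The points of a graph-like space. -/
abbrev Point (G : GraphLikeSpace.{u}) : Type u := GraphLikePoint G.V G.E

instance instTopologicalSpacePoint (G : GraphLikeSpace.{u}) : TopologicalSpace G.Point := G.top

/-- The map `ι_e : [0,1] → G`. -/
noncomputable def edge (G : GraphLikeSpace.{u}) (e : G.E) : unitInterval → G.Point :=
  edgeMap G.src G.tgt e

/-- The set of interior points of the edges in `F`, i.e. `(0,1) × F`. -/
def innerPoints (G : GraphLikeSpace.{u}) (F : Set G.E) : Set G.Point :=
  {p | ∃ r : Ioo (0 : ℝ) 1, ∃ e ∈ F, p = edgePt r e}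

/-! ### Maps of graph-like spaces -/

/-- The function on points induced by `φV : V(G) → V(G')` and
`φE : E(G) → (E(G') × {+,-}) ⊔ V(G')`; the sign `+` is `true` and `-` is `false`. -/
def inducedFun {V E V' E' : Type u} (φV : V → V') (φE : E → (E' × Bool) ⊕ V') :
    GraphLikePoint V E → GraphLikePoint V' E'
  | vertex v => vertex (φV v)
  | edgePt r e =>
    match φE e with
    | Sum.inl (f, true) => edgePt r f
    | Sum.inl (f, false) => edgePt ⟨1 - (r : ℝ), sub_pos.2 r.2.2, sub_lt_self 1 r.2.1⟩ f
    | Sum.inr v => vertex v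

/-- A map of graph-like spaces. -/
structure Hom (G G' : GraphLikeSpace.{u}) : Type u where
  /-- the action on vertices -/
  onV : G.V → G'.V
  /-- the action on edges -/
  onE : G.E → (G'.E × Bool) ⊕ G'.V
  continuous_inducedFun :
    Continuous (inducedFun onV onE : G.Point → G'.Point)

/-- The function on points underlying a map of graph-like spaces. -/
def Hom.toFun {G G' : GraphLikeSpace.{u}} (φ : Hom G G') : G.Point → G'.Point :=
  inducedFun φ.onV φ.onE

/-! ### Pseudo-lines, pseudo-arcs and pseudo-circles -/

/-- What remains of `G` after removing the edges in `F` (that is, their interior points). -/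
def removeEdges (G : GraphLikeSpace.{u}) (F : Set G.E) : Set G.Point :=
  (G.innerPoints F)ᶜ

/-- Removing the edges in `F` separates `v` from `w`: they are in different components of what
remains. -/
def EdgesSeparate (G : GraphLikeSpace.{u}) (F : Set G.E) (v w : G.V) : Prop :=
  (vertex w : G.Point) ∉ connectedComponentIn (G.removeEdges F) (vertex v)

/-- `L` is a pseudo-line with start-vertex `s` and end-vertex `t`. -/
structure IsPseudoLine (L : GraphLikeSpace.{u}) (s t : L.V) : Prop where
  compact : CompactSpace L.Point
  connected : ConnectedSpace L.Point
  edge_separates : ∀ e : L.E, L.EdgesSeparate {e} s t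
  exists_separating : ∀ v w : L.V, v ≠ w → ∃ e : L.E, L.EdgesSeparate {e} v w

/-- `C` is a pseudo-circle. -/
structure IsPseudoCircle (C : GraphLikeSpace.{u}) : Prop where
  compact : CompactSpace C.Point
  connected : ConnectedSpace C.Point
  nonempty_edges : Nonempty C.E
  remove_one : ∀ e : C.E, IsConnected (C.removeEdges {e})
  remove_two : ∀ e f : C.E, e ≠ f → ¬ IsConnected (C.removeEdges {e, f})
  exists_separating : ∀ v w : C.V, v ≠ w → ∃ e f : C.E, e ≠ f ∧ C.EdgesSeparate {e, f} v w

/-- `v` and `w` are joined by a pseudo-arc of `G` (an injective map of graph-like spaces from a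
pseudo-line to `G`) that is included in the set of points `H`. -/
def JoinedByPseudoArcIn (G : GraphLikeSpace.{u}) (H : Set G.Point) (v w : G.V) : Prop :=
  ∃ (L : GraphLikeSpace.{u}) (s t : L.V) (φ : Hom L G), L.IsPseudoLine s t ∧
    Function.Injective φ.toFun ∧ φ.onV s = v ∧ φ.onV t = w ∧ range φ.toFun ⊆ H

/-- The vertex `v` lies on a pseudo-circle of `G` (the image of an injective map of graph-like
spaces from a pseudo-circle to `G`). -/
def LiesOnPseudoCircle (G : GraphLikeSpace.{u}) (v : G.V) : Prop :=
  ∃ (C : GraphLikeSpace.{u}) (φ : Hom C G), C.IsPseudoCircle ∧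
    Function.Injective φ.toFun ∧ (vertex v : G.Point) ∈ range φ.toFun

/-- A set `H` of points of `G` is pseudo-arc connected (in `G`) if it is a connected set of interior
points of one edge, or else any two vertices in `H` can be joined by a pseudo-arc of `G` included
in `H` and any interior point in `H` of an edge `e` can be joined to an endvertex of `e` by an arc
in `H ∩ ι_e[0,1]`. -/
def IsPseudoArcConnected (G : GraphLikeSpace.{u}) (H : Set G.Point) : Prop :=
  (∃ e : G.E, H ⊆ G.innerPoints {e} ∧ IsPreconnected H) ∨
    ((∀ v w : G.V, vertex v ∈ H → vertex w ∈ H → G.JoinedByPseudoArcIn H v w) ∧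
      ∀ (e : G.E) (r : Ioo (0 : ℝ) 1), edgePt r e ∈ H →
        ∃ γ : unitInterval → G.Point, Continuous γ ∧ Function.Injective γ ∧
          γ 0 = edgePt r e ∧ (γ 1 = vertex (G.src e) ∨ γ 1 = vertex (G.tgt e)) ∧
          range γ ⊆ H ∩ range (G.edge e))

/-- Local pseudo-arc connectedness of a graph-like space. -/
def LocallyPseudoArcConnected (G : GraphLikeSpace.{u}) : Prop :=
  ∀ (x : G.V) (U : Set G.Point), IsOpen U → vertex x ∈ U →
    ∃ U' : Set G.Point, U' ⊆ U ∧ IsOpen U' ∧ vertex x ∈ U' ∧ G.IsPseudoArcConnected U'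

/-! ### Subspaces -/

/-- The inclusion of the points on a subset of the vertices and a subset of the edges. -/
def inclusion {V E : Type u} (V' : Set V) (E' : Set E) :
    GraphLikePoint V' E' → GraphLikePoint V E
  | vertex v => vertex v
  | edgePt r e => edgePt r e

theorem inclusion_edgeMap {V E : Type u} (V' : Set V) (E' : Set E) (src tgt : E → V)
    (h0 : ∀ e ∈ E', src e ∈ V') (h1 : ∀ e ∈ E', tgt e ∈ V') (e : E') (x : unitInterval) :
    inclusion V' E' (edgeMap (fun e : E' => (⟨src e, h0 e e.2⟩ : V'))
      (fun e : E' => (⟨tgt e, h1 e e.2⟩ : V')) e x) = edgeMap src tgt (e : E) x := by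
  unfold edgeMap
  split_ifs <;> rfl

/-- The graph-like subspace of `G` with vertex set `V'` and edge set `E'`, where `V'` contains all
endvertices of edges in `E'`; it carries the subspace topology. -/
def subspace (G : GraphLikeSpace.{u}) (V' : Set G.V) (E' : Set G.E)
    (h0 : ∀ e ∈ E', G.src e ∈ V') (h1 : ∀ e ∈ E', G.tgt e ∈ V') : GraphLikeSpace.{u} where
  V := V'
  E := E'
  src e := ⟨G.src e, h0 e e.2⟩
  tgt e := ⟨G.tgt e, h1 e e.2⟩
  top := TopologicalSpace.induced (inclusion V' E') G.top
  continuous_edge e := by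
    let _ := G.top
    refine continuous_induced_rng.2 ?_
    have h : inclusion V' E' ∘ (edgeMap (fun e : E' => (⟨G.src e, h0 e e.2⟩ : V'))
        (fun e : E' => (⟨G.tgt e, h1 e e.2⟩ : V')) e) = edgeMap G.src G.tgt (e : G.E) :=
      funext fun x => inclusion_edgeMap V' E' G.src G.tgt h0 h1 e x
    rw [h]
    exact G.continuous_edge e
  isOpenMap_inner e := by
    let _ := G.top
    intro W hW
    refine isOpen_induced_iff.2 ⟨_, G.isOpenMap_inner (e : G.E) W hW, ?_⟩
    ext p
    cases p with
    | vertex v => simp [inclusion]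
    | edgePt r f => simp [inclusion, Subtype.ext_iff]
  separated v v' hv := by
    let _ := G.top
    obtain ⟨U, U', hU, hU', hd, hc, hm, hm'⟩ :=
      G.separated v v' (fun h => hv (Subtype.ext h))
    exact ⟨inclusion V' E' ⁻¹' U, inclusion V' E' ⁻¹' U', isOpen_induced_iff.2 ⟨U, hU, rfl⟩,
      isOpen_induced_iff.2 ⟨U', hU', rfl⟩, hd.preimage _, fun w => hc w, hm, hm'⟩

/-- The vertices of `Ĝ`: those lying on at least one edge or pseudo-circle of `G`. -/
def hatVertices (G : GraphLikeSpace.{u}) : Set G.V :=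
  {v | (∃ e : G.E, G.src e = v ∨ G.tgt e = v) ∨ G.LiesOnPseudoCircle v}

/-- The subspace `Ĝ` of `G`, with all edges of `G` and with the vertices of `G` that lie on at
least one edge or pseudo-circle of `G`. -/
def hat (G : GraphLikeSpace.{u}) : GraphLikeSpace.{u} :=
  G.subspace G.hatVertices univ (fun e _ => Or.inl ⟨e, Or.inl rfl⟩)
    (fun e _ => Or.inl ⟨e, Or.inr rfl⟩)

/-- The vertices in the closure of `(0,1) × R`. -/
def closureVertices (G : GraphLikeSpace.{u}) (R : Set G.E) : Set G.V :=
  {v | (vertex v : G.Point) ∈ closure (G.innerPoints R)}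

theorem edge_mem_closure (G : GraphLikeSpace.{u}) {R : Set G.E} {e : G.E} (he : e ∈ R)
    (x : unitInterval) : G.edge e x ∈ closure (G.innerPoints R) := by
  have hd : Dense (Ioo (0 : unitInterval) 1) := by
    rw [dense_iff_closure_eq, closure_Ioo (zero_ne_one)]
    exact Set.eq_univ_of_forall fun y => ⟨unitInterval.nonneg y, unitInterval.le_one y⟩
  have hx : x ∈ closure (Ioo (0 : unitInterval) 1) := hd x
  refine map_mem_closure (G.continuous_edge e) hx ?_
  intro y hy
  have h0 : y ≠ 0 := ne_of_gt hy.1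
  have h1 : y ≠ 1 := ne_of_lt hy.2
  refine ⟨⟨(y : ℝ), unitInterval.pos_iff_ne_zero.2 h0, unitInterval.lt_one_iff_ne_one.2 h1⟩,
    e, he, ?_⟩
  simp [edge, edgeMap, h0, h1]

/-- The standard subspace `R̄` of `G` with edge set `R`: its edges are those in `R`, and its
vertices are those in the closure of `(0,1) × R`. -/
def standardSubspace (G : GraphLikeSpace.{u}) (R : Set G.E) : GraphLikeSpace.{u} :=
  G.subspace (G.closureVertices R) R
    (fun e he => by
      have h := G.edge_mem_closure he 0
      simpa [edge, edgeMap, closureVertices] using h)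
    (fun e he => by
      have h := G.edge_mem_closure he 1
      simpa [edge, edgeMap, closureVertices] using h)

/-- The set of points of the standard subspace `R̄`, as a subset of `G`. -/
def standardSet (G : GraphLikeSpace.{u}) (R : Set G.E) : Set G.Point :=
  range (inclusion (G.closureVertices R) R)

end GraphLikeSpace

/-! ### Graph frameworks -/

/-- The axioms for `R` to be a cyclic order on the set `X`. -/
structure IsCyclicOrderOn {α : Type u} (X : Set α) (R : α → α → α → Prop) : Prop where
  mem : ∀ a b c, R a b c → a ∈ X ∧ b ∈ X ∧ c ∈ X
  cyclic : ∀ a b c, R a b c → R b c a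
  asymm : ∀ a b c, R a b c → ¬ R c b a
  trans : ∀ a b c d, R a b c → R a c d → R a b d
  total : ∀ a ∈ X, ∀ b ∈ X, ∀ c ∈ X, a ≠ b → b ≠ c → a ≠ c → R a b c ∨ R c b a

/-- A signing of a tame matroid `M`, with signs in `ℤˣ = {1, -1}`. Only the values `c o e` for
circuits `o` and `e ∈ o`, and `d b e` for cocircuits `b` and `e ∈ b`, carry meaning. -/
structure Matroid.Signing {α : Type u} (M : Matroid α) : Type u where
  tame : M.Tame
  /-- the functions `c_o : o → {1, -1}` -/
  c : Set α → α → ℤˣ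
  /-- the functions `d_b : b → {1, -1}` -/
  d : Set α → α → ℤˣ
  sum_eq_zero : ∀ (o b : Set α) (ho : M.IsCircuit o) (hb : M.IsCocircuit b),
    ∑ e ∈ (tame o b ho hb).toFinset, ((c o e : ℤ) * (d b e : ℤ)) = 0

/-- The relation `R_o` that a signing together with maps `σ_b` defines on the circuit `o`. -/
def Matroid.Signing.cyc {α : Type u} {M : Matroid α} (S : M.Signing) (σ : Set α → α → ℤˣ)
    (o : Set α) (e f g : α) : Prop :=
  (e ∈ o ∧ f ∈ o ∧ g ∈ o) ∧ (e ≠ f ∧ f ≠ g ∧ e ≠ g) ∧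
    ∃ b : Set α, M.IsCocircuit b ∧ b ∩ o = {e, f} ∧ σ b g = S.c o f * S.d b f

/-- `p` and `q` are clockwise adjacent in the restriction of the relation `R` to `s`. -/
def ClockwiseAdjacent {α : Type u} (R : α → α → α → Prop) (s : Set α) (p q : α) : Prop :=
  p ∈ s ∧ q ∈ s ∧ p ≠ q ∧ ∀ g ∈ s, g ≠ p → g ≠ q → R p q g

/-- A graph framework on the matroid `M`. Only the values `σ b e` for cocircuits `b` and
`e ∈ M.E \ b` carry meaning. -/
structure Matroid.GraphFramework {α : Type u} (M : Matroid α) : Type u extends M.Signing where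
  /-- the functions `σ_b : E \ b → {1, -1}` -/
  σ : Set α → α → ℤˣ
  isCyclicOrder : ∀ o : Set α, M.IsCircuit o → IsCyclicOrderOn o (toSigning.cyc σ o)
  /-- In `R_o`, the edges `e, f, g` being in cyclic order does not depend on the witness `b`. -/
  independent : ∀ (o b b' : Set α) (e f g : α), M.IsCircuit o → M.IsCocircuit b →
    M.IsCocircuit b' → e ∈ o → f ∈ o → g ∈ o → e ≠ f → f ≠ g → e ≠ g →
    b ∩ o = {e, f} → b' ∩ o = {e, f} →
    (σ b g = c o f * d b f ↔ σ b' g = c o f * d b' f)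
  adjacent_mem_mem : ∀ (o b s : Set α) (p q : α), M.IsCircuit o → M.IsCocircuit b →
    s.Finite → b ∩ o ⊆ s → s ⊆ o → ClockwiseAdjacent (toSigning.cyc σ o) s p q →
    p ∈ b → q ∈ b → c o p * d b p = -(c o q * d b q)
  adjacent_not_not : ∀ (o b s : Set α) (p q : α), M.IsCircuit o → M.IsCocircuit b →
    s.Finite → b ∩ o ⊆ s → s ⊆ o → ClockwiseAdjacent (toSigning.cyc σ o) s p q →
    p ∉ b → q ∉ b → σ b p = σ b q
  adjacent_mem_not : ∀ (o b s : Set α) (p q : α), M.IsCircuit o → M.IsCocircuit b →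
    s.Finite → b ∩ o ⊆ s → s ⊆ o → ClockwiseAdjacent (toSigning.cyc σ o) s p q →
    p ∈ b → q ∉ b → c o p * d b p = σ b q
  adjacent_not_mem : ∀ (o b s : Set α) (p q : α), M.IsCircuit o → M.IsCocircuit b →
    s.Finite → b ∩ o ⊆ s → s ⊆ o → ClockwiseAdjacent (toSigning.cyc σ o) s p q →
    p ∉ b → q ∈ b → c o q * d b q = -(σ b p)

namespace Matroid.GraphFramework

open GraphLikePoint

variable {α : Type u} {M : Matroid α}

/-- The vertex set `{1, -1}^{C*(M)}` of `G(M, Γ)`. -/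
abbrev Vert (M : Matroid α) : Type u := {b : Set α // M.IsCocircuit b} → ℤˣ

open scoped Classical in
/-- The endvertex `ι_e(0)`. -/
noncomputable def srcV (Γ : M.GraphFramework) (e : M.E) : Vert M :=
  fun b => if (e : α) ∈ b.1 then -(Γ.d b.1 e) else Γ.σ b.1 e

open scoped Classical in
/-- The endvertex `ι_e(1)`. -/
noncomputable def tgtV (Γ : M.GraphFramework) (e : M.E) : Vert M :=
  fun b => if (e : α) ∈ b.1 then Γ.d b.1 e else Γ.σ b.1 e

/-- The subbasic open set `U_b^i(ε_b)`. (Only the values of `ε` on `b` matter.) -/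
def sideSet (Γ : M.GraphFramework) (b : {b : Set α // M.IsCocircuit b}) (i : ℤˣ)
    (ε : M.E → Ioo (0 : ℝ) 1) : Set (GraphLikePoint (Vert M) M.E) :=
  {p | match p with
    | vertex v => v b = i
    | edgePt r e =>
        ((e : α) ∉ b.1 ∧ Γ.σ b.1 e = i) ∨
        ((e : α) ∈ b.1 ∧ Γ.d b.1 e = i ∧ 1 - (ε e : ℝ) < (r : ℝ)) ∨
        ((e : α) ∈ b.1 ∧ Γ.d b.1 e = -i ∧ (r : ℝ) < (ε e : ℝ))}

/-- The topology of `G(M, Γ)`, generated by the sets `W × {e}` with `W` open in `(0,1)` and the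
sets `U_b^i(ε_b)`. -/
@[reducible] def topology (Γ : M.GraphFramework) : TopologicalSpace (GraphLikePoint (Vert M) M.E) :=
  TopologicalSpace.generateFrom
    {S | (∃ (W : Set (Ioo (0 : ℝ) 1)) (e : M.E), IsOpen W ∧ S = (fun r => edgePt r e) '' W) ∨
      ∃ b i ε, S = Γ.sideSet b i ε}

theorem continuous_edgeMap (Γ : M.GraphFramework) (e : M.E) :
    @Continuous _ _ _ Γ.topology (edgeMap Γ.srcV Γ.tgtV e) := by
  refine continuous_generateFrom_iff.2 ?_
  rintro S (⟨W, f, hW, rfl⟩ | ⟨b, i, ε, rfl⟩)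
  · by_cases hef : e = f
    · subst hef
      obtain ⟨W', hW', rfl⟩ := isOpen_induced_iff.1 hW
      have : edgeMap Γ.srcV Γ.tgtV e ⁻¹' ((fun r => edgePt r e) '' (Subtype.val ⁻¹' W')) =
          Subtype.val ⁻¹' W' ∩ Ioo (0 : unitInterval) 1 := by
        ext x
        by_cases h0 : x = 0
        · simp [edgeMap, h0]
        by_cases h1 : x = 1
        · simp [edgeMap, h1]
        have h0' : 0 < x := unitInterval.pos_iff_ne_zero.2 h0
        have h1' : x < 1 := unitInterval.lt_one_iff_ne_one.2 h1
        simp [edgeMap, h0, h1, h0', h1']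
      rw [this]
      exact (hW'.preimage continuous_subtype_val).inter isOpen_Ioo
    · have : edgeMap Γ.srcV Γ.tgtV e ⁻¹' ((fun r => edgePt r f) '' W) = ∅ := by
        ext x
        simp only [edgeMap, mem_preimage, mem_image, mem_empty_iff_false, iff_false]
        rintro ⟨r, -, hr⟩
        split_ifs at hr
        exact hef (by simpa using (GraphLikePoint.edgePt.inj hr).2.symm)
      rw [this]
      exact isOpen_empty
  · by_cases hb : (e : α) ∈ b.1
    · rcases Int.units_eq_one_or (Γ.d b.1 e * i) with hi | hi
      · have hd : Γ.d b.1 e = i := by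
          rcases Int.units_eq_one_or (Γ.d b.1 e) with h | h <;>
          rcases Int.units_eq_one_or i with h' | h' <;> simp_all
        have hne : i ≠ -i := by
          rcases Int.units_eq_one_or i with h' | h' <;> rw [h'] <;> decide
        have : edgeMap Γ.srcV Γ.tgtV e ⁻¹' (Γ.sideSet b i ε) =
            {x : unitInterval | 1 - (ε e : ℝ) < (x : ℝ)} := by
          ext x
          have hε := (ε e).2
          by_cases h0 : x = 0
          · simp [edgeMap, h0, sideSet, srcV, hb, hd, hne.symm, hε.2.le]
          by_cases h1 : x = 1
          · simp [edgeMap, h1, sideSet, tgtV, hb, hd, hε.1]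
          simp [edgeMap, h0, h1, sideSet, hb, hd, hne]
        rw [this]
        exact isOpen_lt continuous_const continuous_subtype_val
      · have hd : Γ.d b.1 e = -i := by
          rcases Int.units_eq_one_or (Γ.d b.1 e) with h | h <;>
          rcases Int.units_eq_one_or i with h' | h' <;> simp_all
        have hne : -i ≠ i := by
          rcases Int.units_eq_one_or i with h' | h' <;> rw [h'] <;> decide
        have : edgeMap Γ.srcV Γ.tgtV e ⁻¹' (Γ.sideSet b i ε) =
            {x : unitInterval | (x : ℝ) < (ε e : ℝ)} := by
          ext x
          have hε := (ε e).2
          by_cases h0 : x = 0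
          · simp [edgeMap, h0, sideSet, srcV, hb, hd, hε.1]
          by_cases h1 : x = 1
          · simp [edgeMap, h1, sideSet, tgtV, hb, hd, hne, hε.2.le]
          simp [edgeMap, h0, h1, sideSet, hb, hd, hne]
          exact Iff.rfl
        rw [this]
        exact isOpen_lt continuous_subtype_val continuous_const
    · have : edgeMap Γ.srcV Γ.tgtV e ⁻¹' (Γ.sideSet b i ε) = {_x | Γ.σ b.1 e = i} := by
        ext x
        by_cases h0 : x = 0
        · simp [edgeMap, h0, sideSet, srcV, hb]
        by_cases h1 : x = 1
        · simp [edgeMap, h1, sideSet, tgtV, hb]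
        simp [edgeMap, h0, h1, sideSet, hb]
      rw [this]
      exact isOpen_const

theorem disjoint_sideSet_half (Γ : M.GraphFramework) (b : {b : Set α // M.IsCocircuit b})
    (i : ℤˣ) :
    Disjoint (Γ.sideSet b i fun _ => ⟨1 / 2, by norm_num, by norm_num⟩)
      (Γ.sideSet b (-i) fun _ => ⟨1 / 2, by norm_num, by norm_num⟩) := by
  have hne : i ≠ -i := by
    rcases Int.units_eq_one_or i with h' | h' <;> rw [h'] <;> decide
  rw [Set.disjoint_left]
  rintro (v | ⟨r, e⟩) h h'
  · exact hne (Eq.trans (Eq.symm h) h')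
  · simp only [sideSet, mem_ofPred_eq, neg_neg] at h h'
    rcases h with ⟨h1, h2⟩ | ⟨h1, h2, h3⟩ | ⟨h1, h2, h3⟩ <;>
    rcases h' with ⟨k1, k2⟩ | ⟨k1, k2, k3⟩ | ⟨k1, k2, k3⟩ <;>
    first
      | exact h1 k1
      | exact k1 h1
      | exact hne (h2.symm.trans k2)
      | exact hne (k2.symm.trans h2)
      | linarith

/-- The graph-like space `G(M, Γ)`. -/
noncomputable def toGraphLikeSpace (Γ : M.GraphFramework) : GraphLikeSpace.{u} where
  V := Vert M
  E := M.E
  src := Γ.srcV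
  tgt := Γ.tgtV
  top := Γ.topology
  continuous_edge := Γ.continuous_edgeMap
  isOpenMap_inner e := fun W hW =>
    TopologicalSpace.isOpen_generateFrom_of_mem (Or.inl ⟨W, e, hW, rfl⟩)
  separated v v' hv := by
    obtain ⟨b, hb⟩ := Function.ne_iff.1 hv
    have key : ∀ i j : ℤˣ, i ≠ j → j = -i := by decide
    refine ⟨Γ.sideSet b (v b) fun _ => ⟨1 / 2, by norm_num, by norm_num⟩,
      Γ.sideSet b (-(v b)) fun _ => ⟨1 / 2, by norm_num, by norm_num⟩,
      TopologicalSpace.isOpen_generateFrom_of_mem (Or.inr ⟨_, _, _, rfl⟩),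
      TopologicalSpace.isOpen_generateFrom_of_mem (Or.inr ⟨_, _, _, rfl⟩),
      Γ.disjoint_sideSet_half b (v b), fun w => ?_, rfl, key _ _ hb⟩
    by_cases hw : w b = v b
    · exact Or.inl hw
    · exact Or.inr (key _ _ (Ne.symm hw))

/-- The graph-like space `Ĝ(M, Γ)`. -/
noncomputable def hatSpace (Γ : M.GraphFramework) : GraphLikeSpace.{u} :=
  Γ.toGraphLikeSpace.hat

end Matroid.GraphFramework

/-!
In a Hausdorff graph-like space a minimal compact connected union of vertices and edges containing
two given vertices is a pseudo-arc between them, so being joined by a pseudo-arc inside `H` amounts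
to lying in a common such continuum inside `H`.

A basic neighbourhood of a vertex `x` of `G(M, Γ)` is determined by finitely many cocircuits. Let
`H` be a closed subgraph in which any two vertices are joined by a continuum. The part of `H` that
lies on the side of `x` of a cocircuit `b` may fall apart, because some of its vertices are joined
to `x` only across `b`. A second cocircuit `c` separates all of these from `x`: it contains an edge
`f` of `b` with an endvertex joined to `x` in `H` without crossing `b`, and avoids every edge of `b`
in `H` without such an endvertex, every other edge of `H`, and every edge on the far side of `b`.
If there were no such `c`, a circuit through `f` would join `x` to an edge of `b` without such an
endvertex. The part of `H` on the side of `x` of both `b` and `c` is again a closed subgraph in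
which any two vertices are joined by a continuum.

Repeating this for each of the finitely many cocircuits, and attaching the nearer pieces, shorter
than `1/2`, of the edges that were cut, yields a pseudo-arc connected neighbourhood of `x`. This
applies to the images of `Ĝ(M, Γ)` and `X̄` in `G(M, Γ)`; in the former any two vertices are joined
by a continuum because the circuits of a connected matroid link any two of its edges.
-/

/-! ### Matroids -/

section Matroid

variable {α : Type u} {M : Matroid α}

theorem exists_isCircuit_or_isCocircuit_of_notMem {e : α} (he : e ∈ M.E) {Y : Set α}
    (heY : e ∉ Y) :
    (∃ o, M.IsCircuit o ∧ e ∈ o ∧ o ⊆ insert e Y) ∨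
      ∃ b, M.IsCocircuit b ∧ e ∈ b ∧ Disjoint b Y := by
  by_cases hcl : e ∈ M.closure Y
  · obtain ⟨o, hoY, ho, heo⟩ := Matroid.exists_isCircuit_of_mem_closure hcl heY
    exact Or.inl ⟨o, ho, heo, hoY⟩
  · obtain ⟨I, hI⟩ := M.exists_isBasis' Y
    have heI : M.Indep (insert e I) := by
      rw [← hI.closure_eq_closure] at hcl
      exact hI.indep.insert_indep_iff.2 (Or.inl ⟨he, hcl⟩)
    obtain ⟨b, hb, hbI⟩ := heI.exists_isCocircuit_inter_eq_mem (mem_insert e I)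
    have eq_of_mem : ∀ g ∈ b, g ∈ insert e I → g = e := fun g hgb hg => hbI.subset ⟨hgb, hg⟩
    refine Or.inr ⟨b, hb, (hbI.superset rfl).1, disjoint_left.2 fun f hfb hfY => ?_⟩
    have hfI : f ∉ I := fun h => heY (eq_of_mem f hfb (mem_insert_of_mem e h) ▸ hfY)
    have hfcl : f ∈ M.closure I := by
      rw [hI.closure_eq_closure]
      exact M.mem_closure_of_mem' hfY (hb.subset_ground hfb)
    obtain ⟨o, hoI, ho, hfo⟩ := Matroid.exists_isCircuit_of_mem_closure hfcl hfI
    obtain ⟨g, ⟨hgo, hgb⟩, hgf⟩ := (ho.isCocircuit_inter_nontrivial hb ⟨f, hfo, hfb⟩).exists_ne f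
    have hgI : g ∈ I := (hoI hgo).resolve_left hgf
    exact heY (eq_of_mem g hgb (mem_insert_of_mem e hgI) ▸ hI.subset hgI)

theorem exists_isCocircuit_inter_eq_pair {o : Set α} (ho : M.IsCircuit o) {e f : α}
    (he : e ∈ o) (hf : f ∈ o) (hef : e ≠ f) : ∃ b, M.IsCocircuit b ∧ b ∩ o = {e, f} := by
  obtain ⟨b, hb, hbo⟩ :=
    (ho.sdiff_singleton_indep hf).exists_isCocircuit_inter_eq_mem (e := e) ⟨he, hef⟩
  have heb : e ∈ b := (hbo.superset rfl).1
  have eq_or_eq : ∀ g ∈ b, g ∈ o → g = e ∨ g = f := fun g hgb hgo =>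
    or_iff_not_imp_right.2 fun hgf => hbo.subset ⟨hgb, hgo, hgf⟩
  have hfb : f ∈ b := by
    obtain ⟨g, ⟨hgo, hgb⟩, hge⟩ := (ho.isCocircuit_inter_nontrivial hb ⟨e, he, heb⟩).exists_ne e
    exact (eq_or_eq g hgb hgo).resolve_left hge ▸ hgb
  refine ⟨b, hb, Subset.antisymm (fun g hg => eq_or_eq g hg.1 hg.2) ?_⟩
  rintro g (rfl | rfl)
  exacts [⟨heb, he⟩, ⟨hfb, hf⟩]

theorem exists_isCircuit_inter_eq_pair {b : Set α} (hb : M.IsCocircuit b) {e f : α}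
    (he : e ∈ b) (hf : f ∈ b) (hef : e ≠ f) : ∃ o, M.IsCircuit o ∧ o ∩ b = {e, f} := by
  obtain ⟨o, ho, hob⟩ := exists_isCocircuit_inter_eq_pair hb.isCircuit he hf hef
  exact ⟨o, Matroid.dual_isCocircuit_iff.1 ho, hob⟩

theorem indep_union_of_forall_isCircuit {A I J : Set α}
    (hA : ∀ o, M.IsCircuit o → o ⊆ A ∨ Disjoint o A) (hI : M.Indep I) (hJ : M.Indep J)
    (hIA : I ⊆ A) (hJA : Disjoint J A) : M.Indep (I ∪ J) := by
  rw [Matroid.indep_iff_forall_subset_not_isCircuit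
    (union_subset hI.subset_ground hJ.subset_ground)]
  intro o hoIJ ho
  rcases hA o ho with hoA | hoA
  · exact ho.not_indep <| hI.subset fun g hg =>
      (hoIJ hg).resolve_right fun hgJ => disjoint_left.1 hJA hgJ (hoA hg)
  · exact ho.not_indep <| hJ.subset fun g hg =>
      (hoIJ hg).resolve_left fun hgI => disjoint_left.1 hoA hg (hIA hgI)

/-- `e` and `f` lie on a common circuit of `M`. The matroid `M` is connected only if any two
elements of its ground set are related by the transitive closure of this relation. -/
def OnCommonCircuit (M : Matroid α) (e f : α) : Prop :=
  ∃ o, M.IsCircuit o ∧ e ∈ o ∧ f ∈ o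

theorem Matroid.IsConnectedMatroid.reflTransGen_onCommonCircuit (hM : M.IsConnectedMatroid)
    {e f : α} (he : e ∈ M.E) (hf : f ∈ M.E) : Relation.ReflTransGen (OnCommonCircuit M) e f := by
  by_contra hef
  set A : Set α := {g ∈ M.E | Relation.ReflTransGen (OnCommonCircuit M) e g}
  have circuit_subset_or_disjoint : ∀ o, M.IsCircuit o → o ⊆ A ∨ Disjoint o A := fun o ho =>
    or_iff_not_imp_right.2 fun hoA => by
      obtain ⟨g, hgo, hgA⟩ := not_disjoint_iff.1 hoA
      exact fun k hk => ⟨ho.subset_ground hk, hgA.2.tail ⟨o, ho, hgo, hk⟩⟩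
  obtain ⟨I, hI⟩ := M.exists_isBasis A (sep_subset _ _)
  obtain ⟨J, hJ⟩ := M.exists_isBasis (M.E \ A) sdiff_subset
  have hIJ : M.Indep (I ∪ J) := indep_union_of_forall_isCircuit circuit_subset_or_disjoint
    hI.indep hJ.indep hI.subset (disjoint_sdiff_left.mono_left hJ.subset)
  obtain ⟨B, hB, hIJB⟩ := hIJ.exists_isBase_superset
  refine hM 1 one_lt_two A (M.E \ A) ⟨union_sdiff_cancel (sep_subset _ _), disjoint_sdiff_right,
    ?_, ?_, I, J, B, hI, hJ, hB, by simp [sdiff_eq_empty.2 hIJB]⟩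
  · rw [Nat.cast_one, one_le_encard_iff_nonempty]
    exact ⟨e, he, Relation.ReflTransGen.refl⟩
  · rw [Nat.cast_one, one_le_encard_iff_nonempty]
    exact ⟨f, hf, fun h => hef h.2⟩

theorem Matroid.IsConnectedMatroid.ground_eq_singleton (hM : M.IsConnectedMatroid) {e : α}
    (he : e ∈ M.E) (he' : ∀ b, M.IsCocircuit b → e ∉ b) : M.E = {e} := by
  have eq_of_onCommonCircuit : ∀ f, OnCommonCircuit M e f → f = e := by
    rintro f ⟨o, ho, heo, hfo⟩
    by_contra hfe
    obtain ⟨b, hb, hbo⟩ := exists_isCocircuit_inter_eq_pair ho heo hfo (Ne.symm hfe)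
    exact he' b hb (hbo.superset (mem_insert e {f})).1
  refine Subset.antisymm (fun f hf => ?_) (singleton_subset_iff.2 he)
  induction hM.reflTransGen_onCommonCircuit he hf with
  | refl => rfl
  | @tail g k _ hgk ih =>
    have hg : g = e := ih (hgk.choose_spec.1.subset_ground hgk.choose_spec.2.1)
    exact eq_of_onCommonCircuit k (hg ▸ hgk)

end Matroid

/-! ### Compact connected sets -/

section Topology

variable {X : Type*} [TopologicalSpace X]

theorem subset_left_of_subset_union_of_isClosed {s A B : Set X} (hA : IsClosed A)
    (hB : IsClosed B) (hAB : Disjoint A B) (hsAB : s ⊆ A ∪ B) (hsA : (s ∩ A).Nonempty)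
    (hs : IsPreconnected s) : s ⊆ A := by
  obtain ⟨x, hxs, hxA⟩ := hsA
  refine (isPreconnected_iff_subset_of_disjoint_closed.1 hs A B hA hB hsAB
    (by rw [hAB.inter_eq, inter_empty])).resolve_right fun h => ?_
  exact disjoint_left.1 hAB hxA (h hxs)

variable [T2Space X]

theorem isPreconnected_sInter_of_directedOn {c : Set (Set X)} (hne : c.Nonempty)
    (hc : DirectedOn (· ⊇ ·) c) (hcomp : ∀ s ∈ c, IsCompact s)
    (hconn : ∀ s ∈ c, IsPreconnected s) : IsPreconnected (⋂₀ c) := by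
  obtain ⟨s₀, hs₀⟩ := hne
  have hclosed : IsClosed (⋂₀ c) := isClosed_sInter fun s hs => (hcomp s hs).isClosed
  have hcpt : IsCompact (⋂₀ c) :=
    (hcomp s₀ hs₀).of_isClosed_subset hclosed (sInter_subset_of_mem hs₀)
  rw [isPreconnected_iff_subset_of_fully_disjoint_closed hclosed]
  intro u v hu hv huv hd
  obtain ⟨U, V, hU, hV, huU, hvV, hUV⟩ := SeparatedNhds.of_isCompact_isCompact
    (hcpt.inter_right hu) (hcpt.inter_right hv) (hd.mono inter_subset_right inter_subset_right)
  have hcUV : ⋂ s : c, (s : Set X) ⊆ U ∪ V := by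
    rw [← sInter_eq_iInter]
    exact fun x hx => (huv hx).imp (fun h => huU ⟨hx, h⟩) fun h => hvV ⟨hx, h⟩
  have : Nonempty c := ⟨⟨s₀, hs₀⟩⟩
  obtain ⟨s, hs⟩ := exists_subset_nhds_of_isCompact hc.directed_val
    (fun s => hcomp s s.2) fun x hx => (hU.union hV).mem_nhds (hcUV hx)
  have hcs : ⋂₀ c ⊆ (s : Set X) := sInter_subset_of_mem s.2
  rcases isPreconnected_iff_subset_of_disjoint.1 (hconn s s.2) U V hU hV hs
    (by rw [hUV.inter_eq, inter_empty]) with h | h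
  · exact Or.inl fun x hx => (huv hx).resolve_right fun hxv =>
      disjoint_left.1 hUV (h (hcs hx)) (hvV ⟨hx, hxv⟩)
  · exact Or.inr fun x hx => (huv hx).resolve_left fun hxu =>
      disjoint_left.1 hUV (huU ⟨hx, hxu⟩) (h (hcs hx))

theorem isCompact_connectedComponentIn {R : Set X} (hR : IsCompact R) (x : X) :
    IsCompact (connectedComponentIn R x) := by
  by_cases hx : x ∈ R
  · refine hR.of_isClosed_subset ?_ (connectedComponentIn_subset R x)
    rw [connectedComponentIn_eq_image hx]
    exact hR.isClosed.isClosedEmbedding_subtypeVal.isClosedMap _ isClosed_connectedComponent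
  · exact connectedComponentIn_eq_empty hx ▸ isCompact_empty

theorem exists_isClopen_of_notMem_connectedComponent [CompactSpace X] {x : X} {T : Set X}
    (hT : T.Finite) (hTx : ∀ y ∈ T, y ∉ connectedComponent x) :
    ∃ Z : Set X, IsClopen Z ∧ x ∈ Z ∧ Disjoint T Z := by
  have exists_clopen : ∀ y ∈ T, ∃ Z : Set X, IsClopen Z ∧ x ∈ Z ∧ y ∉ Z := by
    intro y hy
    have h := hTx y hy
    rw [connectedComponent_eq_iInter_isClopen, mem_iInter] at h
    push Not at h
    obtain ⟨Z, hZ⟩ := h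
    exact ⟨Z.1, Z.2.1, Z.2.2, hZ⟩
  choose! Z hZclopen hxZ hyZ using exists_clopen
  exact ⟨⋂ y ∈ T, Z y, hT.isClopen_biInter hZclopen, mem_iInter₂.2 hxZ,
    disjoint_left.2 fun y hy h => hyZ y hy (mem_iInter₂.1 h y hy)⟩

theorem exists_isClosed_partition_of_notMem_connectedComponentIn {R : Set X} (hR : IsCompact R)
    {x : X} (hx : x ∈ R) {T : Set X} (hT : T.Finite)
    (hTx : ∀ y ∈ T, y ∉ connectedComponentIn R x) :
    ∃ A B : Set X, IsClosed A ∧ IsClosed B ∧ Disjoint A B ∧ A ∪ B = R ∧ x ∈ A ∧ Disjoint T A := by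
  have : CompactSpace R := isCompact_iff_compactSpace.1 hR
  have hclosed := hR.isClosed.isClosedEmbedding_subtypeVal.isClosedMap
  obtain ⟨Z, hZ, hxZ, hTZ⟩ := exists_isClopen_of_notMem_connectedComponent (x := (⟨x, hx⟩ : R))
    (hT.preimage Subtype.val_injective.injOn) fun y hy h => hTx y hy <| by
      rw [connectedComponentIn_eq_image hx]
      exact mem_image_of_mem _ h
  refine ⟨Subtype.val '' Z, Subtype.val '' Zᶜ, hclosed _ hZ.isClosed, hclosed _ hZ.compl.isClosed,
    (disjoint_image_iff Subtype.val_injective).2 disjoint_compl_right, ?_, ⟨_, hxZ, rfl⟩, ?_⟩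
  · rw [← image_union, union_compl_self, image_univ, Subtype.range_coe]
  · rw [disjoint_left]
    rintro y hy ⟨z, hz, rfl⟩
    exact disjoint_left.1 hTZ hy hz

end Topology

namespace GraphLikeSpace

open GraphLikePoint

variable {G : GraphLikeSpace.{u}}

/-! ### Unions of vertices and edges -/

/-- `P` is a union of vertices and edges: it contains all or none of the interior points of every
edge. -/
def Saturated (P : Set G.Point) : Prop :=
  ∀ (e : G.E) (r r' : Ioo (0 : ℝ) 1), edgePt r e ∈ P → edgePt r' e ∈ P

/-- The edges with an interior point in `P`. -/
def edgesOf (P : Set G.Point) : Set G.E :=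
  {e | ∃ r : Ioo (0 : ℝ) 1, edgePt r e ∈ P}

/-- The closed edge `ι_e([0,1])`. -/
def closedEdge (G : GraphLikeSpace.{u}) (e : G.E) : Set G.Point :=
  range (G.edge e)

/-- The endvertices of the edge `e` are `a` and `b`, in one of the two orders. -/
def IsLink (G : GraphLikeSpace.{u}) (e : G.E) (a b : G.V) : Prop :=
  (a = G.src e ∧ b = G.tgt e) ∨ (a = G.tgt e ∧ b = G.src e)

@[simp] theorem edgePt_mem_innerPoints {F : Set G.E} {e : G.E} {r : Ioo (0 : ℝ) 1} :
    (edgePt r e : G.Point) ∈ G.innerPoints F ↔ e ∈ F := by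
  constructor
  · rintro ⟨s, f, hf, hs⟩
    cases hs
    exact hf
  · exact fun h => ⟨r, e, h, rfl⟩

@[simp] theorem vertex_notMem_innerPoints {F : Set G.E} {v : G.V} :
    (vertex v : G.Point) ∉ G.innerPoints F := by
  rintro ⟨s, f, -, hs⟩
  cases hs

theorem innerPoints_insert (e : G.E) (F : Set G.E) :
    G.innerPoints (insert e F) = G.innerPoints {e} ∪ G.innerPoints F := by
  ext (v | ⟨r, f⟩)
  · simp only [vertex_notMem_innerPoints, mem_union, or_self]
  · simp only [edgePt_mem_innerPoints, mem_union, mem_insert_iff, mem_singleton_iff]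

theorem isOpen_innerPoints (F : Set G.E) : IsOpen (G.innerPoints F) := by
  have : G.innerPoints F = ⋃ e ∈ F, range fun r : Ioo (0 : ℝ) 1 => (edgePt r e : G.Point) := by
    ext (v | ⟨r, e⟩)
    · simp only [vertex_notMem_innerPoints, mem_iUnion, mem_range, reduceCtorEq, exists_false]
    · simp [edgePt_mem_innerPoints]
  rw [this]
  exact isOpen_biUnion fun e _ => (G.isOpenMap_inner e).isOpen_range

@[simp] theorem edge_zero (e : G.E) : G.edge e 0 = vertex (G.src e) := by
  simp [edge, edgeMap]

@[simp] theorem edge_one (e : G.E) : G.edge e 1 = vertex (G.tgt e) := by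
  simp [edge, edgeMap]

theorem edge_coe (e : G.E) (r : Ioo (0 : ℝ) 1) :
    G.edge e ⟨r, r.2.1.le, r.2.2.le⟩ = edgePt r e := by
  have h0 : (⟨r, r.2.1.le, r.2.2.le⟩ : unitInterval) ≠ 0 := fun h =>
    r.2.1.ne' (congrArg Subtype.val h)
  have h1 : (⟨r, r.2.1.le, r.2.2.le⟩ : unitInterval) ≠ 1 := fun h =>
    r.2.2.ne (congrArg Subtype.val h)
  simp [edge, edgeMap, h0, h1]

theorem mem_closedEdge {e : G.E} {p : G.Point} : p ∈ G.closedEdge e ↔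
    p = vertex (G.src e) ∨ p = vertex (G.tgt e) ∨ ∃ r, p = edgePt r e := by
  constructor
  · rintro ⟨x, rfl⟩
    by_cases h0 : x = 0
    · exact Or.inl (h0 ▸ edge_zero e)
    by_cases h1 : x = 1
    · exact Or.inr (Or.inl (h1 ▸ edge_one e))
    exact Or.inr (Or.inr ⟨_, edge_coe e
      ⟨x, unitInterval.pos_iff_ne_zero.2 h0, unitInterval.lt_one_iff_ne_one.2 h1⟩⟩)
  · rintro (rfl | rfl | ⟨r, rfl⟩)
    exacts [⟨0, edge_zero e⟩, ⟨1, edge_one e⟩, ⟨_, edge_coe e r⟩]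

@[simp] theorem edgePt_mem_closedEdge {e f : G.E} {r : Ioo (0 : ℝ) 1} :
    (edgePt r f : G.Point) ∈ G.closedEdge e ↔ f = e := by
  simp [mem_closedEdge]

theorem isLink_src_tgt (e : G.E) : G.IsLink e (G.src e) (G.tgt e) :=
  Or.inl ⟨rfl, rfl⟩

theorem IsLink.symm {e : G.E} {a b : G.V} (h : G.IsLink e a b) : G.IsLink e b a :=
  Or.symm (h.imp And.symm And.symm)

theorem IsLink.eq_or_eq {e : G.E} {a b c d : G.V} (h : G.IsLink e a b) (h' : G.IsLink e c d) :
    a = c ∨ a = d := by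
  obtain ⟨rfl, rfl⟩ | ⟨rfl, rfl⟩ := h <;> obtain ⟨rfl, rfl⟩ | ⟨rfl, rfl⟩ := h' <;> simp

theorem IsLink.mem_closedEdge_iff {e : G.E} {a b : G.V} (h : G.IsLink e a b) {p : G.Point} :
    p ∈ G.closedEdge e ↔ p = vertex a ∨ p = vertex b ∨ ∃ r, p = edgePt r e := by
  obtain ⟨rfl, rfl⟩ | ⟨rfl, rfl⟩ := h
  · exact mem_closedEdge
  · rw [mem_closedEdge, or_left_comm]

theorem IsLink.left_mem_closedEdge {e : G.E} {a b : G.V} (h : G.IsLink e a b) :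
    (vertex a : G.Point) ∈ G.closedEdge e :=
  h.mem_closedEdge_iff.2 (Or.inl rfl)

theorem isCompact_closedEdge (e : G.E) : IsCompact (G.closedEdge e) :=
  isCompact_range (G.continuous_edge e)

theorem isPreconnected_closedEdge (e : G.E) : IsPreconnected (G.closedEdge e) :=
  isPreconnected_range (G.continuous_edge e)

theorem isPreconnected_innerPoints_singleton (e : G.E) : IsPreconnected (G.innerPoints {e}) := by
  have : G.innerPoints {e} = G.edge e '' Ioo 0 1 := by
    ext p
    constructor
    · rintro ⟨r, f, rfl, rfl⟩
      exact ⟨_, ⟨r.2.1, r.2.2⟩, edge_coe f r⟩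
    · rintro ⟨x, hx, rfl⟩
      exact ⟨⟨x, hx.1, hx.2⟩, e, rfl, edge_coe e ⟨x, hx.1, hx.2⟩⟩
  rw [this]
  exact isPreconnected_Ioo.image _ (G.continuous_edge e).continuousOn

theorem Saturated.mem {P : Set G.Point} (h : Saturated P) {e : G.E} (he : e ∈ edgesOf P)
    (r : Ioo (0 : ℝ) 1) : edgePt r e ∈ P :=
  h e he.choose r he.choose_spec

theorem Saturated.innerPoints_subset {P : Set G.Point} (h : Saturated P) {e : G.E}
    (he : e ∈ edgesOf P) : G.innerPoints {e} ⊆ P := by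
  rintro p ⟨r, f, rfl, rfl⟩
  exact h.mem he r

theorem Saturated.closedEdge_subset {P : Set G.Point} (h : Saturated P) (hP : IsClosed P)
    {e : G.E} (he : e ∈ edgesOf P) : G.closedEdge e ⊆ P := by
  rintro p ⟨x, rfl⟩
  exact hP.closure_subset_iff.2 (h.innerPoints_subset he)
    (G.edge_mem_closure (mem_singleton e) x)

theorem Saturated.union {P Q : Set G.Point} (h : Saturated P) (h' : Saturated Q) :
    Saturated (P ∪ Q) := fun e r r' hr => hr.imp (h e r r') (h' e r r')

theorem Saturated.sdiff_innerPoints {P : Set G.Point} (h : Saturated P) (F : Set G.E) :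
    Saturated (P \ G.innerPoints F) := fun e r r' hr =>
  ⟨h e r r' hr.1, fun he => hr.2 (edgePt_mem_innerPoints.2 (edgePt_mem_innerPoints.1 he))⟩

theorem Saturated.left_of_union {A B : Set G.Point} (h : Saturated (A ∪ B)) (hA : IsClosed A)
    (hB : IsClosed B) (hAB : Disjoint A B) : Saturated A := fun e r r' hr =>
  subset_left_of_subset_union_of_isClosed hA hB hAB (h.innerPoints_subset ⟨r, Or.inl hr⟩)
    ⟨_, ⟨r, e, rfl, rfl⟩, hr⟩ (isPreconnected_innerPoints_singleton e) ⟨r', e, rfl, rfl⟩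

/-! ### Continua -/

/-- A continuum: a compact connected union of vertices and edges. -/
structure IsContinuum (P : Set G.Point) : Prop where
  isCompact : IsCompact P
  isPreconnected : IsPreconnected P
  saturated : Saturated P

/-- `u` and `v` lie in a common continuum included in `H`. -/
def JoinedByContinuumIn (H : Set G.Point) (u v : G.V) : Prop :=
  ∃ P : Set G.Point, P ⊆ H ∧ IsContinuum P ∧ vertex u ∈ P ∧ vertex v ∈ P

theorem isContinuum_vertex (u : G.V) : IsContinuum ({vertex u} : Set G.Point) :=
  ⟨isCompact_singleton, isPreconnected_singleton, fun _ _ _ h => by cases h⟩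

theorem isContinuum_closedEdge (e : G.E) : IsContinuum (G.closedEdge e) :=
  ⟨isCompact_closedEdge e, isPreconnected_closedEdge e, fun _ _ _ h =>
    edgePt_mem_closedEdge.2 (edgePt_mem_closedEdge.1 h)⟩

theorem IsContinuum.union {P Q : Set G.Point} (hP : IsContinuum P) (hQ : IsContinuum Q)
    {x : G.Point} (hxP : x ∈ P) (hxQ : x ∈ Q) : IsContinuum (P ∪ Q) :=
  ⟨hP.isCompact.union hQ.isCompact, hP.isPreconnected.union x hxP hxQ hQ.isPreconnected,
    hP.saturated.union hQ.saturated⟩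

theorem IsContinuum.isCompact_sdiff {P : Set G.Point} (hP : IsContinuum P) (F : Set G.E) :
    IsCompact (P \ G.innerPoints F) :=
  hP.isCompact.diff (isOpen_innerPoints F)

theorem JoinedByContinuumIn.refl {H : Set G.Point} {u : G.V} (h : vertex u ∈ H) :
    JoinedByContinuumIn H u u :=
  ⟨{vertex u}, singleton_subset_iff.2 h, isContinuum_vertex u, rfl, rfl⟩

theorem JoinedByContinuumIn.symm {H : Set G.Point} {u v : G.V} (h : JoinedByContinuumIn H u v) :
    JoinedByContinuumIn H v u := by
  obtain ⟨P, hPH, hP, hu, hv⟩ := h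
  exact ⟨P, hPH, hP, hv, hu⟩

theorem JoinedByContinuumIn.trans {H : Set G.Point} {u v w : G.V}
    (h : JoinedByContinuumIn H u v) (h' : JoinedByContinuumIn H v w) :
    JoinedByContinuumIn H u w := by
  obtain ⟨P, hPH, hP, hu, hv⟩ := h
  obtain ⟨Q, hQH, hQ, hv', hw⟩ := h'
  exact ⟨P ∪ Q, union_subset hPH hQH, hP.union hQ hv hv', Or.inl hu, Or.inr hw⟩

theorem JoinedByContinuumIn.mono {H H' : Set G.Point} {u v : G.V}
    (h : JoinedByContinuumIn H u v) (hH : H ⊆ H') : JoinedByContinuumIn H' u v := by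
  obtain ⟨P, hPH, hP, hu, hv⟩ := h
  exact ⟨P, hPH.trans hH, hP, hu, hv⟩

theorem IsLink.joinedByContinuumIn {H : Set G.Point} {e : G.E} {a b : G.V} (h : G.IsLink e a b)
    (hH : G.closedEdge e ⊆ H) : JoinedByContinuumIn H a b :=
  ⟨_, hH, isContinuum_closedEdge e, h.left_mem_closedEdge, h.symm.left_mem_closedEdge⟩

section T2

variable [T2Space G.Point]

theorem isClosed_closedEdge (e : G.E) : IsClosed (G.closedEdge e) :=
  (isCompact_closedEdge e).isClosed

theorem IsContinuum.isClosed {P : Set G.Point} (hP : IsContinuum P) : IsClosed P :=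
  hP.isCompact.isClosed

theorem IsContinuum.closedEdge_subset {P : Set G.Point} (hP : IsContinuum P) {e : G.E}
    (he : e ∈ edgesOf P) : G.closedEdge e ⊆ P :=
  hP.saturated.closedEdge_subset hP.isClosed he

theorem IsContinuum.left_mem {P : Set G.Point} (hP : IsContinuum P) {e : G.E}
    (he : e ∈ edgesOf P) {a b : G.V} (hab : G.IsLink e a b) : vertex a ∈ P :=
  hP.closedEdge_subset he hab.left_mem_closedEdge

theorem isContinuum_connectedComponentIn {R : Set G.Point} (hR : IsCompact R) (hs : Saturated R)
    (x : G.Point) : IsContinuum (connectedComponentIn R x) := by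
  refine ⟨isCompact_connectedComponentIn hR x, isPreconnected_connectedComponentIn,
    fun e r r' hr => ?_⟩
  rw [connectedComponentIn_eq hr]
  exact (isPreconnected_innerPoints_singleton e).subset_connectedComponentIn ⟨r, e, rfl, rfl⟩
    (hs.innerPoints_subset ⟨r, connectedComponentIn_subset R x hr⟩) ⟨r', e, rfl, rfl⟩

theorem joinedByContinuumIn_iff {R : Set G.Point} {v w : G.V} (hR : IsCompact R)
    (hs : Saturated R) :
    JoinedByContinuumIn R v w ↔ vertex w ∈ connectedComponentIn R (vertex v) := by
  constructor
  · rintro ⟨P, hPR, hP, hv, hw⟩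
    exact hP.isPreconnected.subset_connectedComponentIn hv hPR hw
  · intro hw
    have hv : vertex v ∈ R := connectedComponentIn_nonempty_iff.1 ⟨_, hw⟩
    exact ⟨_, connectedComponentIn_subset _ _, isContinuum_connectedComponentIn hR hs _,
      mem_connectedComponentIn hv, hw⟩

/-! ### Removing finitely many edges from a continuum -/

theorem IsContinuum.exists_isLink_mem_of_isClosed_partition {P : Set G.Point} (hP : IsContinuum P)
    {F : Set G.E} (hF : (F ∩ edgesOf P).Finite) (hne : (F ∩ edgesOf P).Nonempty)
    {A B : Set G.Point} (hA : IsClosed A) (hB : IsClosed B) (hAB : Disjoint A B)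
    (hU : A ∪ B = P \ G.innerPoints F) (hAne : A.Nonempty) :
    ∃ e ∈ F ∩ edgesOf P, ∃ a b, G.IsLink e a b ∧ vertex a ∈ A := by
  by_contra! ends_notMem
  set B' := B ∪ ⋃ e ∈ F ∩ edgesOf P, G.closedEdge e
  have hB' : IsClosed B' := hB.union (hF.isClosed_biUnion fun e _ => isClosed_closedEdge e)
  have hAB' : Disjoint A B' := by
    refine hAB.union_right (disjoint_iUnion₂_right.2 fun e he => disjoint_left.2 fun p hp hpe => ?_)
    rcases mem_closedEdge.1 hpe with rfl | rfl | ⟨r, rfl⟩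
    · exact ends_notMem e he _ _ (isLink_src_tgt e) hp
    · exact ends_notMem e he _ _ (isLink_src_tgt e).symm hp
    · exact (hU.subset (Or.inl hp)).2 (edgePt_mem_innerPoints.2 he.1)
  have hPAB' : P ⊆ A ∪ B' := by
    intro p hp
    by_cases hpF : p ∈ G.innerPoints F
    · obtain ⟨r, e, he, rfl⟩ := hpF
      exact Or.inr (Or.inr (mem_biUnion (⟨he, r, hp⟩ : e ∈ F ∩ edgesOf P)
        (edgePt_mem_closedEdge.2 rfl)))
    · exact (hU.superset ⟨hp, hpF⟩).imp_right Or.inl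
  have hPA : P ⊆ A := subset_left_of_subset_union_of_isClosed hA hB' hAB' hPAB'
    (hAne.mono fun p hp => ⟨(hU.subset (Or.inl hp)).1, hp⟩) hP.isPreconnected
  obtain ⟨e, he⟩ := hne
  exact ends_notMem e he _ _ (isLink_src_tgt e) (hPA (hP.left_mem he.2 (isLink_src_tgt e)))

/-- Boundary bumping, with the endvertices of the edges in `F` as the boundary. -/
theorem IsContinuum.exists_isLink_mem_connectedComponentIn {P : Set G.Point} (hP : IsContinuum P)
    {F : Set G.E} (hF : (F ∩ edgesOf P).Finite) (hne : (F ∩ edgesOf P).Nonempty) {v : G.V}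
    (hv : vertex v ∈ P) :
    ∃ e ∈ F ∩ edgesOf P, ∃ a b, G.IsLink e a b ∧
      vertex a ∈ connectedComponentIn (P \ G.innerPoints F) (vertex v) := by
  by_contra! ends_notMem
  set T : Set G.Point := (vertex ∘ G.src) '' (F ∩ edgesOf P) ∪ (vertex ∘ G.tgt) '' (F ∩ edgesOf P)
  obtain ⟨A, B, hA, hB, hAB, hU, hvA, hTA⟩ :=
    exists_isClosed_partition_of_notMem_connectedComponentIn (hP.isCompact_sdiff F)
    (x := vertex v) (T := T) ⟨hv, vertex_notMem_innerPoints⟩ ((hF.image _).union (hF.image _)) (by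
      rintro y (⟨e, he, rfl⟩ | ⟨e, he, rfl⟩)
      exacts [ends_notMem e he _ _ (isLink_src_tgt e),
        ends_notMem e he _ _ (isLink_src_tgt e).symm])
  obtain ⟨e, he, a, b, ⟨rfl, -⟩ | ⟨rfl, -⟩, haA⟩ :=
    hP.exists_isLink_mem_of_isClosed_partition hF hne hA hB hAB hU ⟨_, hvA⟩
  · exact disjoint_left.1 hTA (Or.inl ⟨e, he, rfl⟩) haA
  · exact disjoint_left.1 hTA (Or.inr ⟨e, he, rfl⟩) haA

end T2

/-- Removing the edge `e` from `P` leaves two disjoint continua, `A` containing the endvertex `a`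
of `e` and `B` containing the other endvertex `b`. -/
structure SplitsAt (P : Set G.Point) (e : G.E) (A : Set G.Point) (a : G.V) (B : Set G.Point)
    (b : G.V) : Prop where
  mem_edgesOf : e ∈ edgesOf P
  isLink : G.IsLink e a b
  left_isContinuum : IsContinuum A
  right_isContinuum : IsContinuum B
  disjoint : Disjoint A B
  union_eq : A ∪ B = P \ G.innerPoints {e}
  left_mem : vertex a ∈ A
  right_mem : vertex b ∈ B

namespace SplitsAt

variable {P A B : Set G.Point} {e : G.E} {a b : G.V}

theorem symm (h : SplitsAt P e A a B b) : SplitsAt P e B b A a where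
  mem_edgesOf := h.mem_edgesOf
  isLink := h.isLink.symm
  left_isContinuum := h.right_isContinuum
  right_isContinuum := h.left_isContinuum
  disjoint := h.disjoint.symm
  union_eq := (union_comm B A).trans h.union_eq
  left_mem := h.right_mem
  right_mem := h.left_mem

theorem left_subset (h : SplitsAt P e A a B b) : A ⊆ P \ G.innerPoints {e} :=
  subset_union_left.trans h.union_eq.subset

theorem vertex_mem (h : SplitsAt P e A a B b) {v : G.V} (hv : vertex v ∈ P) :
    vertex v ∈ A ∪ B :=
  h.union_eq.superset ⟨hv, vertex_notMem_innerPoints⟩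

theorem subset_union_closedEdge (h : SplitsAt P e A a B b) : P ⊆ A ∪ (B ∪ G.closedEdge e) := by
  intro p hp
  by_cases hpe : p ∈ G.innerPoints {e}
  · obtain ⟨r, f, rfl, rfl⟩ := hpe
    exact Or.inr (Or.inr (edgePt_mem_closedEdge.2 rfl))
  · exact (h.union_eq.superset ⟨hp, hpe⟩).imp_right Or.inl

theorem eq_left_of_mem_closedEdge (h : SplitsAt P e A a B b) {p : G.Point} (hpA : p ∈ A)
    (hpe : p ∈ G.closedEdge e) : p = vertex a := by
  rcases h.isLink.mem_closedEdge_iff.1 hpe with rfl | rfl | ⟨r, rfl⟩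
  · rfl
  · exact (disjoint_left.1 h.disjoint hpA h.right_mem).elim
  · exact ((h.left_subset hpA).2 (edgePt_mem_innerPoints.2 rfl)).elim

end SplitsAt

section T2

variable [T2Space G.Point]

/-- If `A` were the union of two disjoint nonempty closed sets, then each of them would contain an
endvertex of `e`, but only one endvertex of `e` lies in `A`. -/
theorem IsContinuum.left_isContinuum_of_isClosed_partition {P A B : Set G.Point}
    (hP : IsContinuum P) {e : G.E} (he : e ∈ edgesOf P) (hA : IsClosed A) (hB : IsClosed B)
    (hAB : Disjoint A B) (hU : A ∪ B = P \ G.innerPoints {e}) {a b : G.V} (hab : G.IsLink e a b)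
    (hb : vertex b ∈ B) : IsContinuum A := by
  have hAP : A ⊆ P := fun x hx => (hU.subset (Or.inl hx)).1
  have left_mem_of_partition : ∀ x y : Set G.Point, IsClosed x → IsClosed y → Disjoint x y →
      A ⊆ x ∪ y → ¬ A ⊆ y → vertex a ∈ A ∩ x := by
    intro x y hx hy hxy hAxy hAy
    obtain ⟨p, hpA, hpy⟩ := not_subset.1 hAy
    obtain ⟨f, ⟨rfl, -⟩, a', b', hab', ha'⟩ :=
      hP.exists_isLink_mem_of_isClosed_partition (F := {e}) (A := A ∩ x) (B := A ∩ y ∪ B)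
      ((finite_singleton e).inter_of_left _) ⟨e, rfl, he⟩ (hA.inter hx) ((hA.inter hy).union hB)
      ((hxy.mono inter_subset_right inter_subset_right).union_right
        (hAB.mono_left inter_subset_left))
      (by rw [← union_assoc, ← inter_union_distrib_left, inter_eq_left.2 hAxy, hU])
      ⟨p, hpA, (hAxy hpA).resolve_right hpy⟩
    rcases hab.mem_closedEdge_iff.1 hab'.left_mem_closedEdge with h | h | ⟨r, h⟩
    · exact h ▸ ha'
    · exact (disjoint_left.1 hAB ha'.1 (h ▸ hb)).elim
    · cases h
  refine ⟨hP.isCompact.of_isClosed_subset hA hAP, ?_,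
    Saturated.left_of_union (hU ▸ hP.saturated.sdiff_innerPoints {e}) hA hB hAB⟩
  rw [isPreconnected_iff_subset_of_fully_disjoint_closed hA]
  intro x y hx hy hAxy hxy
  by_contra! h
  exact disjoint_left.1 hxy (left_mem_of_partition x y hx hy hxy hAxy h.2).2
    (left_mem_of_partition y x hy hx hxy.symm (union_comm x y ▸ hAxy) h.1).2

theorem IsContinuum.exists_splitsAt {P : Set G.Point} (hP : IsContinuum P) {u v : G.V}
    (hu : vertex u ∈ P) (hv : vertex v ∈ P) {e : G.E} (he : e ∈ edgesOf P)
    (hsep : vertex v ∉ connectedComponentIn (P \ G.innerPoints {e}) (vertex u)) :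
    ∃ A a B b, SplitsAt P e A a B b ∧ vertex u ∈ A ∧ vertex v ∈ B := by
  obtain ⟨A, B, hA, hB, hAB, hU, huA, hT⟩ :=
    exists_isClosed_partition_of_notMem_connectedComponentIn (hP.isCompact_sdiff {e})
    (x := vertex u) ⟨hu, vertex_notMem_innerPoints⟩ (finite_singleton (vertex v)) (by
      rintro y rfl
      exact hsep)
  have hvB : vertex v ∈ B :=
    (hU.superset ⟨hv, vertex_notMem_innerPoints⟩ : vertex v ∈ A ∪ B).resolve_left
      (disjoint_singleton_left.1 hT)
  have hU' : B ∪ A = P \ G.innerPoints {e} := (union_comm B A).trans hU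
  have he' : ({e} ∩ edgesOf P).Nonempty := ⟨e, rfl, he⟩
  have hfin : ({e} ∩ edgesOf P).Finite := (finite_singleton e).inter_of_left _
  obtain ⟨_, ⟨rfl, -⟩, a, b, hab, haA⟩ :=
    hP.exists_isLink_mem_of_isClosed_partition hfin he' hA hB hAB hU ⟨_, huA⟩
  have hbB : vertex b ∈ B := by
    obtain ⟨_, ⟨rfl, -⟩, b', a', hba, hb'B⟩ :=
      hP.exists_isLink_mem_of_isClosed_partition hfin he' hB hA hAB.symm hU' ⟨_, hvB⟩
    rcases hab.mem_closedEdge_iff.1 hba.left_mem_closedEdge with h | h | ⟨r, h⟩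
    · exact (disjoint_left.1 hAB haA (h ▸ hb'B)).elim
    · exact h ▸ hb'B
    · cases h
  exact ⟨A, a, B, b, ⟨he, hab, hP.left_isContinuum_of_isClosed_partition he hA hB hAB hU hab hbB,
    hP.left_isContinuum_of_isClosed_partition he hB hA hAB.symm hU' hab.symm haA, hAB, hU, haA,
    hbB⟩, huA, hvB⟩

end T2

/-! ### Arcs as minimal continua -/

/-- `P` is a continuum containing `u` and `v` in which every edge separates `u` from `v`. It plays
the role of a pseudo-arc until it is turned into one in `IsArcBetween.joinedByPseudoArcIn`. -/
structure IsArcBetween (P : Set G.Point) (u v : G.V) : Prop where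
  isContinuum : IsContinuum P
  left_mem : vertex u ∈ P
  right_mem : vertex v ∈ P
  edge_separates : ∀ e ∈ edgesOf P,
    vertex v ∉ connectedComponentIn (P \ G.innerPoints {e}) (vertex u)

/-- What remains of `P` after removing the edges in `F` is covered by two disjoint closed sets, one
containing `v` and the other containing `w`. -/
def ClosedSeparated (P : Set G.Point) (F : Set G.E) (v w : G.V) : Prop :=
  ∃ A B : Set G.Point, IsClosed A ∧ IsClosed B ∧ Disjoint A B ∧ P \ G.innerPoints F ⊆ A ∪ B ∧
    vertex v ∈ A ∧ vertex w ∈ B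

theorem IsArcBetween.symm {P : Set G.Point} {u v : G.V} (h : IsArcBetween P u v) :
    IsArcBetween P v u := by
  refine ⟨h.isContinuum, h.right_mem, h.left_mem, fun e he hcon => h.edge_separates e he ?_⟩
  rw [← connectedComponentIn_eq hcon]
  exact mem_connectedComponentIn ⟨h.right_mem, vertex_notMem_innerPoints⟩

theorem ClosedSeparated.symm {P : Set G.Point} {F : Set G.E} {v w : G.V}
    (h : ClosedSeparated P F v w) : ClosedSeparated P F w v := by
  obtain ⟨A, B, hA, hB, hAB, hU, hv, hw⟩ := h
  exact ⟨B, A, hB, hA, hAB.symm, union_comm A B ▸ hU, hw, hv⟩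

theorem ClosedSeparated.of_sdiff_subset_sdiff {P P' : Set G.Point} {F F' : Set G.E} {v w : G.V}
    (h : ClosedSeparated P F v w) (hP : P' \ G.innerPoints F' ⊆ P \ G.innerPoints F) :
    ClosedSeparated P' F' v w := by
  obtain ⟨A, B, hA, hB, hAB, hU, hv, hw⟩ := h
  exact ⟨A, B, hA, hB, hAB, hP.trans hU, hv, hw⟩

theorem ClosedSeparated.notMem {P : Set G.Point} {F : Set G.E} {v w : G.V}
    (h : ClosedSeparated P F v w) {Z : Set G.Point} (hZ : IsPreconnected Z)
    (hZP : Z ⊆ P \ G.innerPoints F) (hv : vertex v ∈ Z) : vertex w ∉ Z := fun hw => by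
  obtain ⟨A, B, hA, hB, hAB, hU, hvA, hwB⟩ := h
  have hZA : Z ⊆ A := subset_left_of_subset_union_of_isClosed hA hB hAB (hZP.trans hU)
    ⟨_, hv, hvA⟩ hZ
  exact disjoint_left.1 hAB (hZA hw) hwB

section T2

variable [T2Space G.Point]

theorem IsArcBetween.of_minimal {u v : G.V} {P : Set G.Point}
    (hP : Minimal (fun P : Set G.Point => IsContinuum P ∧ vertex u ∈ P ∧ vertex v ∈ P) P) :
    IsArcBetween P u v := by
  obtain ⟨⟨hcont, hu, hv⟩, -⟩ := id hP
  refine ⟨hcont, hu, hv, fun e ⟨r, hr⟩ hcon => ?_⟩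
  have hsub := connectedComponentIn_subset (P \ G.innerPoints {e}) (vertex u)
  have hPle := hP.le_of_le ⟨isContinuum_connectedComponentIn (hcont.isCompact_sdiff {e})
    (hcont.saturated.sdiff_innerPoints {e}) (vertex u),
    mem_connectedComponentIn ⟨hu, vertex_notMem_innerPoints⟩, hcon⟩ (hsub.trans sdiff_subset)
  exact (hsub (hPle hr)).2 (edgePt_mem_innerPoints.2 rfl)

theorem isContinuum_sInter_of_isChain {c : Set (Set G.Point)} (hc : IsChain (· ⊆ ·) c)
    (hne : c.Nonempty) (h : ∀ P ∈ c, IsContinuum P) : IsContinuum (⋂₀ c) := by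
  obtain ⟨P, hP⟩ := hne
  have hdir : DirectedOn (· ⊇ ·) c := fun A hA B hB => (hc.total hA hB).elim
    (fun hAB => ⟨A, hA, Subset.rfl, hAB⟩) fun hBA => ⟨B, hB, hBA, Subset.rfl⟩
  exact ⟨(h P hP).isCompact.of_isClosed_subset (isClosed_sInter fun Q hQ => (h Q hQ).isClosed)
      (sInter_subset_of_mem hP),
    isPreconnected_sInter_of_directedOn ⟨P, hP⟩ hdir
      (fun Q hQ => (h Q hQ).isCompact) fun Q hQ => (h Q hQ).isPreconnected,
    fun e r r' hr Q hQ => (h Q hQ).saturated e r r' (hr Q hQ)⟩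

theorem JoinedByContinuumIn.exists_isArcBetween {H : Set G.Point} {u v : G.V}
    (h : JoinedByContinuumIn H u v) : ∃ P ⊆ H, IsArcBetween P u v := by
  obtain ⟨P₀, hP₀H, hP₀, hu, hv⟩ := h
  obtain ⟨P, hPP₀, hP⟩ := zorn_superset_nonempty
    {P : Set G.Point | IsContinuum P ∧ vertex u ∈ P ∧ vertex v ∈ P}
    (fun c hcS hc hne => ⟨⋂₀ c, ⟨isContinuum_sInter_of_isChain hc hne fun P hP => (hcS hP).1,
      fun P hP => (hcS hP).2.1, fun P hP => (hcS hP).2.2⟩, fun P hP => sInter_subset_of_mem hP⟩)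
    P₀ ⟨hP₀, hu, hv⟩
  exact ⟨P, hPP₀.trans hP₀H, IsArcBetween.of_minimal hP⟩

/-- An edge of `A` that does not separate `u` from `a` in `A` does not separate `u` from `v` in `P`
either, because `f` and `B` join `a` to `v`. -/
theorem IsArcBetween.left_of_splitsAt {P A B : Set G.Point} {u v a b : G.V} {f : G.E}
    (h : IsArcBetween P u v) (hS : SplitsAt P f A a B b) (hu : vertex u ∈ A)
    (hv : vertex v ∈ B) : IsArcBetween A u a := by
  refine ⟨hS.left_isContinuum, hu, hS.left_mem, fun e ⟨r, hr⟩ ha => ?_⟩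
  have hrP := hS.left_subset hr
  have hfe : f ≠ e := by
    rintro rfl
    exact hrP.2 (edgePt_mem_innerPoints.2 rfl)
  have hconn : IsPreconnected (connectedComponentIn (A \ G.innerPoints {e}) (vertex u) ∪
      (G.closedEdge f ∪ B)) :=
    isPreconnected_connectedComponentIn.union _ ha (Or.inl hS.isLink.left_mem_closedEdge)
      ((isPreconnected_closedEdge f).union _ hS.isLink.symm.left_mem_closedEdge hS.right_mem
        hS.right_isContinuum.isPreconnected)
  refine h.edge_separates e ⟨r, hrP.1⟩ (hconn.subset_connectedComponentIn
    (Or.inl (mem_connectedComponentIn ⟨hu, vertex_notMem_innerPoints⟩)) ?_ (Or.inr (Or.inr hv)))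
  refine union_subset ((connectedComponentIn_subset _ _).trans
    (sdiff_subset_sdiff_left fun p hp => (hS.left_subset hp).1)) (union_subset (fun p hp => ?_)
    fun p hp => ⟨(hS.symm.left_subset hp).1, ?_⟩)
  · refine ⟨h.isContinuum.closedEdge_subset hS.mem_edgesOf hp, ?_⟩
    rintro ⟨s, g, rfl, rfl⟩
    exact hfe (edgePt_mem_closedEdge.1 hp).symm
  · rintro ⟨s, g, rfl, rfl⟩
    exact disjoint_left.1 hS.disjoint (hS.left_isContinuum.saturated g r s hr) hp

theorem ClosedSeparated.of_splitsAt {P A B : Set G.Point} {F : Set G.E} {a b v w : G.V} {f : G.E}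
    (h : ClosedSeparated A F v w) (hS : SplitsAt P f A a B b) (hv : vertex v ∈ A)
    (hw : vertex w ∈ A) : ClosedSeparated P F v w := by
  have of_left_mem : ∀ {v w : G.V} {x y : Set G.Point}, vertex v ∈ A → vertex w ∈ A →
      IsClosed x → IsClosed y → Disjoint x y → A \ G.innerPoints F ⊆ x ∪ y → vertex v ∈ x →
      vertex w ∈ y → vertex a ∈ x → ClosedSeparated P F v w := by
    intro v w x y hv hw hx hy hxy hU hvx hwy hax
    have hA := hS.left_isContinuum.isClosed
    refine ⟨A ∩ x ∪ (B ∪ G.closedEdge f), A ∩ y, (hA.inter hx).union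
      (hS.right_isContinuum.isClosed.union (isClosed_closedEdge f)), hA.inter hy, ?_, ?_,
      Or.inl ⟨hv, hvx⟩, ⟨hw, hwy⟩⟩
    · rw [disjoint_right]
      rintro p ⟨hpA, hpy⟩ (⟨-, hpx⟩ | hpB | hpf)
      · exact disjoint_left.1 hxy hpx hpy
      · exact disjoint_left.1 hS.disjoint hpA hpB
      · exact disjoint_left.1 hxy hax (hS.eq_left_of_mem_closedEdge hpA hpf ▸ hpy)
    · rintro p ⟨hpP, hpF⟩
      rcases hS.subset_union_closedEdge hpP with hpA | hp
      · exact (hU ⟨hpA, hpF⟩).imp (fun hpx => Or.inl ⟨hpA, hpx⟩) fun hpy => ⟨hpA, hpy⟩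
      · exact Or.inl (Or.inr hp)
  obtain ⟨x, y, hx, hy, hxy, hU, hvx, hwy⟩ := h
  rcases hU ⟨hS.left_mem, vertex_notMem_innerPoints⟩ with hax | hay
  · exact of_left_mem hv hw hx hy hxy hU hvx hwy hax
  · exact (of_left_mem hw hv hy hx hxy.symm (union_comm x y ▸ hU) hwy hvx hay).symm

theorem IsArcBetween.exists_edge_closedSeparated {F : Set G.E} (hF : F.Finite) {P : Set G.Point}
    {u v x y : G.V} (h : IsArcBetween P u v) (hx : vertex x ∈ P) (hy : vertex y ∈ P)
    (hs : ClosedSeparated P F x y) : ∃ e ∈ edgesOf P, ClosedSeparated P {e} x y := by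
  induction F, hF using Set.Finite.induction_on generalizing P u v with
  | empty =>
    exact absurd hy (hs.notMem h.isContinuum.isPreconnected
      (fun p hp => ⟨hp, fun ⟨_, _, he, _⟩ => he.elim⟩) hx)
  | @insert f F _ _ ih =>
    by_cases hf : f ∈ edgesOf P
    · have of_mem_left : ∀ {A B : Set G.Point} {a b u v : G.V}, IsArcBetween P u v →
          SplitsAt P f A a B b → vertex u ∈ A → vertex v ∈ B → vertex x ∈ A → vertex y ∈ A →
          ∃ e ∈ edgesOf P, ClosedSeparated P {e} x y := by
        intro A B a b u v h hS hu hv hx hy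
        obtain ⟨e, ⟨r, hr⟩, hes⟩ := ih (h.left_of_splitsAt hS hu hv) hx hy
          (hs.of_sdiff_subset_sdiff fun p hp => ⟨(hS.left_subset hp.1).1, by
            rw [innerPoints_insert]
            exact fun h => h.elim (hS.left_subset hp.1).2 hp.2⟩)
        exact ⟨e, ⟨r, (hS.left_subset hr).1⟩, hes.of_splitsAt hS hx hy⟩
      obtain ⟨A, a, B, b, hS, huA, hvB⟩ :=
        h.isContinuum.exists_splitsAt h.left_mem h.right_mem hf (h.edge_separates f hf)
      have of_mem_of_mem : ∀ {x y}, vertex x ∈ A → vertex y ∈ B → ClosedSeparated P {f} x y :=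
        fun hx hy => ⟨A, B, hS.left_isContinuum.isClosed, hS.right_isContinuum.isClosed,
          hS.disjoint, hS.union_eq.superset, hx, hy⟩
      rcases hS.vertex_mem hx with hxA | hxB <;> rcases hS.vertex_mem hy with hyA | hyB
      · exact of_mem_left h hS huA hvB hxA hyA
      · exact ⟨f, hf, of_mem_of_mem hxA hyB⟩
      · exact ⟨f, hf, (of_mem_of_mem hyA hxB).symm⟩
      · exact of_mem_left h.symm hS.symm hvB huA hxB hyB
    · refine ih h hx hy (hs.of_sdiff_subset_sdiff fun p hp => ⟨hp.1, ?_⟩)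
      rw [innerPoints_insert]
      rintro (⟨r, g, rfl, rfl⟩ | hpF)
      · exact hf ⟨r, hp.1⟩
      · exact hp.2 hpF

theorem IsContinuum.exists_finite_closedSeparated {P : Set G.Point} (hP : IsContinuum P)
    {x y : G.V} (hx : vertex x ∈ P) (hy : vertex y ∈ P) (hxy : x ≠ y) :
    ∃ F : Set G.E, F.Finite ∧ ClosedSeparated P F x y := by
  obtain ⟨U, U', hU, hU', hUU', vertex_mem, hxU, hyU'⟩ := G.separated x y hxy
  obtain ⟨t, ht⟩ := hP.isCompact.elim_finite_subcover
    (fun o : Option G.E => o.elim (U ∪ U') fun e => G.innerPoints {e})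
    (by rintro (_ | e); exacts [hU.union hU', isOpen_innerPoints {e}])
    (by
      rintro (v | ⟨r, e⟩) -
      · exact mem_iUnion.2 ⟨none, vertex_mem v⟩
      · exact mem_iUnion.2 ⟨some e, edgePt_mem_innerPoints.2 rfl⟩)
  set F : Set G.E := {e | some e ∈ t}
  have hPF : IsClosed (P \ G.innerPoints F) := (hP.isCompact_sdiff F).isClosed
  have hPFU : P \ G.innerPoints F ⊆ U ∪ U' := by
    rintro p ⟨hp, hpF⟩
    obtain ⟨_ | e, ho, hpo⟩ := mem_iUnion₂.1 (ht hp)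
    · exact hpo
    · obtain ⟨r, f, rfl, rfl⟩ := hpo
      exact absurd (edgePt_mem_innerPoints.2 ho) hpF
  refine ⟨F, t.finite_toSet.preimage (Option.some_injective _).injOn, (P \ G.innerPoints F) \ U',
    (P \ G.innerPoints F) \ U, hPF.sdiff hU', hPF.sdiff hU, ?_, fun p hp => ?_,
    ⟨⟨hx, vertex_notMem_innerPoints⟩, disjoint_left.1 hUU' hxU⟩,
    ⟨⟨hy, vertex_notMem_innerPoints⟩, disjoint_right.1 hUU' hyU'⟩⟩
  · exact disjoint_left.2 fun p hp hp' => (hPFU hp.1).elim hp'.2 hp.2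
  · by_cases hpU : p ∈ U
    · exact Or.inl ⟨hp, disjoint_left.1 hUU' hpU⟩
    · exact Or.inr ⟨hp, hpU⟩

end T2

variable {G' : GraphLikeSpace.{u}}

/-! ### Maps of graph-like spaces -/

theorem Hom.continuous (φ : Hom G G') : Continuous φ.toFun :=
  φ.continuous_inducedFun

theorem Hom.toFun_edgePt (φ : Hom G G') (f : G.E) :
    (∃ v, ∀ r, φ.toFun (edgePt r f) = vertex v) ∨
      ∃ (σ : Equiv.Perm (Ioo (0 : ℝ) 1)) (e : G'.E),
        ∀ r, φ.toFun (edgePt r f) = edgePt (σ r) e := by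
  rcases hf : φ.onE f with ⟨e, _ | _⟩ | v
  · have hinv : Function.Involutive fun r : Ioo (0 : ℝ) 1 =>
        (⟨1 - (r : ℝ), sub_pos.2 r.2.2, sub_lt_self 1 r.2.1⟩ : Ioo (0 : ℝ) 1) := fun r =>
      Subtype.ext (sub_sub_cancel 1 (r : ℝ))
    exact Or.inr ⟨hinv.toPerm, e, fun r => by simp [toFun, inducedFun, hf]⟩
  · exact Or.inr ⟨1, e, fun r => by simp [toFun, inducedFun, hf]⟩
  · exact Or.inl ⟨v, fun r => by simp [toFun, inducedFun, hf]⟩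

theorem Saturated.image (φ : Hom G G') {P : Set G.Point} (hP : Saturated P) :
    Saturated (φ.toFun '' P) := by
  rintro e r r' ⟨v | ⟨s, f⟩, hp, hpe⟩
  · cases hpe
  rcases φ.toFun_edgePt f with ⟨v, hv⟩ | ⟨σ, g, hσ⟩
  · cases (hv s).symm.trans hpe
  · obtain ⟨-, rfl⟩ := GraphLikePoint.edgePt.inj ((hσ s).symm.trans hpe)
    exact ⟨edgePt (σ.symm r') f, hP f s _ hp, by rw [hσ, Equiv.apply_symm_apply]⟩

theorem IsContinuum.image (φ : Hom G G') {P : Set G.Point} (hP : IsContinuum P) :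
    IsContinuum (φ.toFun '' P) :=
  ⟨hP.isCompact.image φ.continuous, hP.isPreconnected.image _ φ.continuous.continuousOn,
    hP.saturated.image φ⟩

theorem JoinedByContinuumIn.image (φ : Hom G G') {H : Set G.Point} {u v : G.V}
    (h : JoinedByContinuumIn H u v) :
    JoinedByContinuumIn (φ.toFun '' H) (φ.onV u) (φ.onV v) := by
  obtain ⟨P, hPH, hP, hu, hv⟩ := h
  exact ⟨φ.toFun '' P, image_mono hPH, hP.image φ, ⟨_, hu, rfl⟩, ⟨_, hv, rfl⟩⟩

theorem isContinuum_univ [CompactSpace G.Point] [PreconnectedSpace G.Point] :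
    IsContinuum (univ : Set G.Point) :=
  ⟨isCompact_univ, isPreconnected_univ, fun _ _ _ _ => mem_univ _⟩

theorem JoinedByPseudoArcIn.joinedByContinuumIn {H : Set G.Point} {u v : G.V}
    (h : G.JoinedByPseudoArcIn H u v) : JoinedByContinuumIn H u v := by
  obtain ⟨L, s, t, φ, hL, -, rfl, rfl, hH⟩ := h
  have := hL.compact
  have := hL.connected
  exact ⟨φ.toFun '' univ, image_univ ▸ hH, isContinuum_univ.image φ,
    ⟨vertex s, mem_univ _, rfl⟩, ⟨vertex t, mem_univ _, rfl⟩⟩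

theorem Hom.exists_injective_image_innerPoints (φ : Hom G G')
    (hφ : Function.Injective φ.toFun) : ∃ ψ : G.E → G'.E, Function.Injective ψ ∧
      ∀ F, φ.toFun '' G.innerPoints F = G'.innerPoints (ψ '' F) := by
  have hedge : ∀ f, ∃ (σ : Equiv.Perm (Ioo (0 : ℝ) 1)) (e : G'.E),
      ∀ r, φ.toFun (edgePt r f) = edgePt (σ r) e := fun f => by
    refine (φ.toFun_edgePt f).resolve_left fun ⟨v, hv⟩ => ?_
    have h : (⟨1 / 2, by norm_num, by norm_num⟩ : Ioo (0 : ℝ) 1) =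
        ⟨1 / 3, by norm_num, by norm_num⟩ :=
      (GraphLikePoint.edgePt.inj (hφ ((hv _).trans (hv _).symm))).1
    norm_num at h
  choose σ ψ hψ using hedge
  refine ⟨ψ, fun f f' hff' => ?_, fun F => ?_⟩
  · have r : Ioo (0 : ℝ) 1 := ⟨1 / 2, by norm_num, by norm_num⟩
    refine (GraphLikePoint.edgePt.inj (hφ (?_ : φ.toFun (edgePt r f) =
      φ.toFun (edgePt ((σ f').symm (σ f r)) f')))).2
    rw [hψ, hψ, Equiv.apply_symm_apply, hff']
  · ext p
    constructor
    · rintro ⟨_, ⟨r, f, hf, rfl⟩, rfl⟩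
      exact ⟨σ f r, ψ f, ⟨f, hf, rfl⟩, hψ f r⟩
    · rintro ⟨r, _, ⟨f, hf, rfl⟩, rfl⟩
      exact ⟨_, ⟨(σ f).symm r, f, hf, rfl⟩, by rw [hψ, Equiv.apply_symm_apply]⟩

theorem Hom.image_removeEdges (φ : Hom G G') (hφ : Function.Injective φ.toFun)
    {F : Set G.E} {F' : Set G'.E} (hF : φ.toFun '' G.innerPoints F = G'.innerPoints F') :
    φ.toFun '' G.removeEdges F = range φ.toFun \ G'.innerPoints F' := by
  rw [removeEdges, image_compl_eq_range_sdiff_image hφ, hF]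

/-! ### The subspace on a set of vertices and edges -/

/-- The inclusion of a subspace as a map of graph-like spaces. -/
def subspaceHom (G : GraphLikeSpace.{u}) (V' : Set G.V) (E' : Set G.E)
    (h0 : ∀ e ∈ E', G.src e ∈ V') (h1 : ∀ e ∈ E', G.tgt e ∈ V') :
    Hom (G.subspace V' E' h0 h1) G where
  onV := fun v : V' => (v : G.V)
  onE := fun e : E' => Sum.inl ((e : G.E), true)
  continuous_inducedFun := by
    have h : (inducedFun (fun v : V' => (v : G.V)) (fun e : E' => Sum.inl ((e : G.E), true)) :
        GraphLikePoint V' E' → GraphLikePoint G.V G.E) = inclusion V' E' := by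
      funext p
      rcases p with v | ⟨r, e⟩ <;> rfl
    exact continuous_iff_le_induced.2 (h ▸ le_rfl)

section Subspace

variable {V' : Set G.V} {E' : Set G.E} (h0 : ∀ e ∈ E', G.src e ∈ V')
  (h1 : ∀ e ∈ E', G.tgt e ∈ V')

theorem subspaceHom_toFun : (G.subspaceHom V' E' h0 h1).toFun = inclusion V' E' := by
  funext p
  rcases p with v | ⟨r, e⟩ <;> rfl

theorem isInducing_subspaceHom : Topology.IsInducing (G.subspaceHom V' E' h0 h1).toFun := by
  rw [subspaceHom_toFun]
  exact ⟨rfl⟩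

theorem subspaceHom_injective : Function.Injective (G.subspaceHom V' E' h0 h1).toFun := by
  rw [subspaceHom_toFun]
  rintro (v | ⟨r, e⟩) (w | ⟨s, f⟩) h
  · exact congrArg vertex (Subtype.ext (GraphLikePoint.vertex.inj h))
  · cases h
  · cases h
  · obtain ⟨hrs, hef⟩ := GraphLikePoint.edgePt.inj h
    exact congrArg₂ edgePt hrs (Subtype.ext hef)

theorem subspaceHom_image_innerPoints (F : Set E') :
    (G.subspaceHom V' E' h0 h1).toFun '' (G.subspace V' E' h0 h1).innerPoints F =
      G.innerPoints (Subtype.val '' F) := by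
  ext p
  constructor
  · rintro ⟨_, ⟨r, (e : E'), he, rfl⟩, rfl⟩
    exact ⟨r, e.1, ⟨e, he, rfl⟩, rfl⟩
  · rintro ⟨r, _, ⟨e, he, rfl⟩, rfl⟩
    exact ⟨(edgePt r e : (G.subspace V' E' h0 h1).Point), edgePt_mem_innerPoints.2 he, rfl⟩

end Subspace

/-! ### Continua as graph-like spaces -/

section T2

variable [T2Space G.Point] {P : Set G.Point}

namespace IsContinuum

/-- The continuum `P` as a graph-like space in its own right. -/
def toGraphLikeSpace (hP : IsContinuum P) : GraphLikeSpace.{u} :=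
  G.subspace (vertex ⁻¹' P) (edgesOf P) (fun e he => hP.left_mem he (isLink_src_tgt e))
    fun e he => hP.left_mem he (isLink_src_tgt e).symm

/-- The inclusion of the continuum `P`. -/
def incl (hP : IsContinuum P) : Hom hP.toGraphLikeSpace G :=
  G.subspaceHom _ _ _ _

theorem isInducing_incl (hP : IsContinuum P) : Topology.IsInducing hP.incl.toFun :=
  isInducing_subspaceHom _ _

theorem incl_injective (hP : IsContinuum P) : Function.Injective hP.incl.toFun :=
  subspaceHom_injective _ _

theorem range_incl (hP : IsContinuum P) : range hP.incl.toFun = P := by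
  ext p
  constructor
  · rintro ⟨v | ⟨r, e⟩, rfl⟩
    exacts [v.2, hP.saturated.mem e.2 r]
  · intro hp
    rcases p with v | ⟨r, e⟩
    exacts [⟨vertex ⟨v, hp⟩, rfl⟩, ⟨edgePt r ⟨e, r, hp⟩, rfl⟩]

theorem image_removeEdges (hP : IsContinuum P) {F : Set (edgesOf P)} {F' : Set G.E}
    (hF : Subtype.val '' F = F') :
    hP.incl.toFun '' hP.toGraphLikeSpace.removeEdges F = P \ G.innerPoints F' := by
  subst hF
  rw [hP.incl.image_removeEdges hP.incl_injective (subspaceHom_image_innerPoints _ _ F),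
    hP.range_incl]

theorem compactSpace (hP : IsContinuum P) : CompactSpace hP.toGraphLikeSpace.Point := by
  rw [← isCompact_univ_iff, hP.isInducing_incl.isCompact_iff, image_univ, hP.range_incl]
  exact hP.isCompact

theorem connectedSpace (hP : IsContinuum P) {v : G.V} (hv : vertex v ∈ P) :
    ConnectedSpace hP.toGraphLikeSpace.Point := by
  refine connectedSpace_iff_univ.2 ⟨⟨vertex ⟨v, hv⟩, mem_univ _⟩, ?_⟩
  rw [← hP.isInducing_incl.isPreconnected_image, image_univ, hP.range_incl]
  exact hP.isPreconnected

theorem edgesSeparate (hP : IsContinuum P) {F : Set (edgesOf P)} {F' : Set G.E}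
    (hF : Subtype.val '' F = F') {x y : hP.toGraphLikeSpace.V}
    (h : vertex (hP.incl.onV y) ∉
      connectedComponentIn (P \ G.innerPoints F') (vertex (hP.incl.onV x))) :
    hP.toGraphLikeSpace.EdgesSeparate F x y := by
  refine fun hy => h ?_
  rw [← hP.image_removeEdges hF]
  exact hP.incl.continuous.continuousOn.image_connectedComponentIn_subset
    vertex_notMem_innerPoints ⟨vertex y, hy, rfl⟩

end IsContinuum

/-! ### Pseudo-lines -/

theorem IsArcBetween.isPseudoLine {u v : G.V} (h : IsArcBetween P u v) :
    h.isContinuum.toGraphLikeSpace.IsPseudoLine ⟨u, h.left_mem⟩ ⟨v, h.right_mem⟩ := by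
  refine ⟨h.isContinuum.compactSpace, h.isContinuum.connectedSpace h.left_mem, fun e => ?_,
    fun x y hxy => ?_⟩
  · exact h.isContinuum.edgesSeparate image_singleton (h.edge_separates e.1 e.2)
  · obtain ⟨F, hF, hsep⟩ := h.isContinuum.exists_finite_closedSeparated x.2 y.2
      fun hxy' => hxy (Subtype.ext hxy')
    obtain ⟨e, he, hesep⟩ := h.exists_edge_closedSeparated hF x.2 y.2 hsep
    refine ⟨⟨e, he⟩, h.isContinuum.edgesSeparate image_singleton ?_⟩
    exact hesep.notMem isPreconnected_connectedComponentIn (connectedComponentIn_subset _ _)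
      (mem_connectedComponentIn ⟨x.2, vertex_notMem_innerPoints⟩)

theorem IsArcBetween.joinedByPseudoArcIn {H : Set G.Point} {u v : G.V} (h : IsArcBetween P u v)
    (hPH : P ⊆ H) : G.JoinedByPseudoArcIn H u v :=
  ⟨_, _, _, h.isContinuum.incl, h.isPseudoLine, h.isContinuum.incl_injective, rfl, rfl,
    h.isContinuum.range_incl.trans_subset hPH⟩

theorem JoinedByContinuumIn.joinedByPseudoArcIn {H : Set G.Point} {u v : G.V}
    (h : JoinedByContinuumIn H u v) : G.JoinedByPseudoArcIn H u v := by
  obtain ⟨P, hPH, hP⟩ := h.exists_isArcBetween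
  exact hP.joinedByPseudoArcIn hPH

end T2

/-! ### Pseudo-circles -/

/-- `P` is a continuum with at least one edge that remains connected when one edge is removed but
not when two are. It is to pseudo-circles what `IsArcBetween` is to pseudo-arcs, except that the
separation of vertices is left out. -/
structure IsCircleSet (P : Set G.Point) : Prop where
  isContinuum : IsContinuum P
  nonempty_edgesOf : (edgesOf P).Nonempty
  remove_one : ∀ e ∈ edgesOf P, IsPreconnected (P \ G.innerPoints {e})
  remove_two : ∀ e ∈ edgesOf P, ∀ f ∈ edgesOf P, e ≠ f →
    ¬ IsPreconnected (P \ G.innerPoints {e, f})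

theorem IsCircleSet.isPseudoCircle [T2Space G.Point] {P : Set G.Point} (h : IsCircleSet P)
    (hsep : ∀ v w, vertex v ∈ P → vertex w ∈ P → v ≠ w → ∃ e ∈ edgesOf P, ∃ f ∈ edgesOf P,
      e ≠ f ∧ vertex w ∉ connectedComponentIn (P \ G.innerPoints {e, f}) (vertex v)) :
    h.isContinuum.toGraphLikeSpace.IsPseudoCircle := by
  have hP := h.isContinuum
  obtain ⟨e₀, he₀⟩ := h.nonempty_edgesOf
  refine ⟨hP.compactSpace, hP.connectedSpace (hP.left_mem he₀ (isLink_src_tgt e₀)), ⟨⟨e₀, he₀⟩⟩,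
    fun e => ⟨⟨vertex (hP.toGraphLikeSpace.src e), vertex_notMem_innerPoints⟩, ?_⟩,
    fun e f hef hcon => ?_, fun v w hvw => ?_⟩
  · rw [← hP.isInducing_incl.isPreconnected_image]
    exact (hP.image_removeEdges image_singleton).symm ▸ h.remove_one e.1 e.2
  · refine h.remove_two e.1 e.2 f.1 f.2 (fun hef' => hef (Subtype.ext hef')) ?_
    exact hP.image_removeEdges (image_pair _ _ _) ▸
      hP.isInducing_incl.isPreconnected_image.2 hcon.isPreconnected
  · obtain ⟨e, he, f, hf, hef, hvwef⟩ := hsep v.1 w.1 v.2 w.2 fun h => hvw (Subtype.ext h)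
    refine ⟨⟨e, he⟩, ⟨f, hf⟩, fun h => hef (congrArg Subtype.val h), ?_⟩
    exact hP.edgesSeparate (image_pair _ _ _) hvwef

theorem IsPseudoCircle.isCircleSet_range [T2Space G'.Point] (hG : G.IsPseudoCircle)
    (φ : Hom G G') (hφ : Function.Injective φ.toFun) : IsCircleSet (range φ.toFun) := by
  have := hG.compact
  have := hG.connected
  have hind := (φ.continuous.isClosedEmbedding hφ).isInducing
  obtain ⟨ψ, -, himage⟩ := φ.exists_injective_image_innerPoints hφ
  have hedges : edgesOf (range φ.toFun) = range ψ := by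
    ext e
    constructor
    · rintro ⟨r, v | ⟨s, f⟩, hp⟩
      · cases hp
      · have hmem : φ.toFun (edgePt s f) ∈ G'.innerPoints (ψ '' {f}) :=
          himage {f} ▸ mem_image_of_mem _ (edgePt_mem_innerPoints.2 rfl)
        rw [hp, image_singleton, edgePt_mem_innerPoints] at hmem
        exact ⟨f, hmem.symm⟩
    · rintro ⟨f, rfl⟩
      refine ⟨⟨1 / 2, by norm_num, by norm_num⟩, image_subset_range _ (G.innerPoints {f}) ?_⟩
      rw [himage, image_singleton, edgePt_mem_innerPoints, mem_singleton_iff]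
  have hremove := fun F => φ.image_removeEdges hφ (himage F)
  refine ⟨image_univ ▸ isContinuum_univ.image φ, ?_, ?_, ?_⟩ <;> rw [hedges]
  · exact hG.nonempty_edges.elim fun f => ⟨ψ f, f, rfl⟩
  · rintro _ ⟨f, rfl⟩
    rw [← image_singleton, ← hremove, hind.isPreconnected_image]
    exact (hG.remove_one f).isPreconnected
  · rintro _ ⟨f, rfl⟩ _ ⟨f', rfl⟩ hff' hcon
    rw [← image_pair, ← hremove, hind.isPreconnected_image] at hcon
    exact hG.remove_two f f' (fun h => hff' (congrArg ψ h))
      ⟨⟨vertex (G.src f), vertex_notMem_innerPoints⟩, hcon⟩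

theorem t2Space_of_disjoint_nhds
    (h : ∀ (v : G.V) (r : Ioo (0 : ℝ) 1) (e : G.E),
      Disjoint (nhds (X := G.Point) (vertex v)) (nhds (X := G.Point) (edgePt r e))) :
    T2Space G.Point := by
  have hnhds : ∀ (r : Ioo (0 : ℝ) 1) (e : G.E) {U : Set (Ioo (0 : ℝ) 1)}, IsOpen U → r ∈ U →
      (fun t => (edgePt t e : G.Point)) '' U ∈ nhds (X := G.Point) (edgePt r e) :=
    fun r e U hU hr => (G.isOpenMap_inner e U hU).mem_nhds (mem_image_of_mem _ hr)
  refine t2Space_iff_disjoint_nhds.2 ?_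
  rintro (v | ⟨r, e⟩) (w | ⟨s, f⟩) hne
  · obtain ⟨U, V, hU, hV, hUV, -, hv, hw⟩ := G.separated v w fun hvw => hne (congrArg vertex hvw)
    exact Filter.disjoint_of_disjoint_of_mem hUV (hU.mem_nhds hv) (hV.mem_nhds hw)
  · exact h v s f
  · exact (h w r e).symm
  by_cases hef : e = f
  · subst hef
    obtain ⟨U, V, hU, hV, hr, hs, hUV⟩ := t2_separation fun hrs : r = s => hne (hrs ▸ rfl)
    refine Filter.disjoint_of_disjoint_of_mem ?_ (hnhds r e hU hr) (hnhds s e hV hs)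
    exact (disjoint_image_iff fun a b hab => (GraphLikePoint.edgePt.inj hab).1).2 hUV
  · refine Filter.disjoint_of_disjoint_of_mem ?_ (hnhds r e isOpen_univ (mem_univ r))
      (hnhds s f isOpen_univ (mem_univ s))
    rw [disjoint_left]
    rintro _ ⟨a, -, rfl⟩ ⟨b, -, hb⟩
    exact hef (GraphLikePoint.edgePt.inj hb).2.symm

end GraphLikeSpace

namespace Matroid.GraphFramework

open GraphLikePoint GraphLikeSpace

variable {α : Type u} {M : Matroid α} {Γ : M.GraphFramework} {s : Set α}
  {b : {b : Set α // M.IsCocircuit b}} {i : ℤˣ} {ε : M.E → Ioo (0 : ℝ) 1} {v w : Vert M}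
  {e : M.E} {r : Ioo (0 : ℝ) 1}

/-! ### The topology of `G(M, Γ)` -/

/-- The edges of `G(M, Γ)` that belong to `s`. -/
def edgeSet (Γ : M.GraphFramework) (s : Set α) : Set Γ.toGraphLikeSpace.E :=
  (Subtype.val ⁻¹' s : Set M.E)

/-- The interior points of the edges of `G(M, Γ)` that belong to `s`. -/
def inner (Γ : M.GraphFramework) (s : Set α) : Set Γ.toGraphLikeSpace.Point :=
  Γ.toGraphLikeSpace.innerPoints (Γ.edgeSet s)

@[simp] theorem edgePt_mem_inner :
    (edgePt r e : Γ.toGraphLikeSpace.Point) ∈ Γ.inner s ↔ (e : α) ∈ s :=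
  edgePt_mem_innerPoints

@[simp] theorem vertex_notMem_inner : (vertex v : Γ.toGraphLikeSpace.Point) ∉ Γ.inner s :=
  vertex_notMem_innerPoints

theorem isOpen_inner (s : Set α) : IsOpen (Γ.inner s) :=
  isOpen_innerPoints _

theorem finite_edgeSet (hs : s.Finite) : (Γ.edgeSet s).Finite :=
  hs.preimage Subtype.val_injective.injOn

/-- The set `U_b^i(ε)` as a set of points of `G(M, Γ)`. -/
def nbhd (Γ : M.GraphFramework) (b : {b : Set α // M.IsCocircuit b}) (i : ℤˣ)
    (ε : M.E → Ioo (0 : ℝ) 1) : Set Γ.toGraphLikeSpace.Point :=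
  Γ.sideSet b i ε

/-- The set `U_b^i(1/2)`, the part of `G(M, Γ)` on the side `i` of the cocircuit `b`. With
`ε = 1/2` the two sides are disjoint and miss only the midpoints of the edges of `b`. -/
noncomputable def side (Γ : M.GraphFramework) (b : {b : Set α // M.IsCocircuit b}) (i : ℤˣ) :
    Set Γ.toGraphLikeSpace.Point :=
  Γ.nbhd b i fun _ => ⟨1 / 2, by norm_num, by norm_num⟩

theorem isOpen_nbhd (b : {b : Set α // M.IsCocircuit b}) (i : ℤˣ) (ε : M.E → Ioo (0 : ℝ) 1) :
    IsOpen (Γ.nbhd b i ε) :=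
  TopologicalSpace.isOpen_generateFrom_of_mem (Or.inr ⟨b, i, ε, rfl⟩)

theorem isOpen_side (b : {b : Set α // M.IsCocircuit b}) (i : ℤˣ) : IsOpen (Γ.side b i) :=
  isOpen_nbhd b i _

@[simp] theorem vertex_mem_nbhd :
    (vertex v : Γ.toGraphLikeSpace.Point) ∈ Γ.nbhd b i ε ↔ v b = i :=
  Iff.rfl

@[simp] theorem vertex_mem_side :
    (vertex v : Γ.toGraphLikeSpace.Point) ∈ Γ.side b i ↔ v b = i :=
  Iff.rfl

theorem edgePt_mem_nbhd :
    (edgePt r e : Γ.toGraphLikeSpace.Point) ∈ Γ.nbhd b i ε ↔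
      ((e : α) ∉ b.1 ∧ Γ.σ b.1 e = i) ∨
        ((e : α) ∈ b.1 ∧ Γ.d b.1 e = i ∧ 1 - (ε e : ℝ) < (r : ℝ)) ∨
        ((e : α) ∈ b.1 ∧ Γ.d b.1 e = -i ∧ (r : ℝ) < (ε e : ℝ)) :=
  Iff.rfl

theorem edgePt_mem_nbhd_of_notMem (he : (e : α) ∉ b.1) :
    (edgePt r e : Γ.toGraphLikeSpace.Point) ∈ Γ.nbhd b i ε ↔ Γ.σ b.1 e = i := by
  rw [edgePt_mem_nbhd]
  tauto

theorem edgePt_mem_side_of_notMem (he : (e : α) ∉ b.1) :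
    (edgePt r e : Γ.toGraphLikeSpace.Point) ∈ Γ.side b i ↔ Γ.σ b.1 e = i :=
  edgePt_mem_nbhd_of_notMem he

theorem edgePt_notMem_nbhd (he : (e : α) ∈ b.1) (h0 : (ε e : ℝ) ≤ r) (h1 : (r : ℝ) ≤ 1 - ε e) :
    (edgePt r e : Γ.toGraphLikeSpace.Point) ∉ Γ.nbhd b i ε := by
  intro h
  rcases edgePt_mem_nbhd.1 h with h | ⟨-, -, h⟩ | ⟨-, -, h⟩
  exacts [h.1 he, h1.not_gt h, h0.not_gt h]

theorem midpoint_notMem_side (he : (e : α) ∈ b.1) :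
    (edgePt ⟨1 / 2, by norm_num, by norm_num⟩ e : Γ.toGraphLikeSpace.Point) ∉ Γ.side b i :=
  edgePt_notMem_nbhd he le_rfl (by norm_num)

theorem disjoint_side (b : {b : Set α // M.IsCocircuit b}) (i : ℤˣ) :
    Disjoint (Γ.side b i) (Γ.side b (-i)) :=
  Γ.disjoint_sideSet_half b i

theorem compl_inner_subset (b : {b : Set α // M.IsCocircuit b}) (i : ℤˣ) :
    (Γ.inner b.1)ᶜ ⊆ Γ.side b i ∪ Γ.side b (-i) := by
  rintro (v | ⟨r, (e : M.E)⟩) hp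
  · exact (eq_or_ne ((v : Vert M) b) i).imp id Int.units_ne_iff_eq_neg.1
  · have he : (e : α) ∉ b.1 := fun h => hp (edgePt_mem_inner.2 h)
    exact (eq_or_ne (Γ.σ b.1 e) i).imp (edgePt_mem_side_of_notMem he).2
      fun h => (edgePt_mem_side_of_notMem he).2 (Int.units_ne_iff_eq_neg.1 h)

theorem side_sdiff_inner_subset_nbhd (b : {b : Set α // M.IsCocircuit b}) (i : ℤˣ)
    (ε : M.E → Ioo (0 : ℝ) 1) : Γ.side b i \ Γ.inner b.1 ⊆ Γ.nbhd b i ε := by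
  rintro (v | ⟨r, (e : M.E)⟩) ⟨hp, hpb⟩
  · exact hp
  · have he : (e : α) ∉ b.1 := fun h => hpb (edgePt_mem_inner.2 h)
    exact (edgePt_mem_nbhd_of_notMem he).2 ((edgePt_mem_side_of_notMem he).1 hp)

theorem nbhd_mono {ε' : M.E → Ioo (0 : ℝ) 1} (h : ∀ e, ε e ≤ ε' e) :
    Γ.nbhd b i ε ⊆ Γ.nbhd b i ε' := by
  rintro (v | ⟨r, e⟩) hp
  · exact hp
  · have he : ((ε e : Ioo (0 : ℝ) 1) : ℝ) ≤ ε' e := h e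
    exact edgePt_mem_nbhd.2 ((edgePt_mem_nbhd.1 hp).imp id (Or.imp
      (And.imp_right (And.imp_right (sub_le_sub_left he 1).trans_lt))
      (And.imp_right (And.imp_right he.trans_lt'))))

theorem exists_biInter_nbhd_subset {U : Set Γ.toGraphLikeSpace.Point} (hU : IsOpen U)
    (hv : vertex v ∈ U) :
    ∃ (B : Finset {b : Set α // M.IsCocircuit b})
      (ε : {b : Set α // M.IsCocircuit b} → M.E → Ioo (0 : ℝ) 1),
      (⋂ b ∈ B, Γ.nbhd b (v b) (ε b)) ⊆ U := by
  classical
  have hU' : TopologicalSpace.GenerateOpen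
    {S | (∃ (W : Set (Ioo (0 : ℝ) 1)) (e : M.E), IsOpen W ∧ S = (fun r => edgePt r e) '' W) ∨
      ∃ b i ε, S = Γ.sideSet b i ε} U := hU
  clear hU
  induction hU' with
  | basic S hS =>
    rcases hS with ⟨W, e, -, rfl⟩ | ⟨b, i, ε, rfl⟩
    · obtain ⟨r, -, hr⟩ := hv
      cases hr
    · refine ⟨{b}, fun _ => ε, ?_⟩
      rw [Finset.set_biInter_singleton, show v b = i from hv]
      exact Subset.rfl
  | univ => exact ⟨∅, fun _ _ => ⟨1 / 2, by norm_num, by norm_num⟩, subset_univ _⟩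
  | inter S T _ _ ihS ihT =>
    obtain ⟨B₁, ε₁, h₁⟩ := ihS hv.1
    obtain ⟨B₂, ε₂, h₂⟩ := ihT hv.2
    refine ⟨B₁ ∪ B₂, fun b e => min (ε₁ b e) (ε₂ b e), fun p hp => ⟨h₁ ?_, h₂ ?_⟩⟩
    · exact mem_iInter₂.2 fun b hb => nbhd_mono (fun e => min_le_left _ _)
        (mem_iInter₂.1 hp b (Finset.mem_union_left _ hb))
    · exact mem_iInter₂.2 fun b hb => nbhd_mono (fun e => min_le_right _ _)
        (mem_iInter₂.1 hp b (Finset.mem_union_right _ hb))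
  | sUnion 𝒮 _ ih =>
    obtain ⟨S, hS, hvS⟩ := hv
    obtain ⟨B, ε, h⟩ := ih S hS hvS
    exact ⟨B, ε, h.trans (subset_sUnion_of_mem hS)⟩

theorem le_nhds_vertex {f : Filter Γ.toGraphLikeSpace.Point}
    (h : ∀ b ε, Γ.nbhd b (v b) ε ∈ f) : f ≤ nhds (X := Γ.toGraphLikeSpace.Point) (vertex v) := by
  intro U hU
  obtain ⟨V, hVU, hV, hvV⟩ := mem_nhds_iff.1 hU
  obtain ⟨B, ε, hB⟩ := exists_biInter_nbhd_subset hV hvV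
  exact Filter.mem_of_superset ((Filter.biInter_finset_mem B).2 fun b _ => h b (ε b))
    (hB.trans hVU)

theorem disjoint_nhds_vertex_edgePt (b : {b : Set α // M.IsCocircuit b}) (v : Vert M)
    (r : Ioo (0 : ℝ) 1) (he : (e : α) ∈ b.1) :
    Disjoint (nhds (X := Γ.toGraphLikeSpace.Point) (vertex v))
      (nhds (X := Γ.toGraphLikeSpace.Point) (edgePt r e)) := by
  obtain ⟨δ, hδ0, hδ⟩ := exists_between (lt_min r.2.1 (sub_pos.2 r.2.2))
  obtain ⟨hδr, hδr'⟩ := lt_min_iff.1 hδ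
  have hW : IsOpen {t : Ioo (0 : ℝ) 1 | δ < (t : ℝ) ∧ (t : ℝ) < 1 - δ} :=
    (isOpen_lt continuous_const continuous_subtype_val).inter
      (isOpen_lt continuous_subtype_val continuous_const)
  refine Filter.disjoint_of_disjoint_of_mem ?_
    ((isOpen_nbhd b (v b) fun _ => ⟨δ, hδ0, hδr.trans r.2.2⟩).mem_nhds rfl)
    ((Γ.toGraphLikeSpace.isOpenMap_inner e _ hW).mem_nhds
      ⟨r, ⟨hδr, lt_sub_comm.1 hδr'⟩, rfl⟩)
  rw [disjoint_right]
  rintro _ ⟨t, ⟨ht0, ht1⟩, rfl⟩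
  exact edgePt_notMem_nbhd he ht0.le ht1.le

theorem t2Space (hE : ∀ e : M.E, ∃ b, M.IsCocircuit b ∧ (e : α) ∈ b) :
    T2Space Γ.toGraphLikeSpace.Point := by
  refine t2Space_of_disjoint_nhds fun v r e => ?_
  obtain ⟨b, hb, heb⟩ := hE e
  exact disjoint_nhds_vertex_edgePt ⟨b, hb⟩ v r heb

theorem subset_side_of_isPreconnected {Z : Set Γ.toGraphLikeSpace.Point} (hZ : IsPreconnected Z)
    (hb : Disjoint Z (Γ.inner b.1)) (hv : vertex v ∈ Z) : Z ⊆ Γ.side b (v b) :=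
  hZ.subset_left_of_subset_union (isOpen_side b _) (isOpen_side b _) (disjoint_side b _)
    (fun _ hp => compl_inner_subset b (v b) (disjoint_left.1 hb hp)) ⟨_, hv, rfl⟩

theorem apply_eq_of_joinedByContinuumIn {H : Set Γ.toGraphLikeSpace.Point}
    (h : JoinedByContinuumIn H v w) (hb : Disjoint H (Γ.inner b.1)) : v b = w b := by
  obtain ⟨P, hPH, hP, hv, hw⟩ := h
  exact (subset_side_of_isPreconnected hP.isPreconnected (hb.mono_left hPH) hv hw).symm

/-! ### Compactness in `G(M, Γ)` -/

theorem finite_edgeSet_inter_edgesOf {P : Set Γ.toGraphLikeSpace.Point} (hP : IsContinuum P)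
    (b : {b : Set α // M.IsCocircuit b}) : (Γ.edgeSet b.1 ∩ edgesOf P).Finite := by
  let cover : Option Γ.toGraphLikeSpace.E → Set Γ.toGraphLikeSpace.Point := fun o =>
    o.elim (Γ.side b 1 ∪ Γ.side b (-1)) fun e => Γ.toGraphLikeSpace.innerPoints {e}
  have hopen : ∀ o, IsOpen (cover o) := by
    rintro (_ | e)
    exacts [(isOpen_side b _).union (isOpen_side b _), isOpen_innerPoints {e}]
  have hcover : P ⊆ ⋃ o, cover o := by
    rintro (v | ⟨r, e⟩) -
    · exact mem_iUnion.2 ⟨none, compl_inner_subset b 1 (vertex_notMem_inner (s := b.1))⟩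
    · exact mem_iUnion.2 ⟨some e, edgePt_mem_innerPoints.2 rfl⟩
  obtain ⟨t, ht⟩ := hP.isCompact.elim_finite_subcover cover hopen hcover
  refine (t.finite_toSet.preimage (Option.some_injective _).injOn).subset ?_
  rintro e ⟨he, heP⟩
  obtain ⟨o, ho, hpo⟩ := mem_iUnion₂.1
    (ht (hP.saturated.mem heP ⟨1 / 2, by norm_num, by norm_num⟩))
  rcases o with _ | f
  · exact (hpo.elim (midpoint_notMem_side he) (midpoint_notMem_side he)).elim
  · exact edgePt_mem_innerPoints.1 hpo ▸ ho

theorem exists_vertex_le_nhds {f : Ultrafilter Γ.toGraphLikeSpace.Point}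
    (hf : ∀ b : {b : Set α // M.IsCocircuit b}, (Γ.inner b.1)ᶜ ∈ f) :
    ∃ v : Vert M, (f : Filter Γ.toGraphLikeSpace.Point) ≤
      nhds (X := Γ.toGraphLikeSpace.Point) (vertex v) := by
  have hside : ∀ b, ∃ i, Γ.side b i ∈ f := fun b =>
    (Ultrafilter.union_mem_iff.1 (Filter.mem_of_superset (hf b) (compl_inner_subset b 1))).elim
      (fun h => ⟨1, h⟩) fun h => ⟨-1, h⟩
  choose v hv using hside
  refine ⟨v, le_nhds_vertex fun b ε => ?_⟩
  exact Filter.mem_of_superset (Filter.inter_mem (hv b) (hf b))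
    (side_sdiff_inner_subset_nbhd b (v b) ε)

theorem isCompact_of_finite_edgeSet_inter {P : Set Γ.toGraphLikeSpace.Point} (hP : IsClosed P)
    (hs : Saturated P)
    (hfin : ∀ b : {b : Set α // M.IsCocircuit b}, (Γ.edgeSet b.1 ∩ edgesOf P).Finite) :
    IsCompact P := by
  refine isCompact_iff_ultrafilter_le_nhds.2 fun f hf => ?_
  have hfP : P ∈ f := Filter.le_principal_iff.1 hf
  by_cases hedge : ∃ e ∈ edgesOf P, Γ.toGraphLikeSpace.closedEdge e ∈ f
  · obtain ⟨e, he, hef⟩ := hedge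
    obtain ⟨x, hx, hfx⟩ := isCompact_iff_ultrafilter_le_nhds.1 (isCompact_closedEdge e) f
      (Filter.le_principal_iff.2 hef)
    exact ⟨x, hs.closedEdge_subset hP he hx, hfx⟩
  · push Not at hedge
    have houtside : ∀ b : {b : Set α // M.IsCocircuit b}, (Γ.inner b.1)ᶜ ∈ f := by
      intro b
      have hmiss : (⋃ e ∈ Γ.edgeSet b.1 ∩ edgesOf P, Γ.toGraphLikeSpace.closedEdge e) ∉ f := by
        rw [Ultrafilter.finite_biUnion_mem_iff (hfin b)]
        exact fun ⟨e, he, hef⟩ => hedge e he.2 hef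
      refine Filter.mem_of_superset
        (Filter.inter_mem hfP (Ultrafilter.compl_mem_iff_notMem.2 hmiss)) ?_
      rintro p ⟨hp, hpmiss⟩ ⟨r, e, he, rfl⟩
      exact hpmiss (mem_iUnion₂.2 ⟨e, ⟨he, r, hp⟩, edgePt_mem_closedEdge.2 rfl⟩)
    obtain ⟨v, hv⟩ := exists_vertex_le_nhds houtside
    exact ⟨vertex v, isClosed_iff_ultrafilter.1 hP _ f hv hfP, hv⟩

end Matroid.GraphFramework

namespace IsCyclicOrderOn

/-! ### Cyclic orders -/

variable {α : Type u} {X s s' : Set α} {R : α → α → α → Prop} {a b c p q r : α}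

theorem ne (hR : IsCyclicOrderOn X R) (h : R a b c) : a ≠ b ∧ b ≠ c ∧ a ≠ c := by
  have irrefl : ∀ x y, ¬ R x x y := fun x y hxy =>
    hR.asymm _ _ _ hxy (hR.cyclic _ _ _ (hR.cyclic _ _ _ hxy))
  refine ⟨?_, ?_, ?_⟩ <;> rintro rfl
  · exact irrefl _ _ h
  · exact irrefl _ _ (hR.cyclic _ _ _ h)
  · exact irrefl _ _ (hR.cyclic _ _ _ (hR.cyclic _ _ _ h))

theorem isStrictOrder (hR : IsCyclicOrderOn X R) (p : α) : IsStrictOrder α (R p) where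
  irrefl _ h := (hR.ne h).2.1 rfl
  trans _ _ _ hab hbc := hR.trans _ _ _ _ hab hbc

theorem exists_clockwiseAdjacent (hR : IsCyclicOrderOn X R) (hfin : s.Finite) (hX : s ⊆ X)
    (hp : p ∈ s) (hq : q ∈ s) (hpq : p ≠ q) :
    ∃ r, ClockwiseAdjacent R s r q ∧ (r = p ∨ R p r q) := by
  have := hR.isStrictOrder q
  have hwf : (s \ {q}).WellFoundedOn (Function.swap (R q)) := hfin.sdiff.wellFoundedOn
  obtain ⟨⟨r, hrs, hrq⟩, -, hmax⟩ :=
    WellFounded.has_min hwf univ ⟨⟨p, hp, hpq⟩, mem_univ _⟩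
  have last : ∀ g ∈ s, g ≠ r → g ≠ q → R g r q := fun g hg hgr hgq =>
    (hR.total q (hX hq) r (hX hrs) g (hX hg) (Ne.symm hrq) hgr.symm hgq.symm).resolve_left
      (hmax ⟨g, hg, hgq⟩ (mem_univ _))
  refine ⟨r, ⟨hrs, hq, hrq, fun g hg hgr hgq => hR.cyclic _ _ _ (last g hg hgr hgq)⟩, ?_⟩
  exact (eq_or_ne p r).imp Eq.symm fun h => last p hp h hpq

theorem notMem_of_clockwiseAdjacent (hR : IsCyclicOrderOn X R) (hpq : ClockwiseAdjacent R s p q)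
    (hr : R p r q) : r ∉ s := fun hrs =>
  hR.asymm _ _ _ hr (hR.cyclic _ _ _ (hpq.2.2.2 r hrs (hR.ne hr).1.symm (hR.ne hr).2.1))

theorem clockwise_induction (hR : IsCyclicOrderOn X R) (hss : s ⊆ s') (hfin : s'.Finite)
    (hX : s' ⊆ X) (hpq : ClockwiseAdjacent R s p q) {C D : α → Prop} (hp : D p)
    (hstep : ∀ r r', ClockwiseAdjacent R s' r r' → D r → C r')
    (hcross : ∀ r ∈ s', r ∉ s → C r → D r) : C q := by
  have := hR.isStrictOrder p
  have claim : q = q ∨ R p q q → C q :=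
    (hfin.wellFoundedOn (r := R p)).induction (P := fun r => r = q ∨ R p r q → C r)
      (hss hpq.2.1) fun r hr ih hrq => by
        have hpr : p ≠ r := hrq.elim (fun h => h ▸ hpq.2.2.1) fun h => (hR.ne h).1
        obtain ⟨r', hadj, rfl | hr'⟩ := hR.exists_clockwiseAdjacent hfin hX (hss hpq.1) hr hpr
        · exact hstep _ _ hadj hp
        have hr'q : R p r' q := hrq.elim (fun h => h ▸ hr') fun h => hR.trans _ _ _ _ hr' h
        exact hstep _ _ hadj <| hcross r' hadj.1 (hR.notMem_of_clockwiseAdjacent hpq hr'q) <|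
          ih r' hadj.1 hr' (Or.inr hr'q)
  exact claim (Or.inl rfl)

end IsCyclicOrderOn

theorem ClockwiseAdjacent.pair {α : Type u} {R : α → α → α → Prop} {p q : α} (hpq : p ≠ q) :
    ClockwiseAdjacent R {p, q} p q :=
  ⟨Or.inl rfl, Or.inr rfl, hpq, fun _ hg hgp hgq => (hg.elim hgp hgq).elim⟩

namespace GraphLikeSpace

open GraphLikePoint

variable {G : GraphLikeSpace.{u}} {F : Set G.E} {e : G.E} {r : Ioo (0 : ℝ) 1}

/-! ### Standard subspaces of circuits -/

theorem edgePt_mem_closure_innerPoints :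
    (edgePt r e : G.Point) ∈ closure (G.innerPoints F) ↔ e ∈ F := by
  refine ⟨fun h => ?_, fun h => subset_closure (edgePt_mem_innerPoints.2 h)⟩
  obtain ⟨_, ⟨s, f, rfl, rfl⟩, hF⟩ := mem_closure_iff.1 h (G.innerPoints {e}) (isOpen_innerPoints _)
    (edgePt_mem_innerPoints.2 rfl)
  exact edgePt_mem_innerPoints.1 hF

theorem saturated_closure_innerPoints (F : Set G.E) : Saturated (closure (G.innerPoints F)) :=
  fun _ _ _ h => edgePt_mem_closure_innerPoints.2 (edgePt_mem_closure_innerPoints.1 h)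

theorem edgesOf_closure_innerPoints (F : Set G.E) : edgesOf (closure (G.innerPoints F)) = F := by
  ext e
  exact ⟨fun ⟨_, hr⟩ => edgePt_mem_closure_innerPoints.1 hr,
    fun h => ⟨⟨1 / 2, by norm_num, by norm_num⟩, edgePt_mem_closure_innerPoints.2 h⟩⟩

end GraphLikeSpace

namespace Matroid.GraphFramework

open GraphLikePoint GraphLikeSpace

variable {α : Type u} {M : Matroid α} {Γ : M.GraphFramework} {o s : Set α} {e p q : α}
  {b : {b : Set α // M.IsCocircuit b}} {v w : Vert M}

theorem apply_ne_of_isLink {e : M.E} (h : Γ.toGraphLikeSpace.IsLink e v w) (he : (e : α) ∈ b.1) :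
    v b ≠ w b := by
  obtain ⟨rfl, rfl⟩ | ⟨rfl, rfl⟩ := h <;> simp only [toGraphLikeSpace, srcV, tgtV, he, if_true]
  exacts [neg_units_ne_self _, units_ne_neg_self _]

theorem apply_eq_of_isLink {e : M.E} (h : Γ.toGraphLikeSpace.IsLink e v w) (he : (e : α) ∉ b.1) :
    v b = w b := by
  obtain ⟨rfl, rfl⟩ | ⟨rfl, rfl⟩ := h <;> simp only [toGraphLikeSpace, srcV, tgtV, he, if_false]

open scoped Classical in
/-- The endvertex at which the edge `e` of the circuit `o` ends when `o` is traversed clockwise. -/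
noncomputable def headV (Γ : M.GraphFramework) (o : Set α) (e : α) : Vert M :=
  fun b => if e ∈ b.1 then Γ.c o e * Γ.d b.1 e else Γ.σ b.1 e

open scoped Classical in
/-- The endvertex at which the edge `e` of the circuit `o` starts when `o` is traversed
clockwise. -/
noncomputable def tailV (Γ : M.GraphFramework) (o : Set α) (e : α) : Vert M :=
  fun b => if e ∈ b.1 then -(Γ.c o e * Γ.d b.1 e) else Γ.σ b.1 e

theorem isLink_headV_tailV (o : Set α) (e : M.E) :
    Γ.toGraphLikeSpace.IsLink e (Γ.headV o e) (Γ.tailV o e) := by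
  rcases Int.units_eq_one_or (Γ.c o e) with h | h
  · right
    constructor <;> funext b <;> simp [headV, tailV, toGraphLikeSpace, srcV, tgtV, h]
  · left
    constructor <;> funext b <;> simp [headV, tailV, toGraphLikeSpace, srcV, tgtV, h]

theorem headV_eq_tailV (ho : M.IsCircuit o) (hfin : s.Finite) (hso : s ⊆ o)
    (hpq : ClockwiseAdjacent (Γ.toSigning.cyc Γ.σ o) s p q) (hb : b.1 ∩ o ⊆ s) :
    Γ.headV o p b = Γ.tailV o q b := by
  unfold headV tailV
  split_ifs with h1 h2 h2
  · exact Γ.adjacent_mem_mem o b.1 s p q ho b.2 hfin hb hso hpq h1 h2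
  · exact Γ.adjacent_mem_not o b.1 s p q ho b.2 hfin hb hso hpq h1 h2
  · rw [Γ.adjacent_not_mem o b.1 s p q ho b.2 hfin hb hso hpq h1 h2, neg_neg]
  · exact Γ.adjacent_not_not o b.1 s p q ho b.2 hfin hb hso hpq h1 h2

theorem headV_ne_headV (ho : M.IsCircuit o) (hpq : p ≠ q) (hbo : b.1 ∩ o = {p, q}) :
    Γ.headV o p b ≠ Γ.headV o q b := by
  classical
  have hset : (Γ.tame o b.1 ho b.2).toFinset = {p, q} := by
    rw [← Finset.coe_inj, Finite.coe_toFinset, inter_comm, hbo, Finset.coe_pair]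
  have hsum := Γ.sum_eq_zero o b.1 ho b.2
  rw [hset, Finset.sum_pair hpq] at hsum
  have hp : p ∈ b.1 := (hbo.superset (Or.inl rfl)).1
  have hq : q ∈ b.1 := (hbo.superset (Or.inr rfl)).1
  simp only [headV, hp, hq, if_true]
  intro heq
  have heq' : (Γ.c o p : ℤ) * Γ.d b.1 p = (Γ.c o q : ℤ) * Γ.d b.1 q := by
    exact_mod_cast congrArg Units.val heq
  have hne : ((Γ.c o q * Γ.d b.1 q : ℤˣ) : ℤ) ≠ 0 := Units.ne_zero _
  rw [Units.val_mul] at hne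
  omega

/-- The closure in `G(M, Γ)` of the interior points of the edges in `o`. -/
def circ (Γ : M.GraphFramework) (o : Set α) : Set Γ.toGraphLikeSpace.Point :=
  _root_.closure (Γ.inner o)

theorem saturated_circ (o : Set α) : Saturated (Γ.circ o) :=
  saturated_closure_innerPoints _

theorem edgesOf_circ (o : Set α) : edgesOf (Γ.circ o) = Γ.edgeSet o :=
  edgesOf_closure_innerPoints _

theorem edgePt_mem_circ {e : M.E} {r : Ioo (0 : ℝ) 1} :
    (edgePt r e : Γ.toGraphLikeSpace.Point) ∈ Γ.circ o ↔ (e : α) ∈ o :=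
  edgePt_mem_closure_innerPoints

theorem closedEdge_subset_circ {e : M.E} (he : (e : α) ∈ o) :
    Γ.toGraphLikeSpace.closedEdge e ⊆ Γ.circ o :=
  (saturated_circ o).closedEdge_subset isClosed_closure ((edgesOf_circ o).symm ▸ he)

theorem closedEdge_subset_circ_sdiff {e : M.E} (he : (e : α) ∈ o) (hes : (e : α) ∉ s) :
    Γ.toGraphLikeSpace.closedEdge e ⊆ Γ.circ o \ Γ.inner s := by
  refine subset_sdiff.2 ⟨closedEdge_subset_circ he, disjoint_right.2 ?_⟩
  rintro _ ⟨r, f, hf, rfl⟩ hfe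
  exact hes (edgePt_mem_closedEdge.1 hfe ▸ hf)

theorem vertex_headV_mem_circ (ho : o ⊆ M.E) (he : e ∈ o) :
    vertex (Γ.headV o e) ∈ Γ.circ o :=
  closedEdge_subset_circ (e := ⟨e, ho he⟩) he (isLink_headV_tailV o ⟨e, ho he⟩).left_mem_closedEdge

theorem vertex_tailV_mem_circ (ho : o ⊆ M.E) (he : e ∈ o) :
    vertex (Γ.tailV o e) ∈ Γ.circ o :=
  closedEdge_subset_circ (e := ⟨e, ho he⟩) he
    (isLink_headV_tailV o ⟨e, ho he⟩).symm.left_mem_closedEdge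

theorem circ_sdiff_inner_inter (s : Set α) :
    Γ.circ o \ Γ.inner (s ∩ o) = Γ.circ o \ Γ.inner s := by
  ext p
  refine and_congr_right fun hp => not_congr ?_
  rcases p with v | ⟨r, (e : M.E)⟩
  · exact iff_of_false vertex_notMem_inner vertex_notMem_inner
  · rw [edgePt_mem_inner, edgePt_mem_inner]
    exact and_iff_left (edgePt_mem_circ.1 hp)

theorem disjoint_circ_sdiff {b : Set α} (h : b ∩ o ⊆ s) :
    Disjoint (Γ.circ o \ Γ.inner s) (Γ.inner b) := by
  rw [disjoint_right]
  rintro _ ⟨r, (e : M.E), he, rfl⟩ ⟨h1, h2⟩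
  exact h2 (edgePt_mem_inner.2 (h ⟨he, edgePt_mem_circ.1 h1⟩))

theorem finite_cocircuit_inter (Γ : M.GraphFramework) (ho : M.IsCircuit o)
    (b : {b : Set α // M.IsCocircuit b}) : (b.1 ∩ o).Finite :=
  inter_comm o b.1 ▸ Γ.tame o b.1 ho b.2

theorem isCompact_circ (ho : M.IsCircuit o) : IsCompact (Γ.circ o) := by
  refine isCompact_of_finite_edgeSet_inter isClosed_closure (saturated_circ o) fun b => ?_
  rw [edgesOf_circ]
  exact finite_edgeSet (Γ.finite_cocircuit_inter ho b)

theorem exists_finite_forall_apply_eq_imp_mem {K A B : Set Γ.toGraphLikeSpace.Point}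
    (hK : IsCompact K) (hA : IsClosed A) (hB : IsClosed B) (hAB : Disjoint A B) (hU : K ⊆ A ∪ B) :
    ∃ 𝓑 : Set {b : Set α // M.IsCocircuit b}, 𝓑.Finite ∧ ∀ v w : Vert M, vertex v ∈ K →
      vertex w ∈ K → (∀ b ∈ 𝓑, v b = w b) → vertex v ∈ A → vertex w ∈ A := by
  have hN : ∀ x : Vert M, ∃ (F : Finset {b : Set α // M.IsCocircuit b})
      (ε : {b : Set α // M.IsCocircuit b} → M.E → Ioo (0 : ℝ) 1),
      (⋂ b ∈ F, Γ.nbhd b (x b) (ε b)) ⊆ Aᶜ ∨ (⋂ b ∈ F, Γ.nbhd b (x b) (ε b)) ⊆ Bᶜ := by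
    intro x
    by_cases hx : vertex x ∈ A
    · obtain ⟨F, ε, h⟩ := exists_biInter_nbhd_subset hB.isOpen_compl (v := x)
        (disjoint_left.1 hAB hx)
      exact ⟨F, ε, Or.inr h⟩
    · obtain ⟨F, ε, h⟩ := exists_biInter_nbhd_subset hA.isOpen_compl (v := x) hx
      exact ⟨F, ε, Or.inl h⟩
  choose F ε hF using hN
  obtain ⟨t, ht⟩ := (hK.diff (isOpen_innerPoints univ)).elim_finite_subcover
    (fun x : Vert M => ⋂ b ∈ F x, Γ.nbhd b (x b) (ε x b))
    (fun x => isOpen_biInter_finset fun b _ => isOpen_nbhd b _ _)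
    (by
      rintro (v | ⟨r, e⟩) hp
      · exact mem_iUnion.2 ⟨v, mem_iInter₂.2 fun b _ => rfl⟩
      · exact absurd ((edgePt_mem_innerPoints (F := univ)).2 trivial) hp.2)
  refine ⟨⋃ x ∈ t, F x, t.finite_toSet.biUnion fun x _ => (F x).finite_toSet, ?_⟩
  intro v w hv hw hvw hvA
  obtain ⟨x, hx, hvx⟩ := mem_iUnion₂.1 (ht ⟨hv, vertex_notMem_innerPoints⟩)
  have hwx : vertex w ∈ ⋂ b ∈ F x, Γ.nbhd b (x b) (ε x b) := mem_iInter₂.2 fun b hb =>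
    (hvw b (mem_iUnion₂.2 ⟨x, hx, hb⟩)).symm.trans (mem_iInter₂.1 hvx b hb)
  rcases hF x with h | h
  · exact absurd hvA (h hvx)
  · exact (hU hw).resolve_right (h hwx)

/-- Walk clockwise from `p` to `q` through the finitely many edges of `o` that lie in one of the
cocircuits deciding between `A` and `B`. -/
theorem tailV_mem_of_headV_mem (ho : M.IsCircuit o) (hfin : s.Finite) (hso : s ⊆ o)
    (hpq : ClockwiseAdjacent (Γ.toSigning.cyc Γ.σ o) s p q)
    {A B : Set Γ.toGraphLikeSpace.Point} (hA : IsClosed A) (hB : IsClosed B) (hAB : Disjoint A B)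
    (hU : Γ.circ o \ Γ.inner s ⊆ A ∪ B) (hp : vertex (Γ.headV o p) ∈ A) :
    vertex (Γ.tailV o q) ∈ A := by
  have hE := ho.subset_ground
  obtain ⟨𝓑, h𝓑, hdet⟩ := exists_finite_forall_apply_eq_imp_mem
    ((isCompact_circ ho).diff (isOpen_inner s)) hA hB hAB hU
  have hs'fin : (s ∪ ⋃ b ∈ 𝓑, b.1 ∩ o).Finite :=
    hfin.union (h𝓑.biUnion fun b _ => Γ.finite_cocircuit_inter ho b)
  have hs'o : s ∪ ⋃ b ∈ 𝓑, b.1 ∩ o ⊆ o :=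
    union_subset hso (iUnion₂_subset fun b _ => inter_subset_right)
  refine (Γ.isCyclicOrder o ho).clockwise_induction
    (C := fun r => vertex (Γ.tailV o r) ∈ A) (D := fun r => vertex (Γ.headV o r) ∈ A)
    (subset_union_left (t := ⋃ b ∈ 𝓑, b.1 ∩ o)) hs'fin hs'o hpq hp ?_ ?_
  · intro r r' hrr' hr
    refine hdet _ _ ⟨vertex_headV_mem_circ hE (hs'o hrr'.1), vertex_notMem_inner⟩
      ⟨vertex_tailV_mem_circ hE (hs'o hrr'.2.1), vertex_notMem_inner⟩ (fun b hb => ?_) hr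
    exact headV_eq_tailV ho hs'fin hs'o hrr'
      (subset_union_of_subset_right (subset_biUnion_of_mem (u := fun b => b.1 ∩ o) hb) _)
  · intro r hr hrs hrA
    have hlink := isLink_headV_tailV (Γ := Γ) o ⟨r, hE (hs'o hr)⟩
    exact subset_left_of_subset_union_of_isClosed hA hB hAB
      ((closedEdge_subset_circ_sdiff (hs'o hr) hrs).trans hU)
      ⟨_, hlink.symm.left_mem_closedEdge, hrA⟩ (isPreconnected_closedEdge _)
      hlink.left_mem_closedEdge

theorem inner_singleton (e : M.E) : Γ.inner {(e : α)} = Γ.toGraphLikeSpace.innerPoints {e} :=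
  congrArg Γ.toGraphLikeSpace.innerPoints (ext fun _ => Subtype.ext_iff.symm)

theorem inner_pair (e f : Γ.toGraphLikeSpace.E) :
    Γ.inner {(e : M.E).1, (f : M.E).1} = Γ.toGraphLikeSpace.innerPoints {e, f} :=
  congrArg Γ.toGraphLikeSpace.innerPoints
    (ext fun _ => (or_congr Subtype.ext_iff Subtype.ext_iff).symm)

theorem inner_mono {s' : Set α} (h : s ⊆ s') : Γ.inner s ⊆ Γ.inner s' := fun _ ⟨r, e, he, hp⟩ =>
  ⟨r, e, h he, hp⟩

theorem isCompact_circ_sdiff (ho : M.IsCircuit o) (s : Set α) :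
    IsCompact (Γ.circ o \ Γ.inner s) :=
  (isCompact_circ ho).diff (isOpen_inner s)

theorem saturated_circ_sdiff (o s : Set α) : Saturated (Γ.circ o \ Γ.inner s) :=
  (saturated_circ o).sdiff_innerPoints _

theorem exists_ne_mem_cocircuit_inter (ho : M.IsCircuit o) (hp : p ∈ b.1 ∩ o) :
    ∃ q ∈ b.1 ∩ o, q ≠ p := by
  by_contra! h
  refine ho.inter_isCocircuit_ne_singleton b.2 (e := p) (Subset.antisymm ?_ ?_)
  · exact fun q hq => h q ⟨hq.2, hq.1⟩
  · exact singleton_subset_iff.2 ⟨hp.2, hp.1⟩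

section T2

variable [T2Space Γ.toGraphLikeSpace.Point]

theorem joinedByContinuumIn_headV_tailV (ho : M.IsCircuit o) (hfin : s.Finite) (hso : s ⊆ o)
    (hpq : ClockwiseAdjacent (Γ.toSigning.cyc Γ.σ o) s p q) :
    JoinedByContinuumIn (Γ.circ o \ Γ.inner s) (Γ.headV o p) (Γ.tailV o q) := by
  refine (joinedByContinuumIn_iff (isCompact_circ_sdiff ho s) (saturated_circ_sdiff o s)).2 ?_
  by_contra hq
  have hp : vertex (Γ.headV o p) ∈ Γ.circ o \ Γ.inner s :=
    ⟨vertex_headV_mem_circ ho.subset_ground (hso hpq.1), vertex_notMem_inner⟩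
  obtain ⟨A, B, hA, hB, hAB, hU, hpA, hqA⟩ :=
    exists_isClosed_partition_of_notMem_connectedComponentIn (isCompact_circ_sdiff ho s) hp
      (finite_singleton _) (by rintro y rfl; exact hq)
  exact disjoint_singleton_left.1 hqA
    (tailV_mem_of_headV_mem ho hfin hso hpq hA hB hAB hU.superset hpA)

theorem joinedByContinuumIn_headV_tailV_pair (ho : M.IsCircuit o) (hp : p ∈ o) (hq : q ∈ o)
    (hpq : p ≠ q) :
    JoinedByContinuumIn (Γ.circ o \ Γ.inner {p, q}) (Γ.headV o p) (Γ.tailV o q) :=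
  joinedByContinuumIn_headV_tailV ho (toFinite _) (pair_subset hp hq) (.pair hpq)

theorem joinedByContinuumIn_headV_tailV_self (ho : M.IsCircuit o) {e : M.E} (he : (e : α) ∈ o) :
    JoinedByContinuumIn (Γ.circ o \ Γ.inner {(e : α)}) (Γ.headV o e) (Γ.tailV o e) := by
  by_cases hf : ∃ f ∈ o, f ≠ e
  · obtain ⟨f, hfo, hfe⟩ := hf
    have hef := joinedByContinuumIn_headV_tailV_pair (Γ := Γ) ho he hfo hfe.symm
    have hfe' := joinedByContinuumIn_headV_tailV_pair (Γ := Γ) ho hfo he hfe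
    have hff := (isLink_headV_tailV (Γ := Γ) o ⟨f, ho.subset_ground hfo⟩).symm.joinedByContinuumIn
      (closedEdge_subset_circ_sdiff (s := {(e : α)}) hfo hfe)
    refine (hef.mono ?_).trans (hff.trans (hfe'.mono ?_)) <;>
      refine sdiff_subset_sdiff_right (inner_mono (singleton_subset_iff.2 ?_))
    exacts [Or.inl rfl, Or.inr rfl]
  · push Not at hf
    have heq : Γ.headV o e = Γ.tailV o e := funext fun b =>
      apply_eq_of_isLink (isLink_headV_tailV o e) fun heb => by
        obtain ⟨f, hf', hfe⟩ := exists_ne_mem_cocircuit_inter ho ⟨heb, he⟩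
        exact hfe (hf f hf'.2)
    exact heq ▸ .refl ⟨vertex_headV_mem_circ ho.subset_ground he, vertex_notMem_inner⟩

theorem isContinuum_circ_sdiff (ho : M.IsCircuit o) {e : M.E} (he : (e : α) ∈ o) :
    IsContinuum (Γ.circ o \ Γ.inner {(e : α)}) := by
  set R := Γ.circ o \ Γ.inner {(e : α)}
  have hR : IsCompact R := isCompact_circ_sdiff ho _
  have hRs : Saturated R := saturated_circ_sdiff o _
  set C : Set Γ.toGraphLikeSpace.Point := connectedComponentIn R (vertex (Γ.headV o e))
  have hCR : C ⊆ R := connectedComponentIn_subset _ _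
  have hheadR : vertex (Γ.headV o e) ∈ R :=
    ⟨vertex_headV_mem_circ ho.subset_ground he, vertex_notMem_inner⟩
  have hhead : vertex (Γ.headV o e) ∈ C := mem_connectedComponentIn (F := R) hheadR
  have htail : vertex (Γ.tailV o e) ∈ C :=
    (joinedByContinuumIn_iff hR hRs).1 (joinedByContinuumIn_headV_tailV_self ho he)
  have hedge : ∀ f : M.E, (f : α) ∈ o → f ≠ e → Γ.toGraphLikeSpace.closedEdge f ⊆ C := by
    intro f hf hfe
    have hfe' : (f : α) ∉ ({(e : α)} : Set α) := fun h => hfe (Subtype.ext h)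
    have hC : vertex (Γ.tailV o f) ∈ C := (joinedByContinuumIn_iff hR hRs).1
      ((joinedByContinuumIn_headV_tailV_pair ho he hf (Ne.symm hfe')).mono
        (sdiff_subset_sdiff_right (inner_mono (singleton_subset_iff.2 (Or.inl rfl)))))
    rw [show C = _ from connectedComponentIn_eq hC]
    exact (isPreconnected_closedEdge f).subset_connectedComponentIn
      (isLink_headV_tailV o f).symm.left_mem_closedEdge
      (closedEdge_subset_circ_sdiff (s := {(e : α)}) hf hfe')
  have hcirc : Γ.circ o ⊆ C ∪ Γ.toGraphLikeSpace.closedEdge e := by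
    refine closure_minimal ?_ ((isCompact_connectedComponentIn hR _).isClosed.union
      (isClosed_closedEdge (G := Γ.toGraphLikeSpace) e))
    rintro _ ⟨r, (f : M.E), hf, rfl⟩
    by_cases hfe : f = e
    · exact Or.inr (edgePt_mem_closedEdge.2 hfe)
    · exact Or.inl (hedge f hf hfe (edgePt_mem_closedEdge.2 rfl))
  have hRC : R ⊆ C := by
    rintro x ⟨hx, hxe⟩
    refine (hcirc hx).elim id fun hxe' => ?_
    obtain rfl | rfl | ⟨r, rfl⟩ := (isLink_headV_tailV o e).mem_closedEdge_iff.1 hxe'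
    exacts [hhead, htail, (hxe (edgePt_mem_inner.2 rfl)).elim]
  exact hRC.antisymm hCR ▸ isContinuum_connectedComponentIn hR hRs _

theorem isContinuum_circ (ho : M.IsCircuit o) : IsContinuum (Γ.circ o) := by
  obtain ⟨e, he⟩ := ho.nonempty
  lift e to M.E using ho.subset_ground he
  have hunion : Γ.circ o = Γ.circ o \ Γ.inner {(e : α)} ∪ Γ.toGraphLikeSpace.closedEdge e := by
    refine Subset.antisymm (fun p hp => or_iff_not_imp_left.2 fun hpe => ?_)
      (union_subset sdiff_subset (closedEdge_subset_circ he))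
    obtain ⟨r, f, hf, rfl⟩ := not_not.1 fun h => hpe ⟨hp, h⟩
    exact edgePt_mem_closedEdge.2 (Subtype.ext hf)
  rw [hunion]
  exact (isContinuum_circ_sdiff ho he).union (isContinuum_closedEdge _)
    ⟨vertex_headV_mem_circ ho.subset_ground he, vertex_notMem_inner⟩
    (isLink_headV_tailV o e).left_mem_closedEdge

theorem exists_joinedByContinuumIn_headV (ho : M.IsCircuit o) (hne : (b.1 ∩ o).Nonempty)
    (hv : vertex v ∈ Γ.circ o) :
    ∃ p ∈ b.1 ∩ o, JoinedByContinuumIn (Γ.circ o \ Γ.inner b.1) v (Γ.headV o p) := by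
  have hjoin : ∀ {w : Vert M}, vertex w ∈ connectedComponentIn (Γ.circ o \ Γ.inner b.1)
      (vertex v) → JoinedByContinuumIn (Γ.circ o \ Γ.inner b.1) v w :=
    (joinedByContinuumIn_iff (isCompact_circ_sdiff ho _) (saturated_circ_sdiff o _)).2
  have hfin := Γ.finite_cocircuit_inter ho b
  have hinter : Γ.edgeSet b.1 ∩ edgesOf (Γ.circ o) = Γ.edgeSet (b.1 ∩ o) := by
    rw [edgesOf_circ]
    rfl
  obtain ⟨p₀, hp₀⟩ := hne
  obtain ⟨e, he, x, y, hxy, hx⟩ := (isContinuum_circ ho).exists_isLink_mem_connectedComponentIn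
    (hinter ▸ finite_edgeSet hfin) (hinter ▸ ⟨⟨p₀, ho.subset_ground hp₀.2⟩, hp₀⟩) hv
  rw [hinter] at he
  obtain rfl | rfl := hxy.eq_or_eq (isLink_headV_tailV o (e : M.E))
  · exact ⟨_, he, hjoin hx⟩
  · obtain ⟨q, hq, hqe⟩ := exists_ne_mem_cocircuit_inter (b := b) ho he
    obtain ⟨p, hpe, -⟩ := (Γ.isCyclicOrder o ho).exists_clockwiseAdjacent hfin inter_subset_right
      hq he hqe
    have hpe' := joinedByContinuumIn_headV_tailV (Γ := Γ) ho hfin inter_subset_right hpe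
    rw [circ_sdiff_inner_inter] at hpe'
    exact ⟨p, hpe.1, (hjoin hx).trans hpe'.symm⟩

/-- Without crossing `b`, the circuit joins `v` to an edge `p` of `b` and `w` to another such edge
`q`. -/
theorem exists_isCocircuit_inter_eq_pair_apply_ne (ho : M.IsCircuit o)
    (hv : vertex v ∈ Γ.circ o) (hw : vertex w ∈ Γ.circ o) (hvw : v ≠ w) :
    ∃ p ∈ o, ∃ q ∈ o, p ≠ q ∧
      ∃ b : {b : Set α // M.IsCocircuit b}, b.1 ∩ o = {p, q} ∧ v b ≠ w b := by
  obtain ⟨b, hb⟩ := Function.ne_iff.1 hvw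
  have hne : (b.1 ∩ o).Nonempty := by
    by_contra hemp
    have hjoin : JoinedByContinuumIn (Γ.circ o \ Γ.inner ∅) v w :=
      ⟨Γ.circ o, subset_sdiff.2 ⟨Subset.rfl, disjoint_right.2 fun _ ⟨_, _, he, _⟩ => he.elim⟩,
        isContinuum_circ ho, hv, hw⟩
    exact hb (apply_eq_of_joinedByContinuumIn hjoin
      (disjoint_circ_sdiff (not_nonempty_iff_eq_empty.1 hemp).subset))
  obtain ⟨p, hp, hvp⟩ := exists_joinedByContinuumIn_headV (Γ := Γ) ho hne hv
  obtain ⟨q, hq, hwq⟩ := exists_joinedByContinuumIn_headV (Γ := Γ) ho hne hw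
  have hpq : p ≠ q := by
    rintro rfl
    exact hb (apply_eq_of_joinedByContinuumIn (hvp.trans hwq.symm) disjoint_sdiff_left)
  obtain ⟨c, hc, hco⟩ := exists_isCocircuit_inter_eq_pair ho hp.2 hq.2 hpq
  have hdis : Disjoint (Γ.circ o \ Γ.inner b.1) (Γ.inner c) :=
    disjoint_circ_sdiff (hco.trans_subset (pair_subset hp.1 hq.1))
  refine ⟨p, hp.2, q, hq.2, hpq, ⟨c, hc⟩, hco, ?_⟩
  rw [apply_eq_of_joinedByContinuumIn (b := ⟨c, hc⟩) hvp hdis,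
    apply_eq_of_joinedByContinuumIn (b := ⟨c, hc⟩) hwq hdis]
  exact headV_ne_headV ho hpq hco

theorem isCircleSet_circ (ho : M.IsCircuit o) : IsCircleSet (Γ.circ o) where
  isContinuum := isContinuum_circ ho
  nonempty_edgesOf := by
    obtain ⟨e, he⟩ := ho.nonempty
    exact edgesOf_circ (Γ := Γ) o ▸ ⟨⟨e, ho.subset_ground he⟩, he⟩
  remove_one e he := by
    rw [edgesOf_circ] at he
    exact inner_singleton (Γ := Γ) e ▸ (isContinuum_circ_sdiff ho he).isPreconnected
  remove_two e he f hf hef hcon := by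
    rw [edgesOf_circ] at he hf
    have hcon' : IsPreconnected (Γ.circ o \ Γ.inner {(e : M.E).1, (f : M.E).1}) := by
      rwa [inner_pair]
    obtain ⟨b, hb, hbo⟩ := exists_isCocircuit_inter_eq_pair ho he hf fun h => hef (Subtype.ext h)
    have hlink := isLink_headV_tailV (Γ := Γ) o (e : M.E)
    refine apply_ne_of_isLink (b := ⟨b, hb⟩) hlink (hbo.superset (Or.inl rfl)).1 (Eq.symm ?_)
    exact subset_side_of_isPreconnected (b := ⟨b, hb⟩) hcon' (disjoint_circ_sdiff hbo.subset)
      ⟨closedEdge_subset_circ he hlink.left_mem_closedEdge, vertex_notMem_inner⟩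
      ⟨closedEdge_subset_circ he hlink.symm.left_mem_closedEdge, vertex_notMem_inner⟩

theorem isPseudoCircle_circ (ho : M.IsCircuit o) :
    (isContinuum_circ (Γ := Γ) ho).toGraphLikeSpace.IsPseudoCircle := by
  refine (isCircleSet_circ ho).isPseudoCircle fun v w hv hw hvw => ?_
  obtain ⟨p, hp, q, hq, hpq, b, hbo, hb⟩ :=
    exists_isCocircuit_inter_eq_pair_apply_ne ho hv hw hvw
  lift p to M.E using ho.subset_ground hp
  lift q to M.E using ho.subset_ground hq
  rw [edgesOf_circ]
  refine ⟨p, hp, q, hq, fun h => hpq (congrArg Subtype.val h), fun hw' => hb (Eq.symm ?_)⟩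
  rw [← inner_pair (Γ := Γ) p q] at hw'
  have hvR : vertex v ∈ Γ.circ o \ Γ.inner {(p : α), (q : α)} := ⟨hv, vertex_notMem_inner⟩
  exact subset_side_of_isPreconnected (b := b) isPreconnected_connectedComponentIn
    ((disjoint_circ_sdiff hbo.subset).mono_left (connectedComponentIn_subset _ _))
    (mem_connectedComponentIn (α := Γ.toGraphLikeSpace.Point) hvR) hw'

theorem mem_hatVertices_of_mem_circ (ho : M.IsCircuit o) (hv : vertex v ∈ Γ.circ o) :
    v ∈ Γ.toGraphLikeSpace.hatVertices :=
  have h := isContinuum_circ (Γ := Γ) ho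
  Or.inr ⟨_, h.incl, isPseudoCircle_circ ho, h.incl_injective, h.range_incl.superset hv⟩

end T2

end Matroid.GraphFramework

namespace GraphLikeSpace

open GraphLikePoint

/-- Each component of `P` minus `e` contains an end of `e`, so a connected set containing both ends
meets all of them. -/
theorem IsContinuum.isPreconnected_sdiff_of_isLink {G : GraphLikeSpace.{u}} [T2Space G.Point]
    {P K : Set G.Point} {e : G.E} {a b : G.V} (hP : IsContinuum P) (he : e ∈ edgesOf P)
    (hab : G.IsLink e a b) (hK : IsPreconnected K) (hKP : K ⊆ P \ G.innerPoints {e})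
    (ha : vertex a ∈ K) (hb : vertex b ∈ K) : IsPreconnected (P \ G.innerPoints {e}) := by
  set R := P \ G.innerPoints {e}
  have hKC : K ⊆ connectedComponentIn R (vertex a) := hK.subset_connectedComponentIn ha hKP
  have hvertex : ∀ v : G.V, vertex v ∈ R → vertex v ∈ connectedComponentIn R (vertex a) := by
    intro v hv
    obtain ⟨f, ⟨rfl, -⟩, c, d, hcd, hc⟩ := hP.exists_isLink_mem_connectedComponentIn
      ((finite_singleton e).inter_of_left _) ⟨e, rfl, he⟩ hv.1
    have hcK : vertex c ∈ K := by
      obtain rfl | rfl := hcd.eq_or_eq hab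
      exacts [ha, hb]
    rw [connectedComponentIn_eq (hKC hcK), ← connectedComponentIn_eq hc]
    exact mem_connectedComponentIn hv
  have hRs : Saturated R := hP.saturated.sdiff_innerPoints _
  have hR : R ⊆ connectedComponentIn R (vertex a) := by
    rintro (v | ⟨r, f⟩) hx
    · exact hvertex v hx
    · have hf : G.closedEdge f ⊆ R :=
        hRs.closedEdge_subset (hP.isCompact_sdiff _).isClosed ⟨r, hx⟩
      have hsrc := (isLink_src_tgt f).left_mem_closedEdge
      rw [connectedComponentIn_eq (hvertex _ (hf hsrc))]
      exact (isPreconnected_closedEdge f).subset_connectedComponentIn hsrc hf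
        (edgePt_mem_closedEdge.2 rfl)
  rw [← (connectedComponentIn_subset R _).antisymm hR]
  exact isPreconnected_connectedComponentIn

end GraphLikeSpace

namespace Matroid.GraphFramework

open GraphLikePoint GraphLikeSpace

variable {α : Type u} {M : Matroid α} {Γ : M.GraphFramework} {o : Set α} {v : Vert M}
  {P : Set Γ.toGraphLikeSpace.Point}

theorem circ_subset (hP : IsClosed P) (hs : Saturated P) (ho : Γ.edgeSet o ⊆ edgesOf P) :
    Γ.circ o ⊆ P :=
  closure_minimal (fun _ ⟨r, _, he, hp⟩ => hp ▸ hs.mem (ho he) r) hP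

section T2

variable [T2Space Γ.toGraphLikeSpace.Point]

theorem exists_isCircuit_edgeSet_subset_edgesOf (hP : IsContinuum P) {e : M.E}
    (he : e ∈ edgesOf P) (hPe : IsPreconnected (P \ Γ.toGraphLikeSpace.innerPoints {e})) :
    ∃ o, M.IsCircuit o ∧ (e : α) ∈ o ∧ Γ.edgeSet o ⊆ edgesOf P := by
  set Y : Set α := {a | ∃ f : M.E, f ∈ edgesOf P ∧ f ≠ e ∧ (f : α) = a}
  have mem_Y : ∀ f : M.E, (f : α) ∈ Y → f ∈ edgesOf P ∧ f ≠ e := by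
    rintro f ⟨g, hg, hge, hgf⟩
    exact Subtype.ext hgf ▸ ⟨hg, hge⟩
  obtain ⟨o, ho, heo, hoY⟩ | ⟨c, hc, hec, hcY⟩ :=
    exists_isCircuit_or_isCocircuit_of_notMem e.2 fun heY => (mem_Y e heY).2 rfl
  · refine ⟨o, ho, heo, fun (f : M.E) hf => ?_⟩
    obtain hfe | hfY := hoY hf
    exacts [Subtype.ext hfe ▸ he, (mem_Y f hfY).1]
  · have hdis : Disjoint (P \ Γ.toGraphLikeSpace.innerPoints {e}) (Γ.inner c) := by
      rw [disjoint_right]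
      rintro _ ⟨r, (f : M.E), hf, rfl⟩ ⟨hfP, hfe⟩
      exact disjoint_left.1 hcY hf ⟨f, ⟨r, hfP⟩, fun h => hfe (edgePt_mem_innerPoints.2 h), rfl⟩
    have hlink := isLink_src_tgt (G := Γ.toGraphLikeSpace) e
    refine (apply_ne_of_isLink (b := ⟨c, hc⟩) hlink hec (Eq.symm ?_)).elim
    exact subset_side_of_isPreconnected (b := ⟨c, hc⟩) hPe hdis
      ⟨hP.left_mem he hlink, vertex_notMem_innerPoints⟩
      ⟨hP.left_mem he hlink.symm, vertex_notMem_innerPoints⟩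

theorem exists_isCircuit_edgesOf_eq (hP : IsCircleSet P) :
    ∃ o, M.IsCircuit o ∧ edgesOf P = Γ.edgeSet o := by
  obtain ⟨e, r, hr⟩ := hP.nonempty_edgesOf
  have he : e ∈ edgesOf P := ⟨r, hr⟩
  obtain ⟨o, ho, heo, hoP⟩ :=
    exists_isCircuit_edgeSet_subset_edgesOf hP.isContinuum he (hP.remove_one e he)
  refine ⟨o, ho, Subset.antisymm (fun f hf => ?_) hoP⟩
  by_contra hfo
  have hef : e ≠ f := fun h => hfo (h ▸ heo)
  set Q := P \ Γ.toGraphLikeSpace.innerPoints {f}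
  have hQ : IsContinuum Q := ⟨hP.isContinuum.isCompact_sdiff _, hP.remove_one f hf,
    hP.isContinuum.saturated.sdiff_innerPoints _⟩
  have hoQ : Γ.circ o \ Γ.inner {(e : M.E).1} ⊆ Q \ Γ.toGraphLikeSpace.innerPoints {e} := by
    rintro x ⟨hx, hxe⟩
    refine ⟨⟨circ_subset hP.isContinuum.isClosed hP.isContinuum.saturated hoP hx, ?_⟩,
      inner_singleton (Γ := Γ) e ▸ hxe⟩
    rintro ⟨r, g, rfl, rfl⟩
    exact hfo (edgePt_mem_circ.1 hx)
  have hlink := isLink_headV_tailV (Γ := Γ) o (e : M.E)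
  refine hP.remove_two f hf e he hef.symm ?_
  rw [innerPoints_insert, ← sdiff_sdiff]
  have heQ : e ∈ edgesOf Q :=
    ⟨r, hr, fun h => hef (edgePt_mem_innerPoints (F := {f}).1 h)⟩
  exact hQ.isPreconnected_sdiff_of_isLink heQ hlink
    (isContinuum_circ_sdiff ho heo).isPreconnected hoQ
    ⟨closedEdge_subset_circ heo hlink.left_mem_closedEdge, vertex_notMem_inner⟩
    ⟨closedEdge_subset_circ heo hlink.symm.left_mem_closedEdge, vertex_notMem_inner⟩

theorem exists_joinedByContinuumIn_mem_circ (hP : IsContinuum P) (ho : M.IsCircuit o)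
    (hPo : edgesOf P = Γ.edgeSet o) (hv : vertex v ∈ P)
    (t : Finset {b : Set α // M.IsCocircuit b}) :
    ∃ a : Vert M, vertex a ∈ Γ.circ o ∧ JoinedByContinuumIn (P \ Γ.inner (⋃ b ∈ t, b.1)) v a := by
  set s : Set α := ⋃ b ∈ t, b.1
  have mem_circ : ∀ {e : M.E} {a b : Vert M}, e ∈ edgesOf P → Γ.toGraphLikeSpace.IsLink e a b →
      vertex a ∈ Γ.circ o := fun he hab =>
    closedEdge_subset_circ (o := o) (hPo.subset he) hab.left_mem_closedEdge
  by_cases hne : (Γ.edgeSet s ∩ edgesOf P).Nonempty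
  · have hfin : (Γ.edgeSet s ∩ edgesOf P).Finite := by
      refine (t.finite_toSet.biUnion fun b _ => finite_edgeSet_inter_edgesOf hP b).subset ?_
      rintro e ⟨hes, heP⟩
      obtain ⟨b, hb, heb⟩ := mem_iUnion₂.1 hes
      exact mem_biUnion hb ⟨heb, heP⟩
    obtain ⟨e, he, a, b, hab, ha⟩ := hP.exists_isLink_mem_connectedComponentIn hfin hne hv
    exact ⟨a, mem_circ he.2 hab, (joinedByContinuumIn_iff (hP.isCompact_sdiff _)
      (hP.saturated.sdiff_innerPoints _)).2 ha⟩
  · obtain ⟨e, he⟩ := ho.nonempty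
    lift e to M.E using ho.subset_ground he
    have heP : e ∈ edgesOf P := hPo.superset he
    have hab := isLink_headV_tailV (Γ := Γ) o e
    refine ⟨_, mem_circ heP hab, P, subset_sdiff.2 ⟨Subset.rfl, disjoint_right.2 ?_⟩, hP, hv,
      hP.left_mem heP hab⟩
    exact fun _ ⟨r, f, hf, hx⟩ hxP => hne ⟨f, hf, r, hx ▸ hxP⟩

theorem vertex_mem_circ_of_edgesOf_eq (hP : IsContinuum P) (ho : M.IsCircuit o)
    (hPo : edgesOf P = Γ.edgeSet o) (hv : vertex v ∈ P) : vertex v ∈ Γ.circ o := by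
  by_contra hvo
  obtain ⟨t, ht⟩ := (isCompact_circ_sdiff ho o).elim_finite_subcover
    (fun b => Γ.side b (-(v b))) (fun b => isOpen_side b _) (by
      rintro (w | ⟨r, e⟩) ⟨hx, hxo⟩
      · have hwv : v ≠ w := fun h => hvo (h ▸ hx)
        obtain ⟨b, hb⟩ := Function.ne_iff.1 hwv
        exact mem_iUnion.2 ⟨b, Int.units_ne_iff_eq_neg.1 hb.symm⟩
      · exact absurd (edgePt_mem_inner.2 (edgePt_mem_circ.1 hx)) hxo)
  obtain ⟨a, ha, hva⟩ := exists_joinedByContinuumIn_mem_circ hP ho hPo hv t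
  obtain ⟨b, hb, hab⟩ := mem_iUnion₂.1 (ht ⟨ha, vertex_notMem_inner⟩)
  have hvb : v b = a b := apply_eq_of_joinedByContinuumIn hva
    (disjoint_sdiff_left.mono_right (inner_mono (subset_biUnion_of_mem hb)))
  exact units_ne_neg_self _ (hvb.trans (vertex_mem_side.1 hab))

theorem exists_isCircuit_of_liesOnPseudoCircle (hv : Γ.toGraphLikeSpace.LiesOnPseudoCircle v) :
    ∃ o, M.IsCircuit o ∧ vertex v ∈ Γ.circ o := by
  obtain ⟨C, φ, hC, hφ, hvφ⟩ := hv
  have hP := hC.isCircleSet_range φ hφ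
  obtain ⟨o, ho, hPo⟩ := exists_isCircuit_edgesOf_eq hP
  exact ⟨o, ho, vertex_mem_circ_of_edgesOf_eq hP.isContinuum ho hPo hvφ⟩

end T2

end Matroid.GraphFramework

namespace GraphLikeSpace

open GraphLikePoint

/-- Any two vertices in `H` are joined by a continuum in `H`. In Hausdorff graph-like spaces this
means that they are joined by a pseudo-arc in `H`. -/
def IsContinuumConnected {G : GraphLikeSpace.{u}} (H : Set G.Point) : Prop :=
  ∀ v w : G.V, vertex v ∈ H → vertex w ∈ H → JoinedByContinuumIn H v w

end GraphLikeSpace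

namespace Matroid.GraphFramework

open GraphLikePoint GraphLikeSpace

variable {α : Type u} {M : Matroid α} {Γ : M.GraphFramework}
  {b : {b : Set α // M.IsCocircuit b}} {i : ℤˣ} {H : Set Γ.toGraphLikeSpace.Point}
  {B : Set {b : Set α // M.IsCocircuit b}} {u v w x : Vert M} {e : M.E} {r : Ioo (0 : ℝ) 1}

/-! ### Cutting a subgraph along cocircuits -/

/-- `H` is a union of vertices and edges of `G(M, Γ)` that contains the endvertices of its edges and
the vertices of `Ĝ(M, Γ)` in the closure of its edges. -/
structure IsClosedSubgraph (Γ : M.GraphFramework) (H : Set Γ.toGraphLikeSpace.Point) : Prop where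
  saturated : Saturated H
  left_mem : ∀ {e v w}, e ∈ edgesOf H → Γ.toGraphLikeSpace.IsLink e v w → vertex v ∈ H
  vertex_mem_of_mem_closure : ∀ v ∈ Γ.toGraphLikeSpace.hatVertices,
    vertex v ∈ _root_.closure (Γ.toGraphLikeSpace.innerPoints (edgesOf H)) → vertex v ∈ H

/-- The part of `H` that avoids the cocircuits in `B` and lies on the same side of each of them as
the vertex `x`. -/
def cut (H : Set Γ.toGraphLikeSpace.Point) (x : Vert M) (B : Set {b : Set α // M.IsCocircuit b}) :
    Set Γ.toGraphLikeSpace.Point :=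
  H ∩ ⋂ b ∈ B, Γ.side b (x b) \ Γ.inner b.1

theorem vertex_mem_cut : (vertex v : Γ.toGraphLikeSpace.Point) ∈ cut H x B ↔
    (vertex v : Γ.toGraphLikeSpace.Point) ∈ H ∧ ∀ b ∈ B, v b = x b := by
  simp only [cut, mem_inter_iff, mem_iInter, mem_sdiff, vertex_mem_side, vertex_notMem_inner,
    not_false_eq_true, and_true]

theorem edgePt_mem_side_sdiff_inner :
    (edgePt r e : Γ.toGraphLikeSpace.Point) ∈ Γ.side b i \ Γ.inner b.1 ↔
      (e : α) ∉ b.1 ∧ Γ.σ b.1 e = i := by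
  rw [mem_sdiff, edgePt_mem_inner, and_comm]
  exact and_congr_right edgePt_mem_side_of_notMem

theorem edgePt_mem_cut : (edgePt r e : Γ.toGraphLikeSpace.Point) ∈ cut H x B ↔
    (edgePt r e : Γ.toGraphLikeSpace.Point) ∈ H ∧ ∀ b ∈ B, (e : α) ∉ b.1 ∧ Γ.σ b.1 e = x b := by
  simp only [cut, mem_inter_iff, mem_iInter, edgePt_mem_side_sdiff_inner]

theorem cut_empty : cut H x ∅ = H := by
  simp only [cut, biInter_empty, inter_univ]

theorem cut_cut (B' : Set {b : Set α // M.IsCocircuit b}) :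
    cut (cut H x B) x B' = cut H x (B ∪ B') := by
  rw [cut, cut, cut, biInter_union, inter_assoc]

theorem apply_eq_σ_of_isLink (h : Γ.toGraphLikeSpace.IsLink e v w) (he : (e : α) ∉ b.1) :
    v b = Γ.σ b.1 e := by
  obtain ⟨rfl, -⟩ | ⟨rfl, -⟩ := h <;> exact if_neg he

theorem IsClosedSubgraph.cut (hH : Γ.IsClosedSubgraph H) (x : Vert M)
    (B : Set {b : Set α // M.IsCocircuit b}) : Γ.IsClosedSubgraph (cut H x B) where
  saturated e r r' h :=
    edgePt_mem_cut.2 ⟨hH.saturated e r r' (edgePt_mem_cut.1 h).1, (edgePt_mem_cut.1 h).2⟩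
  left_mem := by
    rintro e v w ⟨r, hr⟩ hlink
    obtain ⟨hrH, hrB⟩ := edgePt_mem_cut.1 hr
    exact vertex_mem_cut.2 ⟨hH.left_mem ⟨r, hrH⟩ hlink, fun b hb =>
      (apply_eq_σ_of_isLink hlink (hrB b hb).1).trans (hrB b hb).2⟩
  vertex_mem_of_mem_closure v hv hvc := by
    refine vertex_mem_cut.2 ⟨hH.vertex_mem_of_mem_closure v hv
      (_root_.closure_mono ?_ hvc), fun b hb => ?_⟩
    · rintro _ ⟨r, e, ⟨s, hs⟩, rfl⟩
      exact ⟨r, e, ⟨s, hs.1⟩, rfl⟩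
    · obtain ⟨p, hp, r, e, ⟨s, hs⟩, rfl⟩ := mem_closure_iff.1 hvc (Γ.side b ((v : Vert M) b))
        (isOpen_side b _) rfl
      obtain ⟨heb, hσ⟩ := (edgePt_mem_cut.1 hs).2 b hb
      exact ((edgePt_mem_side_of_notMem heb).1 hp).symm.trans hσ

theorem inter_side_of_joinedByContinuumIn (h : JoinedByContinuumIn H v w)
    (hb : Disjoint H (Γ.inner b.1)) : JoinedByContinuumIn (H ∩ Γ.side b (v b)) v w := by
  obtain ⟨P, hPH, hP, hv, hw⟩ := h
  exact ⟨P, subset_inter hPH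
    (subset_side_of_isPreconnected hP.isPreconnected (hb.mono_left hPH) hv), hP, hv, hw⟩

theorem isContinuumConnected_cut {K : Set Γ.toGraphLikeSpace.Point} (hKH : K ⊆ H)
    (hK : ∀ b ∈ B, Disjoint K (Γ.inner b.1))
    (hx : ∀ v, vertex v ∈ cut H x B → JoinedByContinuumIn K x v) :
    IsContinuumConnected (cut H x B) := by
  intro v w hv hw
  obtain ⟨P, hPK, hP, hvP, hwP⟩ := (hx v hv).symm.trans (hx w hw)
  refine ⟨P, fun p hp => ⟨hKH (hPK hp), mem_iInter₂.2 fun b hb => ?_⟩, hP, hvP, hwP⟩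
  have hPb : Disjoint P (Γ.inner b.1) := (hK b hb).mono_left hPK
  rw [← (vertex_mem_cut.1 hv).2 b hb]
  exact ⟨subset_side_of_isPreconnected hP.isPreconnected hPb hvP hp, disjoint_left.1 hPb hp⟩

/-- The edges that the second of two cocircuits cutting off the part of `H` joined to `x` must avoid
when the first of them is `b`: the edges outside `b` that belong to `H` or lie on the other side of
`b`, and the edges of `H` with no endvertex in that part. -/
def avoidedEdges (H : Set Γ.toGraphLikeSpace.Point) (b : {b : Set α // M.IsCocircuit b})
    (x : Vert M) : Set M.E :=
  {e | ((e : α) ∉ b.1 ∧ (e ∈ edgesOf H ∨ Γ.σ b.1 e ≠ x b)) ∨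
    (e ∈ edgesOf H ∧ ∀ v w, Γ.toGraphLikeSpace.IsLink e v w →
      ¬ JoinedByContinuumIn (H \ Γ.inner b.1) x v)}

theorem disjoint_sdiff_inner_of_avoidedEdges {c : Set α} (hc : ∀ e ∈ avoidedEdges H b x, ↑e ∉ c) :
    Disjoint (H \ Γ.inner b.1) (Γ.inner c) := by
  rw [disjoint_right]
  rintro _ ⟨r, (e : M.E), he, rfl⟩ ⟨heH, heb⟩
  exact hc e (Or.inl ⟨fun h => heb (edgePt_mem_inner.2 h), Or.inl ⟨r, heH⟩⟩) he

theorem disjoint_side_sdiff_inner_of_avoidedEdges {c : Set α}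
    (hc : ∀ e ∈ avoidedEdges H b x, ↑e ∉ c) (hi : i ≠ x b) :
    Disjoint (Γ.side b i \ Γ.inner b.1) (Γ.inner c) := by
  rw [disjoint_right]
  rintro _ ⟨r, (e : M.E), he, rfl⟩ hre
  obtain ⟨heb, rfl⟩ := edgePt_mem_side_sdiff_inner.1 hre
  exact hc e (Or.inl ⟨heb, Or.inr hi⟩) he

theorem eq_of_isLink_of_apply_eq {v' w' : Vert M} (h : Γ.toGraphLikeSpace.IsLink e v v')
    (h' : Γ.toGraphLikeSpace.IsLink e w w') (he : (e : α) ∈ b.1) (hvw : v b = w b) : v = w :=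
  (h.eq_or_eq h').resolve_right fun hv => apply_ne_of_isLink h' he (hv ▸ hvw.symm)

section T2

variable [T2Space Γ.toGraphLikeSpace.Point]

theorem IsClosedSubgraph.circ_inter_subset (hH : Γ.IsClosedSubgraph H) {o : Set α}
    (ho : M.IsCircuit o) {N : Set Γ.toGraphLikeSpace.Point} (hN : IsOpen N)
    (hoN : ∀ (e : M.E) (r : Ioo (0 : ℝ) 1), (e : α) ∈ o → edgePt r e ∈ N → e ∈ edgesOf H) :
    Γ.circ o ∩ N ⊆ H := by
  rintro (v | ⟨r, (e : M.E)⟩) ⟨hp, hpN⟩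
  · refine hH.vertex_mem_of_mem_closure v (mem_hatVertices_of_mem_circ ho hp)
      (mem_closure_iff.2 fun U hU hvU => ?_)
    obtain ⟨_, ⟨hpU, hpN⟩, r, e, he, rfl⟩ := mem_closure_iff.1 hp (U ∩ N) (hU.inter hN) ⟨hvU, hpN⟩
    exact ⟨_, hpU, r, e, hoN e r he hpN, rfl⟩
  · exact hH.saturated.mem (hoN e r (edgePt_mem_circ.1 hp) hpN) r

theorem exists_isLink_joinedByContinuumIn {P : Set Γ.toGraphLikeSpace.Point} (hP : IsContinuum P)
    (hv : vertex v ∈ P) (hw : vertex w ∈ P)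
    (hvw : ¬ JoinedByContinuumIn (P \ Γ.inner b.1) v w) :
    ∃ f : M.E, (f : α) ∈ b.1 ∧ f ∈ edgesOf P ∧ ∃ z z', Γ.toGraphLikeSpace.IsLink f z z' ∧
      JoinedByContinuumIn (P \ Γ.inner b.1) v z := by
  have hne : (Γ.edgeSet b.1 ∩ edgesOf P).Nonempty := by
    by_contra hempty
    refine hvw ⟨P, subset_sdiff.2 ⟨Subset.rfl, disjoint_right.2 ?_⟩, hP, hv, hw⟩
    rintro _ ⟨r, e, he, rfl⟩ heP
    exact hempty ⟨e, he, r, heP⟩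
  obtain ⟨f, ⟨hfb, hfP⟩, z, z', hlink, hz⟩ :=
    hP.exists_isLink_mem_connectedComponentIn (finite_edgeSet_inter_edgesOf hP b) hne hv
  exact ⟨f, hfb, hfP, z, z', hlink, (joinedByContinuumIn_iff (hP.isCompact_sdiff _)
    (hP.saturated.sdiff_innerPoints _)).2 hz⟩

/-- Follow a circuit that meets `b` only in `f` and `g` from `v`, away from `f`, until it reaches
`g`. -/
theorem joinedByContinuumIn_side_of_isLink {f g : M.E} {v' w' : Vert M} (hf : (f : α) ∈ b.1)
    (hg : (g : α) ∈ b.1) (hv : Γ.toGraphLikeSpace.IsLink f v v')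
    (hw : Γ.toGraphLikeSpace.IsLink g w w') (hvw : v b = w b) :
    JoinedByContinuumIn (Γ.side b (v b) \ Γ.inner b.1) v w := by
  by_cases hfg : f = g
  · subst hfg
    rw [← eq_of_isLink_of_apply_eq hv hw hf hvw]
    exact .refl ⟨rfl, vertex_notMem_inner⟩
  obtain ⟨o, ho, hob⟩ := exists_isCircuit_inter_eq_pair b.2 hf hg (Subtype.coe_ne_coe.2 hfg)
  have hfo : (f : α) ∈ o := (hob.superset (Or.inl rfl)).1
  have hgo : (g : α) ∈ o := (hob.superset (Or.inr rfl)).1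
  have mem : ∀ {e : M.E} {y y' : Vert M}, (e : α) ∈ o → Γ.toGraphLikeSpace.IsLink e y y' →
      vertex y ∈ Γ.circ o \ Γ.inner {(f : α)} := fun heo hy =>
    ⟨closedEdge_subset_circ heo hy.left_mem_closedEdge, vertex_notMem_inner⟩
  obtain ⟨e, heb, ⟨r, heo, hef⟩, y, y', hy, hvy⟩ := exists_isLink_joinedByContinuumIn
    (isContinuum_circ_sdiff ho hfo) (mem hfo hv) (mem hgo hw.symm) fun h =>
      apply_ne_of_isLink hw hg
        (hvw.symm.trans (apply_eq_of_joinedByContinuumIn h disjoint_sdiff_left))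
  obtain rfl : e = g := Subtype.ext <| (hob.subset ⟨edgePt_mem_circ.1 heo, heb⟩).resolve_left
    fun h => hef (edgePt_mem_inner.2 h)
  have hyb := apply_eq_of_joinedByContinuumIn hvy disjoint_sdiff_left
  rw [← eq_of_isLink_of_apply_eq hy hw hg (hyb.symm.trans hvw)]
  exact (inter_side_of_joinedByContinuumIn hvy disjoint_sdiff_left).mono fun p hp =>
    ⟨hp.2, hp.1.2⟩

/-- A circuit through `f` consisting of `f` and avoided edges stays in `H` from `u` to the next edge
of `b`, which therefore has an endvertex joined to `x`. -/
theorem IsClosedSubgraph.exists_isCocircuit_disjoint_avoidedEdges (hH : Γ.IsClosedSubgraph H)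
    {f : M.E} (hfb : (f : α) ∈ b.1) (hfH : f ∈ edgesOf H) (huw : Γ.toGraphLikeSpace.IsLink f u w)
    (hxu : JoinedByContinuumIn (H \ Γ.inner b.1) x u) :
    ∃ c, M.IsCocircuit c ∧ (f : α) ∈ c ∧ ∀ e ∈ avoidedEdges H b x, ↑e ∉ c := by
  have hfY : (f : α) ∉ Subtype.val '' avoidedEdges H b x := by
    rw [Subtype.val_injective.mem_set_image]
    rintro (hf | hf)
    exacts [hf.1 hfb, hf.2 u w huw hxu]
  obtain ⟨o, ho, hfo, hoY⟩ | ⟨c, hc, hfc, hcY⟩ :=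
    exists_isCircuit_or_isCocircuit_of_notMem f.2 hfY
  swap
  · exact ⟨c, hc, hfc, fun e he hec => disjoint_left.1 hcY hec ⟨e, he, rfl⟩⟩
  exfalso
  have eq_or_mem : ∀ e : M.E, (e : α) ∈ o → e = f ∨ e ∈ avoidedEdges H b x := fun e he =>
    (hoY he).imp Subtype.ext Subtype.val_injective.mem_set_image.1
  have hoH : Γ.circ o ∩ Γ.side b (x b) ⊆ H := by
    refine hH.circ_inter_subset ho (isOpen_side b _) fun e r he hr => ?_
    obtain rfl | (⟨heb, heH | hσ⟩ | heH) := eq_or_mem e he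
    exacts [hfH, heH, (hσ ((edgePt_mem_side_of_notMem heb).1 hr)).elim, heH.1]
  have mem : ∀ {z z' : Vert M}, Γ.toGraphLikeSpace.IsLink f z z' →
      vertex z ∈ Γ.circ o \ Γ.inner {(f : α)} := fun hz =>
    ⟨closedEdge_subset_circ hfo hz.left_mem_closedEdge, vertex_notMem_inner⟩
  obtain ⟨g, hgb, ⟨r, hgo, hgf⟩, z, z', hz, huz⟩ := exists_isLink_joinedByContinuumIn
    (isContinuum_circ_sdiff ho hfo) (mem huw) (mem huw.symm) fun h =>
      apply_ne_of_isLink huw hfb (apply_eq_of_joinedByContinuumIn h disjoint_sdiff_left)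
  have hxz : JoinedByContinuumIn (H \ Γ.inner b.1) x z := by
    refine hxu.trans ((inter_side_of_joinedByContinuumIn huz disjoint_sdiff_left).mono ?_)
    rw [← apply_eq_of_joinedByContinuumIn hxu disjoint_sdiff_left]
    exact fun p hp => ⟨hoH ⟨hp.1.1.1, hp.2⟩, hp.1.2⟩
  obtain rfl | (hg | hg) := eq_or_mem g (edgePt_mem_circ.1 hgo)
  exacts [hgf (edgePt_mem_inner.2 rfl), hg.1 hgb, hg.2 z z' hz hxz]

/-- Walk from `v` to an edge of `b` that avoids `c`, across that edge, and along the other side of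
`b` to the far endvertex of `f`: the walk never crosses `c`, whereas `f` does. -/
theorem apply_ne_of_not_joinedByContinuumIn (hH : IsContinuumConnected H) (hx : vertex x ∈ H)
    {c : {b : Set α // M.IsCocircuit b}} (hc : ∀ e ∈ avoidedEdges H b x, ↑e ∉ c.1) {f : M.E}
    (hfb : (f : α) ∈ b.1) (hfc : (f : α) ∈ c.1) (huw : Γ.toGraphLikeSpace.IsLink f u w)
    (hxu : JoinedByContinuumIn (H \ Γ.inner b.1) x u) (hv : vertex v ∈ H) (hvb : v b = x b)
    (hxv : ¬ JoinedByContinuumIn (H \ Γ.inner b.1) x v) : v c ≠ x c := by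
  obtain ⟨P, hPH, hP, hvP, hxP⟩ := hH v x hv hx
  have hPb : P \ Γ.inner b.1 ⊆ H \ Γ.inner b.1 := sdiff_subset_sdiff_left hPH
  obtain ⟨g, hgb, ⟨r, hgP⟩, z, z', hz, hvz⟩ :=
    exists_isLink_joinedByContinuumIn hP hvP hxP fun h => hxv (h.mono hPb).symm
  replace hvz := hvz.mono hPb
  have hzb : z b = x b := (apply_eq_of_joinedByContinuumIn hvz disjoint_sdiff_left).symm.trans hvb
  have hz'b : z' b ≠ x b := fun h => apply_ne_of_isLink hz hgb (hzb.trans h.symm)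
  have hub : x b = u b := apply_eq_of_joinedByContinuumIn hxu disjoint_sdiff_left
  have hwb : w b ≠ x b := fun h => apply_ne_of_isLink huw hfb (hub.symm.trans h.symm)
  have hxz : ¬ JoinedByContinuumIn (H \ Γ.inner b.1) x z := fun h => hxv (h.trans hvz.symm)
  have hxz' : ¬ JoinedByContinuumIn (H \ Γ.inner b.1) x z' := fun h =>
    hz'b (apply_eq_of_joinedByContinuumIn h disjoint_sdiff_left).symm
  have hg : g ∈ avoidedEdges H b x := by
    refine Or.inr ⟨⟨r, hPH hgP⟩, fun y y' hy => ?_⟩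
    obtain rfl | rfl := hy.eq_or_eq hz
    exacts [hxz, hxz']
  have hHc := disjoint_sdiff_inner_of_avoidedEdges hc
  have hz'w : z' c = w c := by
    refine apply_eq_of_joinedByContinuumIn (joinedByContinuumIn_side_of_isLink hgb hfb hz.symm
      huw.symm ?_) (disjoint_side_sdiff_inner_of_avoidedEdges hc hz'b)
    exact (Int.units_ne_iff_eq_neg.1 hz'b).trans (Int.units_ne_iff_eq_neg.1 hwb).symm
  rw [apply_eq_of_joinedByContinuumIn hvz hHc, apply_eq_of_isLink hz (hc g hg), hz'w,
    apply_eq_of_joinedByContinuumIn hxu hHc]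
  exact apply_ne_of_isLink huw.symm hfc

theorem exists_isContinuumConnected_cut_pair (hH : IsContinuumConnected H)
    (hHc : Γ.IsClosedSubgraph H) (hx : vertex x ∈ H) (b : {b : Set α // M.IsCocircuit b}) :
    ∃ c, IsContinuumConnected (cut H x {b, c}) := by
  by_cases hb : ∀ v : Vert M, vertex v ∈ H → v b = x b → JoinedByContinuumIn (H \ Γ.inner b.1) x v
  · refine ⟨b, isContinuumConnected_cut sdiff_subset (K := H \ Γ.inner b.1) ?_ fun v hv => ?_⟩
    · rintro _ (rfl | rfl) <;> exact disjoint_sdiff_left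
    · exact hb v (vertex_mem_cut.1 hv).1 ((vertex_mem_cut.1 hv).2 b (Or.inl rfl))
  push Not at hb
  obtain ⟨y, hy, -, hxy⟩ := hb
  obtain ⟨P, hPH, hP, hxP, hyP⟩ := hH x y hx hy
  have hPb : P \ Γ.inner b.1 ⊆ H \ Γ.inner b.1 := sdiff_subset_sdiff_left hPH
  obtain ⟨f, hfb, ⟨r, hfP⟩, u, w, huw, hxu⟩ :=
    exists_isLink_joinedByContinuumIn hP hxP hyP fun h => hxy (h.mono hPb)
  obtain ⟨c, hc, hfc, hcY⟩ := hHc.exists_isCocircuit_disjoint_avoidedEdges hfb ⟨r, hPH hfP⟩ huw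
    (hxu.mono hPb)
  refine ⟨⟨c, hc⟩, isContinuumConnected_cut sdiff_subset (K := H \ Γ.inner b.1) ?_ fun v hv => ?_⟩
  · rintro _ (rfl | rfl)
    exacts [disjoint_sdiff_left, disjoint_sdiff_inner_of_avoidedEdges hcY]
  · obtain ⟨hvH, hvB⟩ := vertex_mem_cut.1 hv
    by_contra hxv
    exact apply_ne_of_not_joinedByContinuumIn hH hx hcY hfb hfc huw (hxu.mono hPb) hvH
      (hvB b (Or.inl rfl)) hxv (hvB _ (Or.inr rfl))

theorem exists_isContinuumConnected_cut (hH : IsContinuumConnected H) (hHc : Γ.IsClosedSubgraph H)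
    (hx : vertex x ∈ H) {B₀ : Set {b : Set α // M.IsCocircuit b}} (hB₀ : B₀.Finite) :
    ∃ B, B.Finite ∧ B₀ ⊆ B ∧ IsContinuumConnected (cut H x B) := by
  induction B₀, hB₀ using Set.Finite.induction_on with
  | empty => exact ⟨∅, finite_empty, Subset.rfl, cut_empty.symm ▸ hH⟩
  | @insert b B₀ _ _ ih =>
    obtain ⟨B, hB, hB₀B, hcut⟩ := ih
    obtain ⟨c, hc⟩ := exists_isContinuumConnected_cut_pair hcut (hHc.cut x B)
      (vertex_mem_cut.2 ⟨hx, fun _ _ => rfl⟩) b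
    refine ⟨B ∪ {b, c}, hB.union (toFinite _), insert_subset (Or.inr (Or.inl rfl))
      (subset_union_of_subset_left hB₀B _), cut_cut (x := x) {b, c} ▸ hc⟩

end T2

end Matroid.GraphFramework

namespace GraphLikeSpace

open GraphLikePoint

variable {G K : GraphLikeSpace.{u}}

/-! ### Arcs along an edge -/

theorem edge_eq_edge {e : G.E} {x y : unitInterval} (h : G.edge e x = G.edge e y) :
    x = y ∨ (x = 0 ∧ y = 1) ∨ (x = 1 ∧ y = 0) := by
  by_cases hx0 : x = 0 <;> by_cases hx1 : x = 1 <;> by_cases hy0 : y = 0 <;>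
    by_cases hy1 : y = 1 <;>
    simp_all only [edge, edgeMap, dite_true, dite_false, edgePt.injEq, reduceCtorEq, and_true,
      true_or, or_true, and_self, zero_ne_one, one_ne_zero]
  exact Or.inl (Subtype.ext (congrArg (Subtype.val (p := fun z : ℝ => z ∈ Ioo 0 1)) h))

theorem edge_injOn_uIcc (e : G.E) (r : Ioo (0 : ℝ) 1) {i : unitInterval} (hi : i = 0 ∨ i = 1) :
    InjOn (G.edge e) {x | (x : ℝ) ∈ uIcc (r : ℝ) i} := by
  obtain ⟨r, h0, h1⟩ := r
  have hends : ∀ {x y : unitInterval}, (x : ℝ) ∈ uIcc r i → (y : ℝ) ∈ uIcc r i →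
      ¬ (x = 0 ∧ y = 1) := by
    rintro _ _ hx hy ⟨rfl, rfl⟩
    rcases hi with rfl | rfl
    · exact h1.not_ge (uIcc_of_ge h0.le ▸ hy).2
    · exact h0.not_ge (uIcc_of_le h1.le ▸ hx).1
  intro x hx y hy hxy
  exact (edge_eq_edge hxy).resolve_right
    (not_or_intro (hends hx hy) fun h => hends hy hx h.symm)

theorem exists_arc_edge {S : Set G.Point} (e : G.E) (r : Ioo (0 : ℝ) 1) {i : unitInterval}
    (hi : i = 0 ∨ i = 1) (hS : ∀ x : unitInterval, (x : ℝ) ∈ uIcc (r : ℝ) i → G.edge e x ∈ S) :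
    ∃ γ : unitInterval → G.Point, Continuous γ ∧ Function.Injective γ ∧ γ 0 = edgePt r e ∧
      γ 1 = G.edge e i ∧ range γ ⊆ S ∩ range (G.edge e) := by
  have huIcc : ∀ t : unitInterval, AffineMap.lineMap (r : ℝ) (i : ℝ) (t : ℝ) ∈ uIcc (r : ℝ) i :=
    fun t => segment_eq_uIcc (r : ℝ) i ▸ lineMap_mem_segment ℝ _ _ t.2
  have hri : (r : ℝ) ≠ i := by
    rcases hi with rfl | rfl
    exacts [r.2.1.ne', r.2.2.ne]
  let δ : unitInterval → unitInterval := fun t => ⟨AffineMap.lineMap (r : ℝ) (i : ℝ) (t : ℝ),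
    uIcc_subset_Icc ⟨r.2.1.le, r.2.2.le⟩ i.2 (huIcc t)⟩
  have hδ : Continuous δ := by fun_prop
  refine ⟨G.edge e ∘ δ, (G.continuous_edge e).comp hδ, fun t t' htt' => ?_, ?_, ?_, ?_⟩
  · have h := edge_injOn_uIcc e r hi (huIcc t) (huIcc t') htt'
    exact Subtype.ext (AffineMap.lineMap_injective ℝ hri (congrArg Subtype.val h))
  · rw [← edge_coe]
    simp [δ]
  · simp [δ]
  · rintro _ ⟨t, rfl⟩
    exact ⟨hS _ (huIcc t), _, rfl⟩

theorem edge_zero_or_one_eq {e : G.E} {i : unitInterval} (hi : i = 0 ∨ i = 1) :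
    G.edge e i = vertex (G.src e) ∨ G.edge e i = vertex (G.tgt e) := by
  rcases hi with rfl | rfl
  exacts [Or.inl (edge_zero e), Or.inr (edge_one e)]

theorem src_mem_hatVertices (e : G.E) : G.src e ∈ G.hatVertices :=
  Or.inl ⟨e, Or.inl rfl⟩

theorem tgt_mem_hatVertices (e : G.E) : G.tgt e ∈ G.hatVertices :=
  Or.inl ⟨e, Or.inr rfl⟩

/-! ### Embeddings of graph-like spaces -/

/-- Embeddings of graph-like spaces that preserve the orientation of the edges, such as the
inclusions of subspaces. -/
structure IsGraphEmbedding (j : K.Point → G.Point) : Prop where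
  isEmbedding : Topology.IsEmbedding j
  exists_vertex : ∀ v, ∃ w, j (vertex v) = vertex w
  exists_edge : ∀ e, ∃ f, ∀ x, j (K.edge e x) = G.edge f x

theorem isGraphEmbedding_inclusion {V' : Set G.V} {E' : Set G.E}
    (h0 : ∀ e ∈ E', G.src e ∈ V') (h1 : ∀ e ∈ E', G.tgt e ∈ V') :
    IsGraphEmbedding (K := G.subspace V' E' h0 h1) (inclusion V' E') where
  isEmbedding := ⟨⟨rfl⟩, subspaceHom_toFun h0 h1 ▸ subspaceHom_injective h0 h1⟩
  exists_vertex v := ⟨v.1, rfl⟩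
  exists_edge e := ⟨e.1, inclusion_edgeMap V' E' G.src G.tgt h0 h1 e⟩

namespace IsGraphEmbedding

variable {j : K.Point → G.Point}

theorem comp {L : GraphLikeSpace.{u}} {i : L.Point → K.Point} (hj : IsGraphEmbedding j)
    (hi : IsGraphEmbedding i) : IsGraphEmbedding (j ∘ i) where
  isEmbedding := hj.isEmbedding.comp hi.isEmbedding
  exists_vertex v := by
    obtain ⟨w, hw⟩ := hi.exists_vertex v
    obtain ⟨w', hw'⟩ := hj.exists_vertex w
    exact ⟨w', (congrArg j hw).trans hw'⟩
  exists_edge e := by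
    obtain ⟨f, hf⟩ := hi.exists_edge e
    obtain ⟨f', hf'⟩ := hj.exists_edge f
    exact ⟨f', fun x => (congrArg j (hf x)).trans (hf' x)⟩

theorem exists_edgePt (hj : IsGraphEmbedding j) (e : K.E) :
    ∃ f, ∀ r, j (edgePt r e) = edgePt r f := by
  obtain ⟨f, hf⟩ := hj.exists_edge e
  exact ⟨f, fun r => by rw [← edge_coe, hf, edge_coe]⟩

theorem joinedByContinuumIn_preimage (hj : IsGraphEmbedding j) {H : Set G.Point} {u v : K.V}
    {u' v' : G.V} (hu : j (vertex u) = vertex u') (hv : j (vertex v) = vertex v')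
    (h : JoinedByContinuumIn H u' v') (hH : H ⊆ range j) : JoinedByContinuumIn (j ⁻¹' H) u v := by
  obtain ⟨P, hPH, hP, hu', hv'⟩ := h
  have himage := image_preimage_eq_of_subset (hPH.trans hH)
  refine ⟨j ⁻¹' P, preimage_mono hPH, ⟨?_, ?_, fun e r r' hr => ?_⟩, ?_, ?_⟩
  · exact hj.isEmbedding.isCompact_iff.2 (himage.symm ▸ hP.isCompact)
  · exact hj.isEmbedding.isInducing.isPreconnected_image.1 (himage.symm ▸ hP.isPreconnected)
  · obtain ⟨f, hf⟩ := hj.exists_edgePt e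
    rw [mem_preimage, hf] at hr ⊢
    exact hP.saturated f r r' hr
  · rwa [mem_preimage, hu]
  · rwa [mem_preimage, hv]

end IsGraphEmbedding

theorem isPseudoLine_of_subsingleton [Subsingleton G.Point] (v : G.V) [IsEmpty G.E] :
    G.IsPseudoLine v v where
  compact := Finite.compactSpace
  connected := ⟨⟨vertex v⟩⟩
  edge_separates e := isEmptyElim e
  exists_separating v w hvw :=
    absurd (GraphLikePoint.vertex.inj (Subsingleton.elim (vertex v : G.Point) (vertex w))) hvw

theorem joinedByPseudoArcIn_refl {H : Set G.Point} {u : G.V} (hu : vertex u ∈ H) :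
    G.JoinedByPseudoArcIn H u u := by
  let L := G.subspace {u} ∅ (fun _ h => h.elim) (fun _ h => h.elim)
  have huniq : ∀ p : L.Point, p = vertex (⟨u, rfl⟩ : ({u} : Set G.V)) := by
    rintro (v | ⟨r, e⟩)
    · exact congrArg vertex (Subtype.ext v.2)
    · exact e.2.elim
  have : Subsingleton L.Point := ⟨fun p q => (huniq p).trans (huniq q).symm⟩
  have : IsEmpty L.E := inferInstanceAs (IsEmpty (∅ : Set G.E))
  refine ⟨L, _, _, subspaceHom G _ _ _ _, isPseudoLine_of_subsingleton (⟨u, rfl⟩ : ({u} : Set G.V)),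
    Function.injective_of_subsingleton _, rfl, rfl, ?_⟩
  rintro _ ⟨p, rfl⟩
  rw [huniq p]
  exact hu

theorem isPseudoArcConnected_univ [Subsingleton G.V] : G.IsPseudoArcConnected univ := by
  refine Or.inr ⟨fun u v _ _ => ?_, fun e r _ => ?_⟩
  · obtain rfl := Subsingleton.elim u v
    exact joinedByPseudoArcIn_refl (mem_univ _)
  · obtain ⟨γ, hγ, hinj, h0, h1, hr⟩ :=
      exists_arc_edge (S := univ) e r (Or.inl rfl) fun _ _ => mem_univ _
    exact ⟨γ, hγ, hinj, h0, Or.inl (h1.trans (edge_zero e)), hr⟩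

end GraphLikeSpace

namespace Matroid.GraphFramework

open GraphLikePoint GraphLikeSpace

variable {α : Type u} {M : Matroid α} {Γ : M.GraphFramework} {K : GraphLikeSpace.{u}}
  {j : K.Point → Γ.toGraphLikeSpace.Point}

/-! ### Neighbourhoods that are pseudo-arc connected -/

theorem edge_mem_nbhd {b : {b : Set α // M.IsCocircuit b}} {i : ℤˣ} {ε : M.E → Ioo (0 : ℝ) 1}
    {e : M.E} {x : unitInterval} : Γ.toGraphLikeSpace.edge e x ∈ Γ.nbhd b i ε ↔
      ((e : α) ∉ b.1 ∧ Γ.σ b.1 e = i) ∨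
        ((e : α) ∈ b.1 ∧ Γ.d b.1 e = i ∧ 1 - (ε e : ℝ) < (x : ℝ)) ∨
        ((e : α) ∈ b.1 ∧ Γ.d b.1 e = -i ∧ (x : ℝ) < (ε e : ℝ)) := by
  have hε := (ε e).2
  rcases eq_or_ne x 0 with rfl | h0
  · rw [edge_zero (G := Γ.toGraphLikeSpace) e]
    refine (vertex_mem_nbhd (v := Γ.srcV e)).trans ?_
    by_cases he : (e : α) ∈ b.1 <;> simp [srcV, he, hε.1, hε.2.le, neg_eq_iff_eq_neg]
  rcases eq_or_ne x 1 with rfl | h1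
  · rw [edge_one (G := Γ.toGraphLikeSpace) e]
    refine (vertex_mem_nbhd (v := Γ.tgtV e)).trans ?_
    by_cases he : (e : α) ∈ b.1 <;> simp [tgtV, he, hε.1, hε.2.le]
  · have hx : (x : ℝ) ∈ Ioo (0 : ℝ) 1 :=
      ⟨unitInterval.pos_iff_ne_zero.2 h0, unitInterval.lt_one_iff_ne_one.2 h1⟩
    rw [edge_coe (G := Γ.toGraphLikeSpace) e ⟨x, hx⟩]
    exact edgePt_mem_nbhd

/-- Since `ε ≤ 1/2`, the cocircuits in `B` that contain `e` all attach the point `(r, e)` to the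
same end of `e`, namely the nearer one. -/
theorem exists_edge_mem_biInter_nbhd {B : Set {b : Set α // M.IsCocircuit b}} {x : Vert M}
    {ε : {b : Set α // M.IsCocircuit b} → M.E → Ioo (0 : ℝ) 1}
    (hε : ∀ b e, (ε b e : ℝ) ≤ 1 / 2) {r : Ioo (0 : ℝ) 1} {e : M.E}
    (hr : (edgePt r e : Γ.toGraphLikeSpace.Point) ∈ ⋂ b ∈ B, Γ.nbhd b (x b) (ε b)) :
    ∃ i : unitInterval, (i = 0 ∨ i = 1) ∧ ∀ y : unitInterval, (y : ℝ) ∈ uIcc (r : ℝ) i →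
      Γ.toGraphLikeSpace.edge e y ∈ ⋂ b ∈ B, Γ.nbhd b (x b) (ε b) := by
  simp only [mem_iInter, edgePt_mem_nbhd] at hr
  rcases lt_or_ge (r : ℝ) (1 / 2) with hr2 | hr2
  · refine ⟨0, Or.inl rfl, fun y hy => mem_iInter₂.2 fun b hb => edge_mem_nbhd.2 ?_⟩
    rw [Icc.coe_zero, uIcc_of_ge r.2.1.le] at hy
    rcases hr b hb with h | ⟨-, -, h⟩ | ⟨heb, hd, h⟩
    exacts [Or.inl h, by linarith [hε b e], Or.inr (Or.inr ⟨heb, hd, hy.2.trans_lt h⟩)]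
  · refine ⟨1, Or.inr rfl, fun y hy => mem_iInter₂.2 fun b hb => edge_mem_nbhd.2 ?_⟩
    rw [Icc.coe_one, uIcc_of_le r.2.2.le] at hy
    rcases hr b hb with h | ⟨heb, hd, h⟩ | ⟨-, -, h⟩
    exacts [Or.inl h, Or.inr (Or.inl ⟨heb, hd, h.trans_le hy.1⟩), by linarith [hε b e]]

theorem isPseudoArcConnected_preimage_biInter_nbhd [T2Space Γ.toGraphLikeSpace.Point]
    (hj : IsGraphEmbedding j) {B : Set {b : Set α // M.IsCocircuit b}} {x : Vert M}
    {ε : {b : Set α // M.IsCocircuit b} → M.E → Ioo (0 : ℝ) 1} (hε : ∀ b e, (ε b e : ℝ) ≤ 1 / 2)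
    (hcut : IsContinuumConnected (cut (range j) x B)) :
    K.IsPseudoArcConnected (j ⁻¹' ⋂ b ∈ B, Γ.nbhd b (x b) (ε b)) := by
  have := hj.isEmbedding.t2Space
  have cut_subset : cut (range j) x B ⊆ ⋂ b ∈ B, Γ.nbhd b (x b) (ε b) :=
    inter_subset_right.trans (iInter₂_mono fun b _ => side_sdiff_inner_subset_nbhd b _ _)
  have vertex_mem : ∀ {v v'}, j (vertex v) = vertex v' →
      vertex v ∈ j ⁻¹' (⋂ b ∈ B, Γ.nbhd b (x b) (ε b)) → vertex v' ∈ cut (range j) x B :=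
    fun {v v'} hv h => by
      rw [mem_preimage, hv] at h
      exact vertex_mem_cut.2 ⟨⟨_, hv⟩, mem_iInter₂.1 h⟩
  refine Or.inr ⟨fun u v hu hv => ?_, fun e r hr => ?_⟩
  · obtain ⟨u', hu'⟩ := hj.exists_vertex u
    obtain ⟨v', hv'⟩ := hj.exists_vertex v
    have h := hcut u' v' (vertex_mem hu' hu) (vertex_mem hv' hv)
    exact ((hj.joinedByContinuumIn_preimage hu' hv' h inter_subset_left).mono
      (preimage_mono cut_subset)).joinedByPseudoArcIn
  · obtain ⟨f, hf⟩ := hj.exists_edge e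
    have hr' : edgePt r f ∈ ⋂ b ∈ B, Γ.nbhd b (x b) (ε b) := by
      rwa [mem_preimage, ← edge_coe, hf, edge_coe] at hr
    obtain ⟨i, hi, hmem⟩ := exists_edge_mem_biInter_nbhd hε hr'
    obtain ⟨γ, hγ, hinj, h0, h1, hγr⟩ := exists_arc_edge e r hi
      (S := j ⁻¹' ⋂ b ∈ B, Γ.nbhd b (x b) (ε b)) fun y hy => by
        rw [mem_preimage, hf]
        exact hmem y hy
    exact ⟨γ, hγ, hinj, h0, h1 ▸ edge_zero_or_one_eq hi, hγr⟩

theorem locallyPseudoArcConnected_of_isContinuumConnected_range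
    [T2Space Γ.toGraphLikeSpace.Point] (hj : IsGraphEmbedding j)
    (hclosed : Γ.IsClosedSubgraph (range j)) (hcon : IsContinuumConnected (range j)) :
    K.LocallyPseudoArcConnected := by
  intro x U hU hx
  obtain ⟨U₀, hU₀, rfl⟩ := hj.isEmbedding.isOpen_iff.1 hU
  obtain ⟨x', hx'⟩ := hj.exists_vertex x
  rw [mem_preimage, hx'] at hx
  obtain ⟨B₀, ε₀, hB₀⟩ := exists_biInter_nbhd_subset hU₀ hx
  obtain ⟨B, hB, hB₀B, hcut⟩ :=
    exists_isContinuumConnected_cut hcon hclosed ⟨_, hx'⟩ B₀.finite_toSet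
  let half : Ioo (0 : ℝ) 1 := ⟨1 / 2, by norm_num, by norm_num⟩
  let ε b e := min (ε₀ b e) half
  have hε : ∀ b e, (ε b e : ℝ) ≤ 1 / 2 := fun b e => Subtype.coe_le_coe.2 (min_le_right _ half)
  refine ⟨j ⁻¹' ⋂ b ∈ B, Γ.nbhd b (x' b) (ε b), preimage_mono (Subset.trans ?_ hB₀), ?_, ?_,
    isPseudoArcConnected_preimage_biInter_nbhd hj hε hcut⟩
  · exact (biInter_subset_biInter_left hB₀B).trans
      (iInter₂_mono fun b _ => nbhd_mono fun e => min_le_left _ _)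
  · exact (hB.isOpen_biInter fun b _ => isOpen_nbhd b _ _).preimage hj.isEmbedding.continuous
  · rw [mem_preimage, hx']
    exact mem_iInter₂.2 fun _ _ => rfl

theorem locallyPseudoArcConnected_of_isEmpty [IsEmpty {b : Set α // M.IsCocircuit b}]
    (hj : IsGraphEmbedding j) : K.LocallyPseudoArcConnected := by
  intro x U hU hx
  obtain ⟨U₀, hU₀, rfl⟩ := hj.isEmbedding.isOpen_iff.1 hU
  obtain ⟨x', hx'⟩ := hj.exists_vertex x
  rw [mem_preimage, hx'] at hx
  obtain ⟨B, ε, hB⟩ := exists_biInter_nbhd_subset hU₀ hx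
  obtain rfl : U₀ = univ :=
    univ_subset_iff.1 ((subset_iInter₂ fun b _ => (IsEmpty.false b).elim).trans hB)
  have : Subsingleton K.V := ⟨fun v w => by
    obtain ⟨v', hv⟩ := hj.exists_vertex v
    obtain ⟨w', hw⟩ := hj.exists_vertex w
    obtain rfl : v' = w' := Subsingleton.elim (α := Vert M) v' w'
    exact GraphLikePoint.vertex.inj (hj.isEmbedding.injective (hv.trans hw.symm))⟩
  exact ⟨univ, Subset.rfl, isOpen_univ, mem_univ _, isPseudoArcConnected_univ⟩

theorem t2Space_or_isEmpty (hM : M.IsConnectedMatroid) (Γ : M.GraphFramework) :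
    T2Space Γ.toGraphLikeSpace.Point ∨ IsEmpty {b : Set α // M.IsCocircuit b} := by
  by_cases h : ∀ e : M.E, ∃ b, M.IsCocircuit b ∧ (e : α) ∈ b
  · exact Or.inl (t2Space h)
  · push Not at h
    obtain ⟨e, he⟩ := h
    refine Or.inr ⟨fun ⟨b, hb⟩ => ?_⟩
    obtain ⟨f, hf⟩ := hb.nonempty
    have hfe : f ∈ ({(e : α)} : Set α) := hM.ground_eq_singleton e.2 he ▸ hb.subset_ground hf
    exact he b hb (hfe ▸ hf)

/-! ### The space `Ĝ(M, Γ)` and its standard subspaces -/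

/-- The inclusion of `Ĝ(M, Γ)` into `G(M, Γ)`. -/
def hatIncl (Γ : M.GraphFramework) : Γ.hatSpace.Point → Γ.toGraphLikeSpace.Point :=
  inclusion Γ.toGraphLikeSpace.hatVertices univ

theorem isGraphEmbedding_hatIncl : IsGraphEmbedding Γ.hatIncl :=
  isGraphEmbedding_inclusion (fun e _ => src_mem_hatVertices e) fun e _ => tgt_mem_hatVertices e

theorem vertex_mem_range_hatIncl {v : Vert M} :
    vertex v ∈ range Γ.hatIncl ↔ v ∈ Γ.toGraphLikeSpace.hatVertices := by
  constructor
  · rintro ⟨w | ⟨r, e⟩, hw⟩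
    · exact GraphLikePoint.vertex.inj hw ▸ w.2
    · cases hw
  · exact fun hv => ⟨vertex ⟨v, hv⟩, rfl⟩

theorem edgePt_mem_range_hatIncl {e : M.E} {r : Ioo (0 : ℝ) 1} :
    edgePt r e ∈ range Γ.hatIncl :=
  ⟨edgePt r ⟨e, trivial⟩, rfl⟩

theorem mem_hatVertices_of_isLink {e : M.E} {v w : Vert M}
    (h : Γ.toGraphLikeSpace.IsLink e v w) : v ∈ Γ.toGraphLikeSpace.hatVertices :=
  Or.inl ⟨e, h.imp (fun h => h.1.symm) fun h => h.1.symm⟩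

theorem isClosedSubgraph_range_hatIncl : Γ.IsClosedSubgraph (range Γ.hatIncl) where
  saturated _ _ _ _ := edgePt_mem_range_hatIncl
  left_mem _ h := vertex_mem_range_hatIncl.2 (mem_hatVertices_of_isLink h)
  vertex_mem_of_mem_closure _ hv _ := vertex_mem_range_hatIncl.2 hv

theorem closedEdge_subset_range_hatIncl (e : M.E) :
    Γ.toGraphLikeSpace.closedEdge e ⊆ range Γ.hatIncl := by
  intro p hp
  rcases mem_closedEdge.1 hp with rfl | rfl | ⟨r, rfl⟩
  · exact vertex_mem_range_hatIncl.2 (src_mem_hatVertices (G := Γ.toGraphLikeSpace) e)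
  · exact vertex_mem_range_hatIncl.2 (tgt_mem_hatVertices (G := Γ.toGraphLikeSpace) e)
  · exact edgePt_mem_range_hatIncl

section T2

variable [T2Space Γ.toGraphLikeSpace.Point]

theorem joinedByContinuumIn_range_hatIncl_of_isCircuit {o : Set α} (ho : M.IsCircuit o)
    {u v : Vert M} (hu : vertex u ∈ Γ.circ o) (hv : vertex v ∈ Γ.circ o) :
    JoinedByContinuumIn (range Γ.hatIncl) u v := by
  refine ⟨Γ.circ o, ?_, isContinuum_circ ho, hu, hv⟩
  rintro (v | ⟨r, e⟩) hp
  · exact vertex_mem_range_hatIncl.2 (mem_hatVertices_of_mem_circ ho hp)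
  · exact edgePt_mem_range_hatIncl

theorem joinedByContinuumIn_srcV_srcV (hM : M.IsConnectedMatroid) (e f : M.E) :
    JoinedByContinuumIn (range Γ.hatIncl) (Γ.srcV e) (Γ.srcV f) := by
  have srcV_mem_circ : ∀ {o : Set α} {g : M.E}, (g : α) ∈ o →
      vertex (Γ.srcV g) ∈ Γ.circ o := fun {o g} hg =>
    closedEdge_subset_circ hg
      (IsLink.left_mem_closedEdge (isLink_src_tgt (G := Γ.toGraphLikeSpace) g))
  obtain ⟨f, hf⟩ := f
  induction hM.reflTransGen_onCommonCircuit e.2 hf with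
  | refl =>
    exact JoinedByContinuumIn.refl (closedEdge_subset_range_hatIncl e
      (IsLink.left_mem_closedEdge (isLink_src_tgt (G := Γ.toGraphLikeSpace) e)))
  | tail _ hcommon ih =>
    obtain ⟨o, ho, hgo, hfo⟩ := hcommon
    exact (ih (ho.subset_ground hgo)).trans (joinedByContinuumIn_range_hatIncl_of_isCircuit ho
      (srcV_mem_circ hgo) (srcV_mem_circ hfo))

theorem exists_joinedByContinuumIn_srcV {v : Vert M}
    (hv : v ∈ Γ.toGraphLikeSpace.hatVertices) :
    ∃ e : M.E, JoinedByContinuumIn (range Γ.hatIncl) v (Γ.srcV e) := by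
  rcases hv with ⟨(e : M.E), he⟩ | hv
  · have hlink := isLink_src_tgt (G := Γ.toGraphLikeSpace) e
    refine ⟨e, _, closedEdge_subset_range_hatIncl e,
      isContinuum_closedEdge (G := Γ.toGraphLikeSpace) e, ?_, hlink.left_mem_closedEdge⟩
    rcases he with rfl | rfl
    exacts [hlink.left_mem_closedEdge, hlink.symm.left_mem_closedEdge]
  · obtain ⟨o, ho, hvo⟩ := exists_isCircuit_of_liesOnPseudoCircle hv
    obtain ⟨e, he⟩ := ho.nonempty
    lift e to M.E using ho.subset_ground he
    exact ⟨e, joinedByContinuumIn_range_hatIncl_of_isCircuit ho hvo (closedEdge_subset_circ he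
      (IsLink.left_mem_closedEdge (isLink_src_tgt (G := Γ.toGraphLikeSpace) e)))⟩

theorem isContinuumConnected_range_hatIncl (hM : M.IsConnectedMatroid) :
    IsContinuumConnected (range Γ.hatIncl) := by
  intro u v hu hv
  obtain ⟨e, he⟩ := exists_joinedByContinuumIn_srcV (vertex_mem_range_hatIncl.1 hu)
  obtain ⟨f, hf⟩ := exists_joinedByContinuumIn_srcV (vertex_mem_range_hatIncl.1 hv)
  exact JoinedByContinuumIn.trans he ((joinedByContinuumIn_srcV_srcV hM e f).trans hf.symm)

end T2

theorem locallyPseudoArcConnected_hatSpace (hM : M.IsConnectedMatroid) (Γ : M.GraphFramework) :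
    Γ.hatSpace.LocallyPseudoArcConnected := by
  rcases t2Space_or_isEmpty hM Γ with _ | _
  · exact locallyPseudoArcConnected_of_isContinuumConnected_range isGraphEmbedding_hatIncl
      isClosedSubgraph_range_hatIncl (isContinuumConnected_range_hatIncl hM)
  · exact locallyPseudoArcConnected_of_isEmpty isGraphEmbedding_hatIncl

/-- The inclusion of the standard subspace `X̄` of `Ĝ(M, Γ)` into `G(M, Γ)`. -/
def standardIncl (Γ : M.GraphFramework) (X : Set Γ.hatSpace.E) :
    (Γ.hatSpace.standardSubspace X).Point → Γ.toGraphLikeSpace.Point :=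
  Γ.hatIncl ∘ inclusion (Γ.hatSpace.closureVertices X) X

theorem range_standardIncl (Γ : M.GraphFramework) (X : Set Γ.hatSpace.E) :
    range (Γ.standardIncl X) = Γ.hatIncl '' Γ.hatSpace.standardSet X :=
  range_comp _ _

variable {X : Set Γ.hatSpace.E}

theorem isGraphEmbedding_standardIncl : IsGraphEmbedding (Γ.standardIncl X) :=
  isGraphEmbedding_hatIncl.comp (isGraphEmbedding_inclusion _ _)

theorem exists_of_mem_edgesOf_range_standardIncl {e : M.E}
    (he : e ∈ edgesOf (G := Γ.toGraphLikeSpace) (range (Γ.standardIncl X))) :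
    ∃ e' : X, e'.1.1 = e := by
  obtain ⟨r, v | ⟨s, e'⟩, hp⟩ := he
  · cases hp
  · exact ⟨e', (GraphLikePoint.edgePt.inj hp).2⟩

theorem isClosedSubgraph_range_standardIncl : Γ.IsClosedSubgraph (range (Γ.standardIncl X)) where
  saturated e r r' hr := by
    obtain ⟨e', rfl⟩ := exists_of_mem_edgesOf_range_standardIncl ⟨r, hr⟩
    exact ⟨edgePt r' e', rfl⟩
  left_mem he hlink := by
    obtain ⟨e', rfl⟩ := exists_of_mem_edgesOf_range_standardIncl he
    obtain ⟨rfl, -⟩ | ⟨rfl, -⟩ := hlink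
    exacts [⟨vertex ((Γ.hatSpace.standardSubspace X).src e'), rfl⟩,
      ⟨vertex ((Γ.hatSpace.standardSubspace X).tgt e'), rfl⟩]
  vertex_mem_of_mem_closure v hv hvc := by
    have h : (vertex ⟨v, hv⟩ : Γ.hatSpace.Point) ∈ _root_.closure (Γ.hatSpace.innerPoints X) := by
      rw [isGraphEmbedding_hatIncl.isEmbedding.isInducing.closure_eq_preimage_closure_image]
      refine _root_.closure_mono ?_ hvc
      rintro _ ⟨r, e, he, rfl⟩
      obtain ⟨e', rfl⟩ := exists_of_mem_edgesOf_range_standardIncl he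
      exact ⟨edgePt r e'.1, ⟨r, e'.1, e'.2, rfl⟩, rfl⟩
    exact ⟨vertex ⟨⟨v, hv⟩, h⟩, rfl⟩

theorem isContinuumConnected_range_standardIncl
    (hX : ∀ v w : Γ.hatSpace.V, vertex v ∈ Γ.hatSpace.standardSet X →
      vertex w ∈ Γ.hatSpace.standardSet X →
        Γ.hatSpace.JoinedByPseudoArcIn (Γ.hatSpace.standardSet X) v w) :
    IsContinuumConnected (range (Γ.standardIncl X)) := by
  rintro _ _ ⟨v | ⟨r, e⟩, hv⟩ ⟨w | ⟨s, f⟩, hw⟩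
  · obtain rfl := GraphLikePoint.vertex.inj hv
    obtain rfl := GraphLikePoint.vertex.inj hw
    have h := (hX v.1 w.1 ⟨vertex v, rfl⟩ ⟨vertex w, rfl⟩).joinedByContinuumIn.image
      (Γ.toGraphLikeSpace.subspaceHom _ univ (fun e _ => src_mem_hatVertices e)
        fun e _ => tgt_mem_hatVertices e)
    rw [subspaceHom_toFun] at h
    exact h.mono (range_standardIncl Γ X).superset
  · cases hw
  all_goals cases hv

theorem locallyPseudoArcConnected_standardSubspace (hM : M.IsConnectedMatroid)
    (hX : Γ.hatSpace.IsPseudoArcConnected (Γ.hatSpace.standardSet X)) :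
    (Γ.hatSpace.standardSubspace X).LocallyPseudoArcConnected := by
  rcases t2Space_or_isEmpty hM Γ with _ | _
  · rcases hX with ⟨e, he, -⟩ | ⟨hX, -⟩
    · exact fun x => absurd (he ⟨vertex x, rfl⟩) vertex_notMem_innerPoints
    · exact locallyPseudoArcConnected_of_isContinuumConnected_range isGraphEmbedding_standardIncl
        isClosedSubgraph_range_standardIncl (isContinuumConnected_range_standardIncl hX)
  · exact locallyPseudoArcConnected_of_isEmpty isGraphEmbedding_standardIncl

end Matroid.GraphFramework

theorem mainTheorem6 {α : Type u} (M : Matroid α) (hM : M.IsConnectedMatroid)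
    (Γ : M.GraphFramework) :
    (∀ X : Set Γ.hatSpace.E,
      Γ.hatSpace.IsPseudoArcConnected (Γ.hatSpace.standardSet X) →
        (Γ.hatSpace.standardSubspace X).LocallyPseudoArcConnected) ∧
      Γ.hatSpace.LocallyPseudoArcConnected :=
  ⟨fun _ hX => Matroid.GraphFramework.locallyPseudoArcConnected_standardSubspace hM hX,
    Matroid.GraphFramework.locallyPseudoArcConnected_hatSpace hM Γ⟩
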